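/- **Setting.** Users $[n]$ are the vertices of an undirected graph $\mathcal G=([n],\mathcal E)$; $\mathcal N_i$ is the set of neighbors of $i$. User $i$ holds a dataset $D_i=(\xi_i^1,\dots,\xi_i^m)$, $m\ge 1$, of points of a set $\mathcal X$; for a loss $\ell:\mathbb R^d\times\mathcal X\to\mathbb R$ let $f_i(x)=\frac1m\sum_j \ell(x,\xi_i^j)$, $f=\frac1n\sum_i f_i$, $f_\star=\inf f$. Let $W\in\mathbb R^{n\times n}$ be symmetric and doubly stochastic (with non-negative entries), with $W_{ij}=0$ for distinct non-adjacent $i,j$, and such that for some $p\in(0,1]$ and all $x_1,\dots,x_n\in\mathbb R^d$ with average $\bar x$, $\sum_i\|\sum_jW_{ij}x_j-\bar x\|^2\le(1-p)\sum_i\|x_i-\bar x\|^2$. **Algorithm (DECOR).** Given deterministic $x_i^{(0)}\in\mathbb R^d$, $T\ge1$, stepsizes $\eta_t$ and a threshold $C>0$, for $t=0,\dots,T-1$ every user $i$ draws $\xi_i^{(t)}$ uniformly from $D_i$, computes $g_i^{(t)}=\mathrm{clip}(\nabla\ell(x_i^{(t)},\xi_i^{(t)});C)$ with $\mathrm{clip}(g;C)=\min\{1,C/\|g\|\}g$,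 and broadcasts $x_i^{(t+1/2)}=x_i^{(t)}-\eta_t\big(g_i^{(t)}+\sum_{j\in\mathcal N_i}v_{ij}^{(t)}+\bar v_i^{(t)}\big)$; then $x_i^{(t+1)}=\sum_jW_{ij}x_j^{(t+1/2)}$. Here $v_{ij}^{(t)}=-v_{ji}^{(t)}\sim N(0,\sigma_{\rm cor}^2I_d)$ (one independent vector per edge and iteration), $\bar v_i^{(t)}\sim N(0,\sigma_{\rm cdp}^2I_d)$, and all noises and samples are independent. Let $\bar x^{(t)}=\frac1n\sum_ix_i^{(t)}$, $f_0=f(\bar x^{(0)})-f_\star$, $\Xi_0=\frac1n\sum_i\|x_i^{(0)}-\bar x^{(0)}\|^2$. **Privacy notion.** The secret of an edge $\{i,j\}$ is $(v_{ij}^{(t)})_{t<T}$. The algorithm is $(\varepsilon,\delta)$-SecLDP against collusion at level $q$ if for every $I\subseteq[n]$ with $|I|=q$, all datasets $D,D'$ that differ only in the local dataset of one user outside $I$, all values of the secrets of the edges meeting $I$ and all measurable sets $B$ of transcripts $(x_i^{(t+1/2)})_{i,t}$, conditionally on these values, $\mathbb P[\mathcal A(D)\in B]\le e^\varepsilon\,\mathbb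 P[\mathcal A(D')\in B]+\delta$. **Graph quantities.** $a_q(\mathcal G)$ is the minimum, over the subgraphs obtained by deleting $q$ vertices, of the second-smallest Laplacian eigenvalue; $H=\frac{\sum_{i,k}\|W_i-W_k\|^2\mathbf 1_{k\in\mathcal N_i}}{2\sum_{i,k}\mathbf 1_{k\in\mathcal N_i}}$ with $W_i$ the rows of $W$; $\omega=\|W-\frac1n\mathbf 1\mathbf 1^\top\|_F^2$. **Statement.** There is an absolute constant $K$ such that the following holds. Assume that $\mathcal G$ is $(q+1)$-connected (more than $q+1$ vertices, and connected after deleting any at most $q$ vertices), $\varepsilon>0$, $\delta\in(0,1)$, $\varepsilon\le\log(1/\delta)$, and let $$\sigma_{\rm cdp}^2=\frac{32C^2T\log(1/\delta)}{(n-q)\varepsilon^2},\qquad \sigma_{\rm cor}^2=\frac{32C^2T\log(1/\delta)}{a_q(\mathcal G)\varepsilon^2}.$$ *Privacy.* For all stepsizes DECOR is $(\varepsilon,\delta)$-SecLDP against collusion at level $q$. *Utility.* Assume that every $\ell(\cdot,\xi_i^j)$ is differentiable, every $\nabla f_i$ is $L$-Lipschitz ($L>0$), $f_\star>-\infty$,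 and for constants $P\in\mathbb R$, $M\ge0$, $\sigma_\star,\zeta_\star$ and all $x,x_1,\dots,x_n\in\mathbb R^d$, $$\frac1n\sum_i\frac1m\sum_j\|\nabla\ell(x_i,\xi_i^j)-\nabla f_i(x_i)\|^2\le\sigma_\star^2+\frac Mn\sum_i\|\nabla f(x_i)\|^2,\qquad \frac1n\sum_i\|\nabla f_i(x)\|^2\le\zeta_\star^2+P\|\nabla f(x)\|^2.$$ Assume also that either $\|\nabla\ell(x,\xi_i^j)\|\le C$ for all $x,i,j$, or clipping is omitted from the algorithm (with $\sigma_{\rm cdp},\sigma_{\rm cor}$ as above). Let $c_0=\max\{4\sqrt{3(1-p)(3\max\{1,P\}+pM)},\,2p,\,4pM/n\}$. The expectations below are finite, and: 1. If $\|\nabla f(x)\|^2\ge2\mu(f(x)-f_\star)$ for all $x$, with $\mu>0$, then with $c=\max\{c_0,\mu/L\}$ and $\eta_t=\frac{16}{\mu(t+16cL/(\mu p))}$, $$\mathbb E f(\bar x^{(T)})-f_\star\le K\Big(\frac{LC^2d\log(1/\delta)}{\mu^2n(n-q)\varepsilon^2}+\frac L{\mu^2nT}\Big[\sigma_\star^2+\log(T+1)\frac{LC^2d\log(1/\delta)}{\mu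 p\varepsilon^2}\Big(\frac{H|\mathcal E|}{a_q(\mathcal G)}+\frac n{n-q}\omega\Big)\Big]+\frac{L^2}{\mu^3p^2T^2}\Big[\log(T+1)(1-p)(\zeta_\star^2+p\sigma_\star^2)+c^2\mu f_0+c\mu L\Xi_0\Big]\Big).$$ 2. Without the last assumption, with $\eta_t=\min\Big\{\frac p{2c_0L},\,2\sqrt{\frac{f_0n}{LT(\sigma_\star^2+d\sigma_{\rm cdp}^2)}}\Big\}$ for all $t$, $$\frac1T\sum_{t=0}^{T-1}\mathbb E\|\nabla f(\bar x^{(t)})\|^2\le K\Big(\frac{C\sqrt{Lf_0d\log(1/\delta)}}{\sqrt{n(n-q)}\,\varepsilon}+\sqrt{\frac{Lf_0\sigma_\star^2}{nT}}+\frac{c_0Lf_0}{pT}+\frac{L^2\Xi_0}{pT}+\frac{Lf_0n}{pT}\Big[\frac{(1-p)(\zeta_\star^2/p+\sigma_\star^2)}{\sigma_\star^2+d\sigma_{\rm cdp}^2}+\frac{(n-q)H|\mathcal E|}{n\,a_q(\mathcal G)}+\omega\Big]\Big).$$ -/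

import Mathlib

open MeasureTheory ProbabilityTheory
open scoped Gradient

noncomputable section

namespace Decor

/-! ### Graphs -/

/-- A finite graph is `k`-connected if it has more than `k` vertices and stays connected after
deleting any set of fewer than `k` vertices. -/
def IsKConnected {V : Type*} [Fintype V] (k : ℕ) (G : SimpleGraph V) : Prop :=
  k < Fintype.card V ∧
    ∀ S : Finset V, S.card < k → (G.induce ((S : Set V)ᶜ)).Connected

/-- Algebraic connectivity: the second-smallest eigenvalue, with multiplicity, of the Laplacian
(`eigenvalues₀` lists the eigenvalues in decreasing order). The value `0` for graphs with fewer
than two vertices is a convention. -/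
def algebraicConnectivity {V : Type*} [Fintype V] [DecidableEq V] (G : SimpleGraph V)
    [DecidableRel G.Adj] : ℝ :=
  if h : 2 ≤ Fintype.card V then
    (G.isHermitian_lapMatrix ℝ).eigenvalues₀ ⟨Fintype.card V - 2, by omega⟩
  else 0

/-- `a_q(G)`: the minimum algebraic connectivity over the subgraphs obtained by deleting `q`
vertices (a minimum over finitely many sets `I`). -/
def minAlgConn {n : ℕ} (q : ℕ) (G : SimpleGraph (Fin n)) [DecidableRel G.Adj] : ℝ :=
  ⨅ I : {I : Finset (Fin n) // I.card = q},
    algebraicConnectivity (G.induce (((I.1)ᶜ : Finset (Fin n)) : Set (Fin n)))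

/-- `H_G(W) = (∑_{i,k} ‖W_i - W_k‖² 1_{k ∈ N_i}) / (2 ∑_{i,k} 1_{k ∈ N_i})`. -/
def mixingHeterogeneity {n : ℕ} (G : SimpleGraph (Fin n)) [DecidableRel G.Adj]
    (W : Matrix (Fin n) (Fin n) ℝ) : ℝ :=
  (∑ i, ∑ k, if G.Adj i k then ∑ j, (W i j - W k j) ^ 2 else 0) /
    (2 * ∑ i, ∑ k, if G.Adj i k then (1 : ℝ) else 0)

/-- `‖W - 11ᵀ/n‖_F²`. -/
def distToAverageSq {n : ℕ} (W : Matrix (Fin n) (Fin n) ℝ) : ℝ :=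
  ∑ i, ∑ j, (W i j - 1 / (n : ℝ)) ^ 2

/-- The parameter space `ℝ^d` with the Euclidean norm. -/
abbrev Param (d : ℕ) : Type := EuclideanSpace ℝ (Fin d)

/-- The average of the local models. -/
def average {n d : ℕ} (x : Fin n → Param d) : Param d := (1 / (n : ℝ)) • ∑ i, x i

/-- The consensus distance `(1/n) ∑ ‖x_i - x̄‖²`. -/
def consensusDist {n d : ℕ} (x : Fin n → Param d) : ℝ :=
  (1 / (n : ℝ)) * ∑ i, ‖x i - average x‖ ^ 2

/-- Gossip averaging with weights `W`. -/
def gossip {n d : ℕ} (W : Matrix (Fin n) (Fin n) ℝ) (y : Fin n → Param d) : Fin n → Param d :=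
  fun i => ∑ j, W i j • y j

/-- `W` is a mixing matrix of the graph `G`: symmetric, doubly stochastic, with zero weight
between distinct non-neighbors, and gossip contracts the squared distance to the average by a
factor `1 - p` with `p ∈ (0, 1]`. -/
structure IsMixingMatrix {n : ℕ} (d : ℕ) (G : SimpleGraph (Fin n))
    (W : Matrix (Fin n) (Fin n) ℝ) (p : ℝ) : Prop where
  symm : W.IsSymm
  stochastic : W ∈ doublyStochastic ℝ (Fin n)
  support : ∀ i j, i ≠ j → ¬ G.Adj i j → W i j = 0
  rate_pos : 0 < p
  rate_le_one : p ≤ 1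
  contraction : ∀ x : Fin n → Param d,
    ∑ i, ‖gossip W x i - average x‖ ^ 2 ≤ (1 - p) * ∑ i, ‖x i - average x‖ ^ 2

/-! ### Losses -/

section Loss

variable {n d m : ℕ} {X : Type*}

/-- Local empirical loss of user `i`; the dataset of user `i` is `D i : Fin m → X`. -/
def localLoss (l : Param d → X → ℝ) (D : Fin n → Fin m → X) (i : Fin n) (x : Param d) : ℝ :=
  (1 / (m : ℝ)) * ∑ j, l x (D i j)

/-- Global loss. -/
def globalLoss (l : Param d → X → ℝ) (D : Fin n → Fin m → X) (x : Param d) : ℝ :=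
  (1 / (n : ℝ)) * ∑ i, localLoss l D i x

/-- Infimum of the global loss. -/
def lossInf (l : Param d → X → ℝ) (D : Fin n → Fin m → X) : ℝ := ⨅ x, globalLoss l D x

/-- Standing assumptions on the losses: differentiability, `L`-smoothness of the local losses, a
finite infimum of the global loss, bounded stochastic noise and bounded heterogeneity. -/
structure LossAssumptions (l : Param d → X → ℝ) (D : Fin n → Fin m → X)
    (L P M sigma zeta : ℝ) : Prop where
  differentiable : ∀ i j, Differentiable ℝ (fun x => l x (D i j))
  smooth : ∀ i x y, ‖∇ (localLoss l D i) x - ∇ (localLoss l D i) y‖ ≤ L * ‖x - y‖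
  bddBelow : BddBelow (Set.range (globalLoss l D))
  noise : ∀ x : Fin n → Param d,
    (1 / (n : ℝ)) * ∑ i, (1 / (m : ℝ)) *
        ∑ j, ‖∇ (fun y => l y (D i j)) (x i) - ∇ (localLoss l D i) (x i)‖ ^ 2
      ≤ sigma ^ 2 + M / n * ∑ i, ‖∇ (globalLoss l D) (x i)‖ ^ 2
  heterogeneity : ∀ x : Param d,
    (1 / (n : ℝ)) * ∑ i, ‖∇ (localLoss l D i) x‖ ^ 2
      ≤ zeta ^ 2 + P * ‖∇ (globalLoss l D) x‖ ^ 2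

/-- The Polyak–Łojasiewicz inequality for the global loss. -/
def IsPL (l : Param d → X → ℝ) (D : Fin n → Fin m → X) (mu : ℝ) : Prop :=
  ∀ x, 2 * mu * (globalLoss l D x - lossInf l D) ≤ ‖∇ (globalLoss l D) x‖ ^ 2

end Loss

/-! ### The algorithm -/

/-- Clipping at threshold `C`. -/
def clip {d : ℕ} (C : ℝ) (g : Param d) : Param d := min 1 (C / ‖g‖) • g

/-- The secrets: for every edge, the sequence of noise vectors over the `T` iterations. -/
abbrev Secrets {n : ℕ} (G : SimpleGraph (Fin n)) (T d : ℕ) : Type :=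
  G.edgeSet → Fin T → Param d

/-- The randomness that is not shared: for every iteration and user, the index of the sampled
data point and the uncorrelated noise vector. -/
abbrev Private (n m T d : ℕ) : Type := (Fin T → Fin n → Fin m) × (Fin T → Fin n → Param d)

section Algorithm

variable {n d m T : ℕ} {X : Type*} (G : SimpleGraph (Fin n)) [DecidableRel G.Adj]

/-- `∑_{j ∈ N_i} v_{ij}`, where `v_{ij} = -v_{ji}` is, up to the sign given by the order of `i`
and `j`, the noise attached to the edge `{i, j}`. -/
def pairNoise (u : G.edgeSet → Param d) (i : Fin n) : Param d :=
  ∑ j : G.neighborSet i,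
    if i < j.1 then u ⟨s(i, j.1), j.2⟩ else -u ⟨s(i, j.1), j.2⟩

/-- Noisy local update `x_i - η (κ(∇ℓ(x_i, ξ_i)) + ∑_{j ∈ N_i} v_{ij} + v̄_i)`; the map `κ`
applied to the stochastic gradients is `clip C` in the algorithm. -/
def halfStep (κ : Param d → Param d) (l : Param d → X → ℝ) (D : Fin n → Fin m → X) (eta : ℝ)
    (xi : Fin n → Fin m) (u : G.edgeSet → Param d) (vbar : Fin n → Param d)
    (x : Fin n → Param d) : Fin n → Param d :=
  fun i => x i - eta • (κ (∇ (fun y => l y (D i (xi i))) (x i)) + pairNoise G u i + vbar i)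

/-- The local models after `t ≤ T` iterations (constant in `t` from `T` on). -/
def iterate (κ : Param d → Param d) (l : Param d → X → ℝ) (W : Matrix (Fin n) (Fin n) ℝ)
    (eta : ℕ → ℝ) (x0 : Fin n → Param d) (D : Fin n → Fin m → X)
    (u : Secrets G T d) (r : Private n m T d) : ℕ → Fin n → Param d
  | 0 => x0
  | t + 1 =>
    if h : t < T then
      gossip W (halfStep G κ l D (eta t) (r.1 ⟨t, h⟩) (fun e => u e ⟨t, h⟩) (r.2 ⟨t, h⟩)
        (iterate κ l W eta x0 D u r t))
    else iterate κ l W eta x0 D u r t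

/-- The transcript of all communications: at every iteration every user broadcasts the model
obtained by the noisy local update. -/
def transcript (κ : Param d → Param d) (l : Param d → X → ℝ) (W : Matrix (Fin n) (Fin n) ℝ)
    (eta : ℕ → ℝ) (x0 : Fin n → Param d) (D : Fin n → Fin m → X)
    (u : Secrets G T d) (r : Private n m T d) : Fin T → Fin n → Param d :=
  fun t => halfStep G κ l D (eta t) (r.1 t) (fun e => u e t) (r.2 t)
    (iterate G κ l W eta x0 D u r t)

end Algorithm

/-- The Gaussian measure `N(0, v I_d)`. -/
def gaussian (d : ℕ) (v : ℝ) : Measure (Param d) :=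
  multivariateGaussian 0 (v • (1 : Matrix (Fin d) (Fin d) ℝ))

/-- Law of the secret of one edge: independent `N(0, v I_d)` vectors over the iterations. -/
def edgeSecretLaw (T d : ℕ) (v : ℝ) : Measure (Fin T → Param d) :=
  Measure.pi fun _ => gaussian d v

/-- Law of the unshared randomness: independent uniform indices (the uniform law on all families
of indices), and independently of them independent `N(0, v I_d)` vectors. -/
def privateLaw (n m T d : ℕ) (v : ℝ) : Measure (Private n m T d) :=
  (uniformOn (Set.univ : Set (Fin T → Fin n → Fin m))).prod
    (Measure.pi fun _ => Measure.pi fun _ => gaussian d v)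

/-- Law of all the randomness of the algorithm. -/
def fullLaw {n : ℕ} (G : SimpleGraph (Fin n)) [DecidableRel G.Adj] (m T d : ℕ)
    (vcor vcdp : ℝ) : Measure (Secrets G T d × Private n m T d) :=
  (Measure.pi fun _ : G.edgeSet => edgeSecretLaw T d vcor).prod (privateLaw n m T d vcdp)

/-! ### Secret-based local differential privacy -/

open Classical in
/-- Secret-based local differential privacy of a randomized algorithm `A`, whose transcript
`A D u r` depends on the dataset `D`, on the secrets `u` (independent, `u e ∼ ν e`) and on
further independent randomness `r ∼ ρ`, when the secrets in `hidden` are unknown to the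
adversary. The two sides compare the laws of the transcript conditionally on the values `s` of
the non-hidden secrets: by independence, this conditional law is obtained by freezing these
secrets at `s` and drawing the hidden secrets and `r`. The inequality is required for every
`s`. -/
def SecLDP {Data Edge S R Y : Type*} [Fintype Edge] [MeasurableSpace S] [MeasurableSpace R]
    [MeasurableSpace Y] (ν : Edge → Measure S) (ρ : Measure R)
    (A : Data → (Edge → S) → R → Y) (adjacent : Data → Data → Prop) (hidden : Set Edge)
    (eps delta : ℝ) : Prop :=
  ∀ D D' : Data, adjacent D D' → ∀ s : Edge → S, ∀ B : Set Y, MeasurableSet B →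
    ((Measure.pi ν).prod ρ) {w | A D (fun e => if e ∈ hidden then w.1 e else s e) w.2 ∈ B} ≤
      ENNReal.ofReal (Real.exp eps) *
        ((Measure.pi ν).prod ρ)
          {w | A D' (fun e => if e ∈ hidden then w.1 e else s e) w.2 ∈ B} +
      ENNReal.ofReal delta

/-- The secrets hidden from the group of users `I`: those of the edges with no end in `I`. -/
def hiddenFrom {n : ℕ} (G : SimpleGraph (Fin n)) (I : Finset (Fin n)) : Set G.edgeSet :=
  {e | ∀ i ∈ I, i ∉ e.1}

/-- Two datasets are adjacent, as seen by the colluding group `I`, if they differ at most in the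
local dataset of a single user outside `I`. -/
def AdjacentOutside {n m : ℕ} {X : Type*} (I : Finset (Fin n)) (D D' : Fin n → Fin m → X) :
    Prop :=
  ∃ i, i ∉ I ∧ ∀ j, j ≠ i → D j = D' j

/-- The clipped algorithm is `(eps, delta)`-SecLDP against honest-but-curious users colluding at
level `q`. -/
def DecorSecLDP {n d m T : ℕ} {X : Type*} (G : SimpleGraph (Fin n)) [DecidableRel G.Adj]
    (q : ℕ) (C : ℝ) (l : Param d → X → ℝ) (W : Matrix (Fin n) (Fin n) ℝ) (eta : ℕ → ℝ)
    (x0 : Fin n → Param d) (vcor vcdp eps delta : ℝ) : Prop :=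
  ∀ I : Finset (Fin n), I.card = q →
    SecLDP (fun _ : G.edgeSet => edgeSecretLaw T d vcor) (privateLaw n m T d vcdp)
      (fun D : Fin n → Fin m → X => transcript G (clip C) l W eta x0 D)
      (AdjacentOutside I) (hiddenFrom G I) eps delta

/-! ### Parameters -/

/-- `σ_cdp² = 32 C² T log(1/δ) / ((n - q) ε²)`. -/
def varCdp (n q T : ℕ) (C eps delta : ℝ) : ℝ :=
  32 * C ^ 2 * T * Real.log (1 / delta) / (((n : ℝ) - q) * eps ^ 2)

/-- `σ_cor² = 32 C² T log(1/δ) / (a_q(G) ε²)`. -/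
def varCor {n : ℕ} (G : SimpleGraph (Fin n)) [DecidableRel G.Adj] (q T : ℕ)
    (C eps delta : ℝ) : ℝ :=
  32 * C ^ 2 * T * Real.log (1 / delta) / (minAlgConn q G * eps ^ 2)

/-- `c₀ = max {4 √(3 (1-p) (3 max{1,P} + p M)), 2 p, 4 p M / n}`. -/
def stepConst (n : ℕ) (p P M : ℝ) : ℝ :=
  max (4 * Real.sqrt (3 * (1 - p) * (3 * max 1 P + p * M))) (max (2 * p) (4 * p * M / n))

/-- Stepsizes in the PL case: `η_t = 16 / (μ (t + 16 c L / (μ p)))`, so that `η_0 = p / (c L)`. -/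
def stepPL (mu L p c : ℝ) (t : ℕ) : ℝ := 16 / (mu * (t + 16 * c * L / (mu * p)))

/-- Constant stepsize in the non-convex case:
`min {p / (2 c L), 2 √(f₀ n / (L T (σ⋆² + d σ_cdp²)))}`. -/
def stepNC (n d T : ℕ) (L p c f0 sigma vcdp : ℝ) : ℝ :=
  min (p / (2 * c * L)) (2 * Real.sqrt (f0 * n / (L * T * (sigma ^ 2 + d * vcdp))))

end Decor

end

noncomputable section

/-! Privacy. Two datasets that differ at a user i₀ outside the colluding set I are compared through
a transport Φ of the randomness: a run on D' with noise Φ(w) broadcasts exactly what the run on D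
with noise w broadcasts. At each iteration Φ has to hide the change Δ of the clipped gradient of i₀,
a vector of norm at most 2C. Since the graph stays connected without I, `exists_hidden_flow` spreads
a unit mass from i₀ evenly over the n - q honest users along hidden edges. Solving a Poisson
equation for the Laplacian gives a flow of energy at most 1/a_q, and the uniform remainder has
squared norm 1/(n - q). So Φ shifts the hidden edge noises by the flow times Δ and the private
noises by the remainder times Δ, and with the prescribed variances the squared shift, in units of
variance, is at most ε²/(4T log(1/δ)) per iteration.

The shift depends on the past, so Φ is not a translation. The bound `HolderShift`, a Rényi
divergence estimate in dual form, is stable under adapted composition: by `HolderShift.pi_adapted`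
the constants of the iterations multiply. `HolderShift.measure_le` then turns the total into (ε, δ),
with Rényi order 1 + 2 log(1/δ)/ε.

Utility. Clipping acts as the identity on the gradients that occur, or is absent, so the models form
a Markov chain (`iterateLaw_succ`) and every linear combination of broadcast models is affine in
fresh centred noise (`sum_smul_halfStep`). The average model does not feel the antisymmetric edge
noise; the deviations from the average do, through H|E|. This gives two coupled recursions: the
expected loss decreases by η/4 times the squared gradient up to an error of order ηL² times the
consensus distance (`meanLoss_succ_le`), and the consensus distance contracts by 1 - 11p/24 up to
terms of order η² (`meanConsensus_succ_le`). The Lyapunov function "excess loss + (4ηL²/p) ×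
consensus distance" absorbs the coupling. Under the PL inequality it contracts by 1 - ημ/6, and the
weights (t + k)² sum the recursion; otherwise it telescopes for a constant stepsize. -/

namespace Decor

/-! ### Rearranging the randomness iteration by iteration -/

/-- Exchanging the two indices of a doubly indexed family of independent variables. -/
theorem measurePreserving_pi_swap {ι κ α : Type*} [Fintype ι] [Fintype κ] [MeasurableSpace α]
    (μ : ι → κ → Measure α) [∀ i k, IsProbabilityMeasure (μ i k)] :
    MeasurePreserving (fun (w : ι → κ → α) k i => w i k)
      (Measure.pi fun i => Measure.pi fun k => μ i k)
      (Measure.pi fun k => Measure.pi fun i => μ i k) where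
  measurable := by fun_prop
  map_eq := by
    refine (Measure.pi_eq_generateFrom (fun _ => generateFrom_pi) (fun _ => isPiSystem_pi)
      (fun k => Measure.FiniteSpanningSetsIn.pi fun i => (μ i k).toFiniteSpanningSetsIn) ?_).symm
    intro s hs
    choose r hr hrs using hs
    rw [Measure.map_apply (by fun_prop)]
    · have : (fun (w : ι → κ → α) k i => w i k) ⁻¹' Set.univ.pi s
          = Set.univ.pi fun i => Set.univ.pi fun k => r k i := by
        ext w
        simp only [Set.mem_preimage, Set.mem_univ_pi, ← hrs]
        exact forall_comm
      rw [this, Measure.pi_pi]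
      simp_rw [← hrs, Measure.pi_pi]
      exact Finset.prod_comm
    · refine MeasurableSet.univ_pi fun k => ?_
      rw [← hrs k]
      exact MeasurableSet.univ_pi fun i => (hr k) i (Set.mem_univ i)

instance isProbabilityMeasure_uniformOn_univ {α : Type*} [Fintype α] [Nonempty α]
    [MeasurableSpace α] [MeasurableSingletonClass α] :
    IsProbabilityMeasure (uniformOn (Set.univ : Set α)) :=
  isProbabilityMeasure_uniformOn Set.finite_univ Set.univ_nonempty

theorem uniformOn_univ_pi {ι α : Type*} [Fintype ι] [Fintype α] [MeasurableSpace α]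
    [MeasurableSingletonClass α] :
    uniformOn (Set.univ : Set (ι → α)) = Measure.pi fun _ : ι => uniformOn (Set.univ : Set α) := by
  rw [← uniformOn_pi]
  simp

instance isProbabilityMeasure_gaussian (d : ℕ) (v : ℝ) : IsProbabilityMeasure (gaussian d v) := by
  unfold gaussian; infer_instance

/-- The randomness of one iteration: sampled indices, edge noises, private noises. -/
abbrev StepNoise {n : ℕ} (G : SimpleGraph (Fin n)) (m d : ℕ) : Type :=
  (Fin n → Fin m) × (G.edgeSet → Param d) × (Fin n → Param d)

/-- Law of the randomness of one iteration. -/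
def stepLaw {n : ℕ} (G : SimpleGraph (Fin n)) [DecidableRel G.Adj] (m d : ℕ) (vcor vcdp : ℝ) :
    Measure (StepNoise G m d) :=
  (uniformOn (Set.univ : Set (Fin n → Fin m))).prod
    ((Measure.pi fun _ : G.edgeSet => gaussian d vcor).prod
      (Measure.pi fun _ : Fin n => gaussian d vcdp))

instance isProbabilityMeasure_stepLaw {n : ℕ} (G : SimpleGraph (Fin n)) [DecidableRel G.Adj]
    (m d : ℕ) [NeZero m] (vcor vcdp : ℝ) : IsProbabilityMeasure (stepLaw G m d vcor vcdp) := by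
  unfold stepLaw; infer_instance

/-- Regrouping a family of one-step noises into secrets and private randomness. -/
def regroup {n : ℕ} (G : SimpleGraph (Fin n)) (m T d : ℕ) (w : Fin T → StepNoise G m d) :
    Secrets G T d × Private n m T d :=
  (fun e t => (w t).2.1 e, fun t => (w t).1, fun t => (w t).2.2)

/-- `fullLaw` groups the edge noise by edge, whereas all later arguments run over time. The two
groupings differ by splitting products of pairs, exchanging the edge and time indices and permuting
three independent factors. -/
theorem measurePreserving_regroup {n : ℕ} (G : SimpleGraph (Fin n)) [DecidableRel G.Adj]
    (m T d : ℕ) [NeZero m] (vcor vcdp : ℝ) :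
    MeasurePreserving (regroup G m T d) (Measure.pi fun _ => stepLaw G m d vcor vcdp)
      (fullLaw G m T d vcor vcdp) := by
  have h1 := measurePreserving_arrowProdEquivProdArrow (Fin n → Fin m)
    ((G.edgeSet → Param d) × (Fin n → Param d)) (Fin T)
    (fun _ => uniformOn (Set.univ : Set (Fin n → Fin m)))
    (fun _ => (Measure.pi fun _ : G.edgeSet => gaussian d vcor).prod
      (Measure.pi fun _ : Fin n => gaussian d vcdp))
  have h2 := measurePreserving_arrowProdEquivProdArrow (G.edgeSet → Param d) (Fin n → Param d)
    (Fin T) (fun _ => Measure.pi fun _ : G.edgeSet => gaussian d vcor)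
    (fun _ => Measure.pi fun _ : Fin n => gaussian d vcdp)
  have h3 := measurePreserving_pi_swap (fun (_ : Fin T) (_ : G.edgeSet) => gaussian d vcor)
  have h4 := MeasurePreserving.prod h3
    (MeasurePreserving.id (Measure.pi fun _ : Fin T => Measure.pi fun _ : Fin n => gaussian d vcdp))
  have h5 := MeasurePreserving.prod
    (MeasurePreserving.id (Measure.pi fun _ : Fin T => uniformOn (Set.univ : Set (Fin n → Fin m))))
    (h4.comp h2)
  have h6 := h5.comp h1
  set A := Measure.pi fun _ : Fin T => uniformOn (Set.univ : Set (Fin n → Fin m))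
  set B := Measure.pi fun _ : G.edgeSet => Measure.pi fun _ : Fin T => gaussian d vcor
  set Γ := Measure.pi fun _ : Fin T => Measure.pi fun _ : Fin n => gaussian d vcdp
  have h7 : MeasurePreserving (fun z : (Fin T → Fin n → Fin m) × (G.edgeSet → Fin T → Param d) ×
      (Fin T → Fin n → Param d) => (z.2.1, z.1, z.2.2)) (A.prod (B.prod Γ))
      (B.prod (A.prod Γ)) := by
    have e1 := measurePreserving_prodAssoc A B Γ
    have e2 := measurePreserving_prodAssoc B A Γ
    have e3 := MeasurePreserving.prod (Measure.measurePreserving_swap (μ := A) (ν := B))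
      (MeasurePreserving.id Γ)
    exact (e2.comp e3).comp (e1.symm MeasurableEquiv.prodAssoc)
  have h8 := h7.comp h6
  have hA : A = uniformOn (Set.univ : Set (Fin T → Fin n → Fin m)) := uniformOn_univ_pi.symm
  have : fullLaw G m T d vcor vcdp = B.prod (A.prod Γ) := by
    rw [hA]; rfl
  rw [this]
  exact h8

/-! ### The isotropic Gaussian measure -/

/-- The characteristic function is exp(-v‖t‖²/2) on both sides. The product form lets the
one-dimensional shift estimate be tensorised over coordinates. -/
theorem gaussian_eq_map_pi (d : ℕ) {v : ℝ} (hv : 0 ≤ v) :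
    gaussian d v = (Measure.pi fun _ : Fin d => gaussianReal 0 v.toNNReal).map (WithLp.toLp 2) := by
  have hS : (v • (1 : Matrix (Fin d) (Fin d) ℝ)).PosSemidef := Matrix.PosSemidef.one.smul hv
  apply Measure.ext_of_charFun (E := EuclideanSpace ℝ (Fin d))
  ext t
  rw [gaussian, charFun_multivariateGaussian hS, charFun_pi]
  simp_rw [charFun_gaussianReal]
  rw [← Complex.exp_sum]
  congr 1
  simp only [inner_zero_right, Complex.ofReal_zero, zero_mul, mul_zero, zero_sub,
    Matrix.smul_mulVec, Matrix.one_mulVec, dotProduct_smul, smul_eq_mul, Finset.sum_neg_distrib,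
    Real.coe_toNNReal v hv]
  rw [neg_inj, ← Finset.sum_div]
  congr 1
  simp [dotProduct, Finset.mul_sum, pow_two]

theorem integral_gaussian (d : ℕ) (v : ℝ) : ∫ x, x ∂gaussian d v = 0 := by
  simp [gaussian]

theorem memLp_gaussian (d : ℕ) (v : ℝ) : MemLp (fun x : Param d => x) 2 (gaussian d v) := by
  unfold gaussian; exact IsGaussian.memLp_two_id

theorem integral_norm_sq_gaussian (d : ℕ) {v : ℝ} (hv : 0 ≤ v) :
    ∫ x, ‖x‖ ^ 2 ∂gaussian d v = d * v := by
  have hS : (v • (1 : Matrix (Fin d) (Fin d) ℝ)).PosSemidef := Matrix.PosSemidef.one.smul hv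
  have hi : ∀ i : Fin d, MemLp (fun x : Param d => x i) 2 (gaussian d v) := fun i =>
    (memLp_gaussian d v).continuousLinearMap_comp (EuclideanSpace.proj (𝕜 := ℝ) i)
  simp_rw [EuclideanSpace.real_norm_sq_eq]
  rw [integral_finsetSum _ fun i _ => (hi i).integrable_sq]
  have : ∀ i : Fin d, ∫ x : Param d, x i ^ 2 ∂gaussian d v = v := by
    intro i
    have h : Var[fun x : Param d => x i; gaussian d v] = _ :=
      variance_eval_multivariateGaussian (μ := 0) hS i
    have h0 : ∫ x : Param d, x i ∂gaussian d v = 0 := by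
      have := ContinuousLinearMap.integral_comp_comm (EuclideanSpace.proj (𝕜 := ℝ) i)
        ((memLp_gaussian d v).integrable one_le_two)
      simpa [integral_gaussian] using this
    rw [variance_of_integral_eq_zero ((hi i).aestronglyMeasurable.aemeasurable) h0] at h
    simpa using h
  simp [this]

/-! ### Hölder bounds for transformations of a probability space -/

/-- The image of `μ` under `Ψ` is controlled by `μ` in the sense of Rényi divergences:
`∫ h ∘ Ψ dμ ≤ K (∫ h ^ b dμ) ^ (1 / b)` for all nonnegative measurable `h`. -/
def HolderShift {A : Type*} [MeasurableSpace A] (b : ℝ) (μ : Measure A) (Ψ : A → A)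
    (K : ENNReal) : Prop :=
  ∀ h : A → ENNReal, Measurable h →
    ∫⁻ a, h (Ψ a) ∂μ ≤ K * (∫⁻ a, h a ^ b ∂μ) ^ (1 / b)

section HolderShift

variable {A B : Type*} [MeasurableSpace A] [MeasurableSpace B] {a b : ℝ}

theorem HolderShift.mono {μ : Measure A} {Ψ : A → A} {K K' : ENNReal}
    (h : HolderShift b μ Ψ K) (hK : K ≤ K') : HolderShift b μ Ψ K' :=
  fun g hg => (h g hg).trans (by gcongr)

/-- Hölder's inequality for the density times the test function: the constant is the L^a norm of the
density, which encodes the Rényi divergence of order a. -/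
theorem holderShift_of_density (hab : a.HolderConjugate b) {μ : Measure A} {Ψ : A → A}
    (hΨ : Measurable Ψ) {ρ : A → ENNReal} (hρ : Measurable ρ) (hmap : μ.map Ψ = μ.withDensity ρ)
    {K : ENNReal} (hK : (∫⁻ x, ρ x ^ a ∂μ) ^ (1 / a) ≤ K) : HolderShift b μ Ψ K := by
  intro h hh
  rw [← lintegral_map hh hΨ, hmap, lintegral_withDensity_eq_lintegral_mul _ hρ hh]
  refine (ENNReal.lintegral_mul_le_Lp_mul_Lq μ hab hρ.aemeasurable hh.aemeasurable).trans ?_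
  gcongr

theorem holderShift_id (hab : a.HolderConjugate b) {μ : Measure A} [IsProbabilityMeasure μ] :
    HolderShift b μ id 1 := by
  refine holderShift_of_density hab measurable_id (ρ := fun _ => 1) measurable_const ?_ ?_
  · simp
  · simp

theorem HolderShift.of_measurePreserving {μ : Measure A} {ν : Measure B} (e : A ≃ᵐ B)
    (he : MeasurePreserving e μ ν) {Ψ : A → A} {K : ENNReal}
    (h : HolderShift b μ Ψ K) : HolderShift b ν (fun y => e (Ψ (e.symm y))) K := by
  intro g hg
  rw [← he.lintegral_comp_emb e.measurableEmbedding,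
    ← he.lintegral_comp_emb e.measurableEmbedding]
  simpa using h (fun x => g (e x)) (hg.comp e.measurable)

/-- The second map may depend on the first coordinate as long as its constant does not. The
fibrewise bound produces the function x ↦ ‖h(x, ·)‖_b, to which the first bound applies, and the
exponents 1/b and b cancel. Hence adapted shifts cost no more than fixed ones. -/
theorem HolderShift.prod (hb : 0 < b) {μ : Measure A} {ν : Measure B} [SFinite μ] [SFinite ν]
    {Ψ₁ : A → A} {Ψ₂ : A → B → B} {K₁ K₂ : ENNReal} (h₁ : HolderShift b μ Ψ₁ K₁)
    (h₂ : ∀ x, HolderShift b ν (Ψ₂ x) K₂) (hm₁ : Measurable Ψ₁)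
    (hm₂ : Measurable fun z : A × B => Ψ₂ z.1 z.2) :
    HolderShift b (μ.prod ν) (fun z => (Ψ₁ z.1, Ψ₂ z.1 z.2)) (K₁ * K₂) := by
  intro h hh
  have hm : Measurable fun z : A × B => h (Ψ₁ z.1, Ψ₂ z.1 z.2) := by fun_prop
  have hmb : Measurable fun z : A × B => h z ^ b := by fun_prop
  have hk : Measurable fun x => (∫⁻ y, h (x, y) ^ b ∂ν) ^ (1 / b) :=
    (hmb.lintegral_prod_right').pow_const _
  rw [lintegral_prod _ hm.aemeasurable, lintegral_prod _ hmb.aemeasurable]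
  calc ∫⁻ x, ∫⁻ y, h (Ψ₁ x, Ψ₂ x y) ∂ν ∂μ
      ≤ ∫⁻ x, K₂ * (∫⁻ y, h (Ψ₁ x, y) ^ b ∂ν) ^ (1 / b) ∂μ :=
        lintegral_mono fun x => h₂ x (fun y => h (Ψ₁ x, y)) (by fun_prop)
    _ = K₂ * ∫⁻ x, (∫⁻ y, h (Ψ₁ x, y) ^ b ∂ν) ^ (1 / b) ∂μ :=
        lintegral_const_mul _ (hk.comp hm₁)
    _ ≤ K₂ * (K₁ * (∫⁻ x, ((∫⁻ y, h (x, y) ^ b ∂ν) ^ (1 / b)) ^ b ∂μ) ^ (1 / b)) := by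
        gcongr
        exact h₁ _ hk
    _ = K₁ * K₂ * (∫⁻ x, ∫⁻ y, h (x, y) ^ b ∂ν ∂μ) ^ (1 / b) := by
        simp_rw [← ENNReal.rpow_mul, one_div_mul_cancel hb.ne', ENNReal.rpow_one]
        ring

/-- Composition over time: the coordinate `Φ w t` may depend on the past `w s`, `s < t`. -/
theorem HolderShift.pi_adapted [Nonempty A] (hb : 0 < b) :
    ∀ {T : ℕ} {μ : Fin T → Measure A} [∀ t, IsProbabilityMeasure (μ t)]
      {Φ : (Fin T → A) → Fin T → A} {K : Fin T → ENNReal}, Measurable Φ →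
      (∀ t w w', (∀ s, s ≤ t → w s = w' s) → Φ w t = Φ w' t) →
      (∀ t w, HolderShift b (μ t) (fun z => Φ (Function.update w t z) t) (K t)) →
      HolderShift b (Measure.pi μ) Φ (∏ t, K t) := by
  intro T
  induction T with
  | zero =>
    intro μ _ Φ K hm had hK h hh
    have : ∀ w, Φ w = w := fun w => Subsingleton.elim _ _
    simp only [this, Finset.univ_eq_empty, Finset.prod_empty, one_mul]
    rw [Measure.pi_of_empty μ fun i => i.elim0, lintegral_dirac' _ hh, lintegral_dirac' _ (by fun_prop), ← ENNReal.rpow_mul,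
      mul_one_div_cancel hb.ne', ENNReal.rpow_one]
  | succ T ih =>
    intro μ _ Φ K hm had hK
    obtain ⟨z₀⟩ := ‹Nonempty A›
    -- Time 0 is split off: the component of Φ there ignores later coordinates, and once the first
    -- coordinate is frozen the others form an adapted map over one time step fewer.
    let e := (MeasurableEquiv.piFinSuccAbove (fun _ : Fin (T + 1) => A) 0).symm
    have he : ∀ x y, e (x, y) = Fin.cons x y := fun _ _ => by
      simp [e, Fin.consEquiv]
    have hcons : Measurable fun z : A × (Fin T → A) => (Fin.cons z.1 z.2 : Fin (T + 1) → A) := by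
      have := e.measurable
      convert this using 1
      ext z : 1
      exact (he z.1 z.2).symm
    have hp : MeasurePreserving e ((μ 0).prod (Measure.pi fun j => μ (Fin.succ j)))
        (Measure.pi μ) := by
      exact (measurePreserving_piFinSuccAbove μ 0).symm
    have hcm : ∀ x : A, Measurable fun y : Fin T → A => (Fin.cons x y : Fin (T + 1) → A) :=
      fun x => hcons.comp (measurable_const.prodMk measurable_id)
    have hupd : ∀ (x : A) (w : Fin T → A), Function.update (Fin.cons z₀ w : Fin (T + 1) → A) 0 x
        = Fin.cons x w := fun x w => by simp
    -- The filler `z₀` for the later coordinates is immaterial by adaptedness.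
    have h1 : HolderShift b (μ 0) (fun x => Φ (Fin.cons x fun _ => z₀) 0) (K 0) := by
      have := hK 0 (Fin.cons z₀ fun _ => z₀)
      simpa only [hupd] using this
    have h2 : ∀ x, HolderShift b (Measure.pi fun j => μ (Fin.succ j))
        (fun y => Fin.tail (Φ (Fin.cons x y))) (∏ t, K (Fin.succ t)) := by
      intro x
      refine ih ?_ ?_ ?_
      · have := hm.comp (hcm x)
        unfold Fin.tail
        fun_prop
      · intro t w w' hw
        refine had _ _ _ fun s hs => ?_
        induction s using Fin.cases with
        | zero => simp
        | succ s => simpa using hw s (by simpa using hs)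
      · intro t w
        have := hK t.succ (Fin.cons x w)
        simpa only [Fin.cons_update, Fin.tail] using this
    have h3 := HolderShift.prod hb h1 h2 (by
        have := hm.comp (hcons.comp (measurable_id.prodMk (measurable_const (a := fun _ => z₀))))
        exact (measurable_pi_apply 0).comp this) (by
        have := hm.comp hcons
        unfold Fin.tail
        fun_prop)
    have h4 := h3.of_measurePreserving e hp
    rw [Fin.prod_univ_succ]
    convert h4 using 1
    ext w t
    have hw : w = Fin.cons (w 0) (Fin.tail w) := (Fin.cons_self_tail w).symm
    have hes : e.symm w = (w 0, Fin.tail w) := by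
      rw [MeasurableEquiv.symm_apply_eq, he]; exact hw
    rw [hes, he]
    induction t using Fin.cases with
    | zero =>
      simp only [Fin.cons_zero]
      refine had _ _ _ fun s hs => ?_
      rw [Fin.le_zero_iff.1 hs]; simp
    | succ t =>
      simp only [Fin.cons_succ, Fin.tail]
      rw [← hw]

theorem HolderShift.pi [Nonempty A] (hb : 0 < b) {ι : Type*} [Fintype ι] {μ : ι → Measure A}
    [∀ i, IsProbabilityMeasure (μ i)] {Ψ : ι → A → A} (hm : ∀ i, Measurable (Ψ i))
    {K : ι → ENNReal} (hK : ∀ i, HolderShift b (μ i) (Ψ i) (K i)) :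
    HolderShift b (Measure.pi μ) (fun w i => Ψ i (w i)) (∏ i, K i) := by
  let e := (Fintype.equivFin ι).symm
  have h := HolderShift.pi_adapted hb (μ := fun t => μ (e t)) (Φ := fun w t => Ψ (e t) (w t))
    (K := fun t => K (e t)) (by fun_prop) (fun t w w' hw => by simp [hw t le_rfl])
    (fun t w => by simpa using hK (e t))
  have h2 := h.of_measurePreserving (MeasurableEquiv.piCongrLeft (fun _ => A) e)
    (measurePreserving_piCongrLeft μ e)
  rw [e.prod_comp K] at h2
  convert h2 using 1
  ext w i
  obtain ⟨t, rfl⟩ := e.surjective i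
  rw [MeasurableEquiv.piCongrLeft_apply_apply]
  rfl

end HolderShift

/-! ### Translations of Gaussian measures -/

theorem gaussianReal_eq_withDensity (s : ℝ) {v : NNReal} (hv : v ≠ 0) :
    gaussianReal s v = (gaussianReal 0 v).withDensity
      fun x => ENNReal.ofReal (Real.exp ((s * x - s ^ 2 / 2) / v)) := by
  rw [gaussianReal_of_var_ne_zero _ hv, gaussianReal_of_var_ne_zero _ hv,
    ← withDensity_mul _ (measurable_gaussianPDF _ _) (by fun_prop)]
  congr 1
  ext x
  rw [Pi.mul_apply, gaussianPDF, gaussianPDF, ← ENNReal.ofReal_mul (gaussianPDFReal_nonneg _ _ _)]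
  congr 1
  rw [gaussianPDFReal, gaussianPDFReal, mul_assoc (√_)⁻¹, ← Real.exp_add]
  congr 2
  have : (v : ℝ) ≠ 0 := by exact_mod_cast hv
  field_simp
  ring

/-- The density of the shifted law is the exponential of an affine function, so its a-th moment is a
value of the Gaussian moment generating function, exp(a(a - 1)s²/(2v)); the constant is its a-th
root. -/
theorem holderShift_gaussianReal {a b : ℝ} (hab : a.HolderConjugate b) (s : ℝ) {v : NNReal}
    (hv : v ≠ 0) : HolderShift b (gaussianReal 0 v) (fun x => x + s)
      (ENNReal.ofReal (Real.exp ((a - 1) / 2 * (s ^ 2 / v)))) := by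
  have ha := hab.pos
  have hv' : (v : ℝ) ≠ 0 := by exact_mod_cast hv
  refine holderShift_of_density hab (by fun_prop)
    (ρ := fun x => ENNReal.ofReal (Real.exp ((s * x - s ^ 2 / 2) / v))) (by fun_prop)
    ((gaussianReal_map_add_const s).trans ?_) ?_
  · rw [zero_add]; exact gaussianReal_eq_withDensity s hv
  · have h1 : ∀ x : ℝ, ENNReal.ofReal (Real.exp ((s * x - s ^ 2 / 2) / v)) ^ a
        = ENNReal.ofReal (Real.exp (-(a * s ^ 2 / (2 * v))) * Real.exp (a * s / v * x)) := by
      intro x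
      rw [ENNReal.ofReal_rpow_of_nonneg (Real.exp_nonneg _) ha.le, ← Real.exp_mul, ← Real.exp_add]
      congr 2
      field_simp
      ring
    have h2 : ∫ x, Real.exp (a * s / v * x) ∂gaussianReal 0 v
        = Real.exp (v * (a * s / v) ^ 2 / 2) := by
      have := congrFun (mgf_id_gaussianReal (μ := 0) (v := v)) (a * s / v)
      simpa [mgf] using this
    simp_rw [h1]
    rw [← ofReal_integral_eq_lintegral_ofReal
      ((integrable_exp_mul_gaussianReal _).const_mul _) (Filter.Eventually.of_forall fun x => by
        positivity), integral_const_mul, h2, ← Real.exp_add,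
      ENNReal.ofReal_rpow_of_nonneg (Real.exp_nonneg _) (by positivity), ← Real.exp_mul]
    apply le_of_eq
    congr 2
    field_simp
    ring

theorem holderShift_gaussian {a b : ℝ} (hab : a.HolderConjugate b) {d : ℕ} (s : Param d) {v : ℝ}
    (hv : 0 < v) : HolderShift b (gaussian d v) (fun x => x + s)
      (ENNReal.ofReal (Real.exp ((a - 1) / 2 * (‖s‖ ^ 2 / v)))) := by
  have hv' : v.toNNReal ≠ 0 := by simpa using hv
  have h := HolderShift.pi hab.symm.pos (μ := fun _ : Fin d => gaussianReal 0 v.toNNReal)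
    (Ψ := fun i x => x + s i) (fun i => by fun_prop)
    (fun i => holderShift_gaussianReal hab (s i) hv')
  have h2 := h.of_measurePreserving (MeasurableEquiv.toLp 2 (Fin d → ℝ))
    ⟨(MeasurableEquiv.toLp 2 (Fin d → ℝ)).measurable, (gaussian_eq_map_pi d hv.le).symm⟩
  have h3 : ∏ i, ENNReal.ofReal (Real.exp ((a - 1) / 2 * (s i ^ 2 / v.toNNReal)))
      = ENNReal.ofReal (Real.exp ((a - 1) / 2 * (‖s‖ ^ 2 / v))) := by
    rw [← ENNReal.ofReal_prod_of_nonneg fun i _ => Real.exp_nonneg _, ← Real.exp_sum,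
      ← Finset.mul_sum, ← Finset.sum_div, EuclideanSpace.real_norm_sq_eq, Real.coe_toNNReal v hv.le]
  rw [h3] at h2
  exact h2

theorem holderShift_pi_gaussian {a b : ℝ} (hab : a.HolderConjugate b) {ι : Type*} [Fintype ι]
    {d : ℕ} (s : ι → Param d) {v : ℝ} (hv : 0 < v) :
    HolderShift b (Measure.pi fun _ : ι => gaussian d v) (fun x => x + s)
      (ENNReal.ofReal (Real.exp ((a - 1) / 2 * ((∑ i, ‖s i‖ ^ 2) / v)))) := by
  have h := HolderShift.pi hab.symm.pos (μ := fun _ : ι => gaussian d v)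
    (Ψ := fun i x => x + s i) (fun i => by fun_prop)
    (fun i => holderShift_gaussian hab (s i) hv)
  rw [← ENNReal.ofReal_prod_of_nonneg fun i _ => Real.exp_nonneg _, ← Real.exp_sum,
      ← Finset.mul_sum, ← Finset.sum_div] at h
  exact h

/-- Translating the Gaussian noises of one iteration by vectors depending on the sampled
indices. -/
theorem holderShift_stepLaw {n m d : ℕ} [NeZero m] (G : SimpleGraph (Fin n)) [DecidableRel G.Adj]
    {a b : ℝ} (hab : a.HolderConjugate b) {vcor vcdp R : ℝ} (hcor : 0 < vcor) (hcdp : 0 < vcdp)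
    (su : (Fin n → Fin m) → G.edgeSet → Param d) (sv : (Fin n → Fin m) → Fin n → Param d)
    (hR : ∀ xi, (∑ e, ‖su xi e‖ ^ 2) / vcor + (∑ i, ‖sv xi i‖ ^ 2) / vcdp ≤ R) :
    HolderShift b (stepLaw G m d vcor vcdp) (fun z => (z.1, z.2.1 + su z.1, z.2.2 + sv z.1))
      (ENNReal.ofReal (Real.exp ((a - 1) / 2 * R))) := by
  have hb := hab.symm.pos
  have ha : 0 ≤ (a - 1) / 2 := by linarith [hab.lt]
  -- The sampled indices are not moved and cost a factor 1; given them, the shift is a fixed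
  -- translation.
  have h := HolderShift.prod hb
    (holderShift_id hab (μ := uniformOn (Set.univ : Set (Fin n → Fin m))))
    (Ψ₂ := fun xi (y : (G.edgeSet → Param d) × (Fin n → Param d)) => (y.1 + su xi, y.2 + sv xi))
    (ν := (Measure.pi fun _ : G.edgeSet => gaussian d vcor).prod
      (Measure.pi fun _ : Fin n => gaussian d vcdp))
    (K₂ := ENNReal.ofReal (Real.exp ((a - 1) / 2 * R)))
    (fun xi => by
      refine (HolderShift.prod hb (holderShift_pi_gaussian hab (su xi) hcor)
        (fun _ => holderShift_pi_gaussian hab (sv xi) hcdp) (by fun_prop) (by fun_prop)).mono ?_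
      rw [← ENNReal.ofReal_mul (Real.exp_nonneg _), ← Real.exp_add, ← mul_add]
      exact ENNReal.ofReal_le_ofReal (Real.exp_le_exp.2 (mul_le_mul_of_nonneg_left (hR xi) ha)))
    measurable_id (by
      have h1 : Measurable su := measurable_of_finite _
      have h2 : Measurable sv := measurable_of_finite _
      fun_prop)
  rw [one_mul] at h
  exact h

/-- A Hölder bound gives approximate differential privacy. -/
theorem HolderShift.measure_le {A : Type*} [MeasurableSpace A] {μ : Measure A} {Ψ : A → A}
    {a b D eps delta : ℝ} (hab : a.HolderConjugate b) (hdelta : 0 < delta)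
    (hΨ : HolderShift b μ Ψ (ENNReal.ofReal (Real.exp ((a - 1) / 2 * D))))
    (hD : a * D / 2 + Real.log (1 / delta) / (a - 1) ≤ eps) {S : Set A} (hS : MeasurableSet S)
    (hm : Measurable Ψ) :
    μ (Ψ ⁻¹' S) ≤ ENNReal.ofReal (Real.exp eps) * μ S + ENNReal.ofReal delta := by
  have ha := hab.lt
  have hb := hab.symm.pos
  -- An indicator equals its own b-th power, so the bound compares the probability of the preimage
  -- with μ(S)^(1/b).
  have h := hΨ (S.indicator 1) (measurable_one.indicator hS)
  have h1 : ∀ x, S.indicator (1 : A → ENNReal) (Ψ x) = (Ψ ⁻¹' S).indicator 1 x := fun x => rfl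
  have h2 : ∀ x, S.indicator (1 : A → ENNReal) x ^ b = S.indicator 1 x := by
    intro x
    by_cases hx : x ∈ S <;> simp [hx, hb]
  simp_rw [h1, h2] at h
  rw [lintegral_indicator_one (hm hS), lintegral_indicator_one hS] at h
  refine h.trans ?_
  have hl : Real.log (1 / delta) = -Real.log delta := by simp
  have hinv : 1 / b + 1 / a = 1 := by
    rw [add_comm, one_div, one_div]; exact hab.inv_add_inv_eq_one
  have ha1 : 0 < a - 1 := by linarith
  have ha0 : 0 < a := by linarith
  have hbe : 1 / b = (a - 1) / a := by
    have : (a - 1) / a = 1 - 1 / a := by field_simp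
    linarith
  set x := ENNReal.ofReal (Real.exp eps) * μ S with hx
  set y := ENNReal.ofReal delta with hy
  -- In logarithms, this is the assumption on `D` multiplied by (a - 1)/a = 1/b.
  have hK : ENNReal.ofReal (Real.exp ((a - 1) / 2 * D))
      ≤ ENNReal.ofReal (Real.exp eps) ^ (1 / b) * y ^ (1 / a) := by
    rw [hy, ← Real.exp_log hdelta,
      ENNReal.ofReal_rpow_of_nonneg (Real.exp_nonneg _) (by positivity),
      ENNReal.ofReal_rpow_of_nonneg (Real.exp_nonneg _) (by positivity), ← Real.exp_mul,
      ← Real.exp_mul, ← ENNReal.ofReal_mul (Real.exp_nonneg _), ← Real.exp_add]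
    refine ENNReal.ofReal_le_ofReal (Real.exp_le_exp.2 ?_)
    rw [hl] at hD
    have := mul_le_mul_of_nonneg_right hD (div_pos ha1 ha0).le
    rw [hbe]
    have e1 : (a * D / 2 + -Real.log delta / (a - 1)) * ((a - 1) / a)
      = (a - 1) / 2 * D - Real.log delta * (1 / a) := by field_simp; ring
    linarith
  calc ENNReal.ofReal (Real.exp ((a - 1) / 2 * D)) * μ S ^ (1 / b)
      ≤ ENNReal.ofReal (Real.exp eps) ^ (1 / b) * y ^ (1 / a) * μ S ^ (1 / b) := by gcongr
    _ = x ^ (1 / b) * y ^ (1 / a) := by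
        rw [hx, ENNReal.mul_rpow_of_nonneg _ _ (by positivity)]; ring
    -- A weighted geometric mean is at most the maximum, hence at most the sum.
    _ ≤ (max x y) ^ (1 / b) * (max x y) ^ (1 / a) := by
        gcongr
        · exact le_max_left _ _
        · exact le_max_right _ _
    _ = max x y := by
        rw [← ENNReal.rpow_add_of_nonneg _ _ (by positivity) (by positivity), hinv,
          ENNReal.rpow_one]
    _ ≤ x + y := max_le le_self_add le_add_self

/-! ### Flows on connected graphs -/

section Flow

variable {V : Type*} [Fintype V] [DecidableEq V] (G : SimpleGraph V) [DecidableRel G.Adj]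

/-- The kernel of the Laplacian of a connected graph is one-dimensional. If the second-smallest
eigenvalue vanished, so would the smallest, and the rank would be at most |V| - 2. -/
theorem algebraicConnectivity_pos (hG : G.Connected) (hV : 2 ≤ Fintype.card V) :
    0 < algebraicConnectivity G := by
  have hA := G.isHermitian_lapMatrix ℝ
  have hps := G.posSemidef_lapMatrix ℝ
  rw [algebraicConnectivity, dif_pos hV]
  by_contra hle
  have hsub : Subsingleton G.ConnectedComponent := hG.preconnected.subsingleton_connectedComponent
  have hker := G.card_connectedComponent_eq_finrank_ker_toLin'_lapMatrix
  have hcard : Fintype.card G.ConnectedComponent ≤ 1 := Fintype.card_le_one_iff_subsingleton.2 hsub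
  have hrn := LinearMap.finrank_range_add_finrank_ker (Matrix.toLin' (G.lapMatrix ℝ))
  have hrank : (G.lapMatrix ℝ).rank = Fintype.card {i // hA.eigenvalues i ≠ 0} :=
    hA.rank_eq_card_non_zero_eigs
  have hr : (G.lapMatrix ℝ).rank = Module.finrank ℝ (LinearMap.range (Matrix.toLin' (G.lapMatrix ℝ))) := by
    rw [Matrix.rank, Matrix.toLin'_apply']
  rw [← hker, ← hr, Module.finrank_fintype_fun_eq_card] at hrn
  let e : Fin (Fintype.card V) ≃ V := Fintype.equivOfCardEq (Fintype.card_fin _)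
  have hev : ∀ i, hA.eigenvalues (e i) = hA.eigenvalues₀ i := fun i => by
    simp [Matrix.IsHermitian.eigenvalues, e]
  let i₁ : Fin (Fintype.card V) := ⟨Fintype.card V - 2, by omega⟩
  let i₂ : Fin (Fintype.card V) := ⟨Fintype.card V - 1, by omega⟩
  have h1 : hA.eigenvalues₀ i₁ ≤ 0 := not_lt.1 hle
  have h2 : hA.eigenvalues₀ i₂ ≤ hA.eigenvalues₀ i₁ :=
    hA.eigenvalues₀_antitone (by simp [i₁, i₂, Fin.le_def]; omega)
  have hz₁ : hA.eigenvalues (e i₁) = 0 := le_antisymm (by rw [hev]; exact h1) (hps.eigenvalues_nonneg _)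
  have hz₂ : hA.eigenvalues (e i₂) = 0 :=
    le_antisymm (by rw [hev]; exact h2.trans h1) (hps.eigenvalues_nonneg _)
  have hne : e i₁ ≠ e i₂ := by
    rw [Ne, e.injective.eq_iff]; simp [i₁, i₂, Fin.ext_iff]; omega
  have hsubset : (Finset.univ.filter fun i => hA.eigenvalues i ≠ 0) ⊆ Finset.univ \ {e i₁, e i₂} := by
    intro i hi
    simp only [Finset.mem_filter, Finset.mem_univ, true_and] at hi
    simp only [Finset.mem_sdiff, Finset.mem_univ, true_and, Finset.mem_insert,
      Finset.mem_singleton, not_or]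
    exact ⟨fun h => hi (h ▸ hz₁), fun h => hi (h ▸ hz₂)⟩
  have hc := Finset.card_le_card hsubset
  rw [Finset.card_sdiff_of_subset (Finset.subset_univ _), Finset.card_pair hne, Finset.card_univ,
    ← Fintype.card_subtype, ← hrank] at hc
  omega

/-- Solving the Poisson equation on a connected graph, with an energy bound. -/
theorem exists_lapMatrix_mulVec_eq (hG : G.Connected) (hV : 2 ≤ Fintype.card V) {x : V → ℝ}
    (hx : ∑ i, x i = 0) :
    ∃ y, (G.lapMatrix ℝ).mulVec y = x ∧ y ⬝ᵥ x ≤ (∑ i, x i ^ 2) / algebraicConnectivity G := by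
  have ha := algebraicConnectivity_pos G hG hV
  have hA := G.isHermitian_lapMatrix ℝ
  have hps := G.posSemidef_lapMatrix ℝ
  set a := algebraicConnectivity G with hadef
  have hae : a = hA.eigenvalues₀ ⟨Fintype.card V - 2, by omega⟩ := by
    rw [hadef, algebraicConnectivity, dif_pos hV]
  let e : Fin (Fintype.card V) ≃ V := Fintype.equivOfCardEq (Fintype.card_fin _)
  have hev : ∀ i, hA.eigenvalues (e i) = hA.eigenvalues₀ i := fun i => by
    simp [Matrix.IsHermitian.eigenvalues, e]
  let j₀ : V := e ⟨Fintype.card V - 1, by omega⟩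
  have hge : ∀ j, j ≠ j₀ → a ≤ hA.eigenvalues j := by
    intro j hj
    obtain ⟨i, rfl⟩ := e.surjective j
    rw [hev, hae]
    apply hA.eigenvalues₀_antitone
    have : i ≠ ⟨Fintype.card V - 1, by omega⟩ := fun h => hj (by rw [h])
    have h1 : i.1 ≠ Fintype.card V - 1 := fun h => this (Fin.ext h)
    have := i.2
    rw [Fin.le_def]; simp only; omega
  let v := hA.eigenvectorBasis
  have hv : ∀ j, (G.lapMatrix ℝ).mulVec (v j) = hA.eigenvalues j • (v j : V → ℝ) := fun j =>
    hA.mulVec_eigenvectorBasis j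
  let X : EuclideanSpace ℝ V := WithLp.toLp 2 x
  have h0 : ∀ j, hA.eigenvalues j = 0 → inner ℝ (v j) X = 0 := by
    intro j hj
    have h1 := hv j
    rw [hj, zero_smul, G.lapMatrix_mulVec_eq_zero_iff_forall_reachable] at h1
    obtain ⟨k⟩ : Nonempty V := hG.nonempty
    have h2 : ∀ i, v j i = v j k := fun i => h1 i k (hG.preconnected i k)
    rw [PiLp.inner_apply]
    simp only [h2, RCLike.inner_apply, conj_trivial, X]
    rw [← Finset.sum_mul, hx, zero_mul]
  -- The last eigenvalue must be zero, since otherwise the Laplacian would be invertible; its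
  -- eigenvector is then constant and orthogonal to x.
  have hin : ∀ j, j = j₀ → inner ℝ (v j) X = 0 := by
    rintro j rfl
    by_cases hz : hA.eigenvalues j₀ = 0
    · exact h0 _ hz
    · exfalso
      have hpos : ∀ j, hA.eigenvalues j ≠ 0 := fun j => by
        by_cases hj : j = j₀
        · rw [hj]; exact hz
        · exact (ha.trans_le (hge j hj)).ne'
      have hdet : (G.lapMatrix ℝ).det ≠ 0 := by
        rw [hA.det_eq_prod_eigenvalues]
        exact Finset.prod_ne_zero_iff.2 fun j _ => by simpa using hpos j
      have : Nonempty V := hG.nonempty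
      exact hdet G.det_lapMatrix_eq_zero
  -- Spectral inverse on the complement of the constants. The term at `j₀` has zero numerator, so
  -- the division by zero there is harmless.
  let Y : EuclideanSpace ℝ V := ∑ j, (inner ℝ (v j) X / hA.eigenvalues j) • v j
  have hX : ∑ j, inner ℝ (v j) X • v j = X := v.sum_repr' X
  refine ⟨Y, ?_, ?_⟩
  · have h1 : (Y : V → ℝ) = ∑ j, (inner ℝ (v j) X / hA.eigenvalues j) • (v j : V → ℝ) := by
      simp [Y]
    rw [h1, Matrix.mulVec_sum]
    simp_rw [Matrix.mulVec_smul, hv, smul_smul]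
    have h2 : x = ∑ j, inner ℝ (v j) X • (v j : V → ℝ) := by
      have := congrArg (WithLp.ofLp (p := 2)) hX
      simpa [X] using this.symm
    conv_rhs => rw [h2]
    refine Finset.sum_congr rfl fun j _ => ?_
    by_cases hj : j = j₀
    · simp [hin j hj]
    · rw [div_mul_cancel₀ _ (ha.trans_le (hge j hj)).ne']
  · have h1 : (Y : V → ℝ) ⬝ᵥ x = inner ℝ Y X := by
      simp [PiLp.inner_apply, dotProduct, X, mul_comm]
    have h2 : inner ℝ Y X = ∑ j, inner ℝ (v j) X ^ 2 / hA.eigenvalues j := by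
      simp only [Y, sum_inner, real_inner_smul_left]
      exact Finset.sum_congr rfl fun j _ => by ring
    have h3 : ∑ i, x i ^ 2 = ∑ j, inner ℝ (v j) X ^ 2 := by
      rw [v.sum_sq_inner_right X, EuclideanSpace.real_norm_sq_eq]
    rw [h1, h2, h3, Finset.sum_div]
    refine Finset.sum_le_sum fun j _ => ?_
    by_cases hj : j = j₀
    · simp [hin j hj]
    · exact div_le_div_of_nonneg_left (sq_nonneg _) ha (hge j hj)

end Flow

/-! ### Sums over oriented edges and flows avoiding the colluding users -/

section Edges

variable {n : ℕ} (G : SimpleGraph (Fin n)) [DecidableRel G.Adj]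

/-- Ordered adjacent pairs are darts, and every edge carries exactly two of them. -/
theorem sum_neighborSet_edge {E : Type*} [AddCommMonoid E] (F : G.edgeSet → E) :
    ∑ i, ∑ j : G.neighborSet i, F ⟨s(i, j.1), j.2⟩ = 2 • ∑ e, F e := by
  rw [← Fintype.sum_sigma' (fun i (j : G.neighborSet i) => F ⟨s(i, j.1), j.2⟩)]
  have h1 : ∑ x : (i : Fin n) × G.neighborSet i, F ⟨s(x.1, x.2.1), x.2.2⟩
      = ∑ x : G.Dart, F ⟨x.edge, x.edge_mem⟩ := by
    refine Fintype.sum_bijective (fun x => (⟨(x.1, x.2.1), x.2.2⟩ : G.Dart)) ⟨?_, ?_⟩ _ _ ?_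
    · rintro ⟨i, j, hj⟩ ⟨i', j', hj'⟩ h
      simp only at h
      obtain ⟨rfl, rfl⟩ := h
      rfl
    · rintro ⟨⟨i, j⟩, h⟩
      exact ⟨⟨i, j, h⟩, rfl⟩
    · intro x; rfl
  rw [h1, ← Finset.sum_fiberwise (g := fun x : G.Dart => (⟨x.edge, x.edge_mem⟩ : G.edgeSet)),
    Finset.smul_sum]
  refine Finset.sum_congr rfl fun e _ => ?_
  rw [Finset.sum_congr rfl (g := fun _ => F e) fun x hx => ?_]
  · rw [Finset.sum_const, ← G.dart_edge_fiber_card e.1 e.2]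
    congr 3
    ext x
    simp [Subtype.ext_iff]
  · simp only [Finset.mem_filter, Finset.mem_univ, true_and] at hx
    rw [hx]

/-- The value of an antisymmetric function along an edge oriented from its smaller end to its
larger end. -/
def edgeValue (g : Fin n → Fin n → ℝ) (e : Sym2 (Fin n)) : ℝ :=
  Sym2.lift ⟨fun i j => if i < j then g i j else g j i, fun i j => by
    rcases lt_trichotomy i j with h | h | h
    · simp [h, h.not_gt]
    · simp [h]
    · simp [h, h.not_gt]⟩ e

theorem edgeValue_mk (g : Fin n → Fin n → ℝ) (i j : Fin n) :
    edgeValue g s(i, j) = if i < j then g i j else g j i := rfl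

theorem edgeValue_sq {g : Fin n → Fin n → ℝ} (hg : ∀ i j, g i j = -g j i) (i j : Fin n) :
    edgeValue g s(i, j) ^ 2 = g i j ^ 2 := by
  rw [edgeValue_mk]
  split_ifs
  · rfl
  · rw [hg i j, neg_sq]

/-- The sign convention of `pairNoise` undoes the orientation chosen in `edgeValue`, so what reaches
a vertex is the divergence of the antisymmetric flow g. -/
theorem pairNoise_edgeValue {d : ℕ} {g : Fin n → Fin n → ℝ} (hg : ∀ i j, g i j = -g j i)
    (Δ : Param d) (i : Fin n) :
    pairNoise G (fun e => edgeValue g e.1 • Δ) i = (∑ j : G.neighborSet i, g i j.1) • Δ := by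
  rw [pairNoise, Finset.sum_smul]
  refine Finset.sum_congr rfl fun j _ => ?_
  rw [edgeValue_mk]
  split_ifs with h
  · rfl
  · rw [hg i j.1, neg_smul]

theorem sum_neighborSet {E : Type*} [AddCommMonoid E] (i : Fin n)
    (F : ∀ j, G.Adj i j → E) :
    ∑ j : G.neighborSet i, F j.1 j.2 = ∑ j, if h : G.Adj i j then F j h else 0 := by
  rw [Finset.sum_dite, Finset.sum_const_zero, add_zero]
  refine Fintype.sum_bijective
    (fun j => ⟨j.1, Finset.mem_filter.2 ⟨Finset.mem_univ _, j.2⟩⟩) ⟨?_, ?_⟩ _ _ fun j => rfl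
  · intro j j' h
    exact Subtype.ext (congrArg (fun x => x.1) h)
  · rintro ⟨j, hj⟩; exact ⟨⟨j, (Finset.mem_filter.1 hj).2⟩, rfl⟩

/-- Summation by parts on the graph: each edge noise enters at its two ends with opposite signs. For
constant weights everything cancels. -/
theorem sum_smul_pairNoise {d : ℕ} (A : Fin n → ℝ) (u : G.edgeSet → Param d) :
    ∑ i, A i • pairNoise G u i = ∑ e, edgeValue (fun i j => A i - A j) e.1 • u e := by
  have key := sum_neighborSet_edge G (fun e => edgeValue (fun i j => A i - A j) e.1 • u e)
  have h1 : ∑ i, A i • pairNoise G u i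
      = ∑ i, ∑ j, if h : G.Adj i j then
          A i • (if i < j then u ⟨s(i, j), h⟩ else -u ⟨s(i, j), h⟩) else 0 := by
    refine Finset.sum_congr rfl fun i _ => ?_
    rw [pairNoise, Finset.smul_sum]
    exact sum_neighborSet G i fun j h => A i • (if i < j then u ⟨s(i, j), h⟩ else -u ⟨s(i, j), h⟩)
  -- The identity is proved after doubling, so that the two orientations of each edge can be paired.
  have h3 : (2 : ℕ) • ∑ i, A i • pairNoise G u i
      = (2 : ℕ) • ∑ e, edgeValue (fun i j => A i - A j) e.1 • u e := by
    rw [← key, two_smul]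
    have h2 := h1
    rw [Finset.sum_comm] at h2
    nth_rewrite 1 [h1]
    rw [h2, ← Finset.sum_add_distrib]
    refine Finset.sum_congr rfl fun i _ => ?_
    rw [sum_neighborSet G i fun j h => edgeValue (fun i j => A i - A j) s(i, j) • u ⟨s(i, j), h⟩,
      ← Finset.sum_add_distrib]
    refine Finset.sum_congr rfl fun j _ => ?_
    by_cases h : G.Adj i j
    · have hs : (⟨s(j, i), h.symm⟩ : G.edgeSet) = ⟨s(i, j), h⟩ := Subtype.ext Sym2.eq_swap
      rw [dif_pos h, dif_pos h, dif_pos h.symm, hs, edgeValue_mk]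
      rcases lt_or_gt_of_ne h.ne with hlt | hlt
      · simp only [hlt, hlt.not_gt, if_true, if_false, sub_smul, smul_neg]; abel
      · simp only [hlt, hlt.not_gt, if_true, if_false, sub_smul, smul_neg]; abel
    · have h' : ¬ G.Adj j i := fun h' => h h'.symm
      simp [h, h']
  simpa [two_nsmul, ← two_smul ℝ] using h3

/-- Spreading a unit mass placed at `i₀ ∉ I` evenly over the complement of `I`, along edges that
avoid `I`. -/
theorem exists_hidden_flow {q : ℕ} (hG : IsKConnected (q + 1) G) {I : Finset (Fin n)}
    (hI : I.card = q) {i₀ : Fin n} (hi₀ : i₀ ∉ I) :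
    ∃ (φ : G.edgeSet → ℝ) (ψ : Fin n → ℝ), (∀ e, e ∉ hiddenFrom G I → φ e = 0) ∧
      (∀ (d : ℕ) (Δ : Param d) k,
        pairNoise G (fun e => φ e • Δ) k + ψ k • Δ = if k = i₀ then Δ else 0) ∧
      ∑ e, φ e ^ 2 ≤ 1 / algebraicConnectivity (G.induce ((Iᶜ : Finset (Fin n)) : Set (Fin n))) ∧
      ∑ k, ψ k ^ 2 = 1 / ((n : ℝ) - q) := by
  set S : Set (Fin n) := ((Iᶜ : Finset (Fin n)) : Set (Fin n)) with hS
  have hmem : ∀ i, i ∈ S ↔ i ∉ I := fun i => by simp [hS]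
  have hn := hG.1
  rw [Fintype.card_fin] at hn
  have hcard : Fintype.card S = n - q := by
    have : Fintype.card S = (Iᶜ).card := by
      rw [← Fintype.card_coe]; rfl
    rw [this, Finset.card_compl, Fintype.card_fin, hI]
  have hconn : (G.induce S).Connected := by
    have := hG.2 I (by omega)
    rwa [hS, Finset.coe_compl]
  have hN : (0 : ℝ) < (n : ℝ) - q := by
    have : (q : ℝ) < n := by exact_mod_cast (by omega : q < n)
    linarith
  have hcardR : (Fintype.card S : ℝ) = (n : ℝ) - q := by
    rw [hcard, Nat.cast_sub (by omega)]
  -- Unit source at i₀ minus the uniform mass: the total is zero, as the Poisson equation requires,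
  -- and the squared norm is 1 - 1/(n - q).
  let x : S → ℝ := fun i => (if i.1 = i₀ then 1 else 0) - 1 / ((n : ℝ) - q)
  let s₀ : S := ⟨i₀, (hmem i₀).2 hi₀⟩
  have hite : ∀ i : S, (if i.1 = i₀ then (1 : ℝ) else 0) = if i = s₀ then 1 else 0 := fun i => by
    simp [s₀, Subtype.ext_iff]
  have hx : ∑ i, x i = 0 := by
    simp only [x, hite, Finset.sum_sub_distrib, Finset.sum_ite_eq', Finset.mem_univ, if_true,
      Finset.sum_const, Finset.card_univ, nsmul_eq_mul, hcardR]
    field_simp; ring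
  have hx2 : ∑ i, x i ^ 2 ≤ 1 := by
    have : ∀ i, x i ^ 2 = (if i = s₀ then 1 else 0)
        - 2 / ((n : ℝ) - q) * (if i = s₀ then 1 else 0) + 1 / ((n : ℝ) - q) ^ 2 := by
      intro i
      simp only [x, hite]
      generalize (n : ℝ) - q = r
      rw [sub_sq, one_div_pow]
      split_ifs <;> ring
    simp only [this, Finset.sum_add_distrib, Finset.sum_sub_distrib, ← Finset.mul_sum,
      Finset.sum_ite_eq', Finset.mem_univ, if_true, Finset.sum_const, Finset.card_univ,
      nsmul_eq_mul, hcardR]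
    have e1 : 1 - 2 / ((n : ℝ) - q) * 1 + ((n : ℝ) - q) * (1 / ((n : ℝ) - q) ^ 2)
        = 1 - 1 / ((n : ℝ) - q) := by field_simp; ring
    rw [e1]
    have : 0 < 1 / ((n : ℝ) - q) := by positivity
    linarith
  have hV : 2 ≤ Fintype.card S := by omega
  have ha := algebraicConnectivity_pos (G.induce S) hconn hV
  obtain ⟨y, hy, hyx⟩ := exists_lapMatrix_mulVec_eq (G.induce S) hconn hV hx
  -- Potential differences within S, extended by zero so that edges meeting I carry no flow.
  let g : Fin n → Fin n → ℝ := fun i j =>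
    if h : i ∈ S ∧ j ∈ S then y ⟨i, h.1⟩ - y ⟨j, h.2⟩ else 0
  have hg : ∀ i j, g i j = -g j i := by
    intro i j
    by_cases h : i ∈ S ∧ j ∈ S
    · simp only [g, dif_pos h, dif_pos h.symm]; ring
    · simp only [g, dif_neg h, dif_neg fun h' => h (And.symm h'), neg_zero]
  have hsum : ∀ F : Fin n → ℝ, (∀ i, i ∉ S → F i = 0) → ∑ i, F i = ∑ i : S, F i.1 := by
    intro F hF
    rw [← Finset.sum_subtype Iᶜ (fun i => by simp) F]
    exact (Finset.sum_subset (Finset.subset_univ _) fun i _ hi =>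
      hF i (by simpa [hS] using hi)).symm
  have hdiv : ∀ i, ∑ j : G.neighborSet i, g i j.1
      = (if i = i₀ then 1 else 0) - if i ∈ S then 1 / ((n : ℝ) - q) else 0 := by
    intro i
    rw [sum_neighborSet G i fun j _ => g i j]
    by_cases hi : i ∈ S
    · rw [hsum _ fun j hj => by simp [g, hj], if_pos hi]
      have h1 := congrFun hy ⟨i, hi⟩
      rw [SimpleGraph.lapMatrix_mulVec_apply, SimpleGraph.degree_eq_sum_if_adj,
        SimpleGraph.neighborFinset_eq_filter, Finset.sum_filter, Finset.sum_mul,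
        ← Finset.sum_sub_distrib] at h1
      rw [← show x ⟨i, hi⟩ = (if i = i₀ then 1 else 0) - 1 / ((n : ℝ) - q) from rfl, ← h1]
      refine Finset.sum_congr rfl fun j _ => ?_
      by_cases hij : G.Adj i j.1 <;> simp [g, hij, hi]
    · have : i ≠ i₀ := fun h => hi (h ▸ s₀.2)
      simp [g, hi, this]
  refine ⟨fun e => edgeValue g e.1, fun k => if k ∈ S then 1 / ((n : ℝ) - q) else 0, ?_, ?_, ?_, ?_⟩
  · rintro ⟨e, he⟩ hne
    induction e using Sym2.ind with
    | _ i j =>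
      have : ¬ (i ∈ S ∧ j ∈ S) := by
        intro h
        refine hne fun k hk hke => ?_
        rcases Sym2.mem_iff.1 hke with rfl | rfl
        · exact (hmem _).1 h.1 hk
        · exact (hmem _).1 h.2 hk
      simp only [edgeValue_mk, g, dif_neg this, dif_neg fun h' => this (And.symm h'), ite_self]
  · intro d Δ k
    rw [pairNoise_edgeValue G hg, hdiv, ← add_smul, sub_add_cancel]
    split_ifs <;> simp
  · have key := sum_neighborSet_edge G (fun e => edgeValue g e.1 ^ 2)
    simp_rw [edgeValue_sq hg] at key
    have h1 : ∑ i, ∑ j : G.neighborSet i, g i j.1 ^ 2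
        = ∑ i : S, ∑ j : S, if (G.induce S).Adj i j then (y i - y j) ^ 2 else 0 := by
      rw [Finset.sum_congr rfl fun i _ => sum_neighborSet G i fun j _ => g i j ^ 2]
      rw [hsum _ fun i hi => by simp [g, hi]]
      refine Finset.sum_congr rfl fun i _ => ?_
      rw [hsum _ fun i hi => by simp [g, hi]]
      refine Finset.sum_congr rfl fun j _ => ?_
      simp [g]
    -- The energy of the flow is the Dirichlet form of its potential, which equals y ⬝ᵥ x; the half
    -- in the form compensates for the double count of edges.
    have h2 := SimpleGraph.lapMatrix_toLinearMap₂' (R := ℝ) (G.induce S) y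
    rw [Matrix.toLinearMap₂'_apply', hy, ← h1, key] at h2
    have h3 : ∑ e : G.edgeSet, edgeValue g e.1 ^ 2 = y ⬝ᵥ x := by
      rw [h2, two_smul]; ring
    rw [h3]
    exact hyx.trans (by gcongr)
  · rw [hsum _ fun i hi => by simp [hi]]
    simp only [Subtype.coe_prop, if_true, Finset.sum_const, Finset.card_univ, nsmul_eq_mul, hcardR]
    field_simp

end Edges

/-! ### Positivity of a_q -/

section MinAlgConn

variable {n q : ℕ} {G : SimpleGraph (Fin n)}

theorem IsKConnected.lt (hG : IsKConnected (q + 1) G) : q + 1 < n := by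
  simpa using hG.1

variable [DecidableRel G.Adj]

theorem algebraicConnectivity_induce_pos (hG : IsKConnected (q + 1) G) {I : Finset (Fin n)}
    (hI : I.card = q) :
    0 < algebraicConnectivity (G.induce ((Iᶜ : Finset (Fin n)) : Set (Fin n))) := by
  have hn := hG.lt
  apply algebraicConnectivity_pos
  · have := hG.2 I (by omega)
    rwa [Finset.coe_compl]
  · have : Fintype.card ((Iᶜ : Finset (Fin n)) : Set (Fin n)) = (Iᶜ).card := by
      rw [← Fintype.card_coe]; rfl
    rw [this, Finset.card_compl, Fintype.card_fin, hI]
    omega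

theorem minAlgConn_le {I : Finset (Fin n)} (hI : I.card = q) :
    minAlgConn q G ≤ algebraicConnectivity (G.induce ((Iᶜ : Finset (Fin n)) : Set (Fin n))) :=
  ciInf_le (Set.finite_range _).bddBelow (⟨I, hI⟩ : {I : Finset (Fin n) // I.card = q})

theorem minAlgConn_pos (hG : IsKConnected (q + 1) G) : 0 < minAlgConn q G := by
  have hn := hG.lt
  obtain ⟨I, _, hI⟩ := Finset.exists_subset_card_eq
    (s := (Finset.univ : Finset (Fin n))) (n := q) (by simp; omega)
  have : Nonempty {I : Finset (Fin n) // I.card = q} := ⟨⟨I, hI⟩⟩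
  obtain ⟨J, hJ⟩ := exists_eq_ciInf_of_finite (f := fun I : {I : Finset (Fin n) // I.card = q} =>
    algebraicConnectivity (G.induce (((I.1)ᶜ : Finset (Fin n)) : Set (Fin n))))
  rw [minAlgConn, ← hJ]
  exact algebraicConnectivity_induce_pos hG J.2

end MinAlgConn

/-! ### Measurability of the algorithm -/

section Measurability

variable {n d m T : ℕ} {X : Type*} (G : SimpleGraph (Fin n)) [DecidableRel G.Adj]

/-- The derivative of an arbitrary function is measurable, so the transcript is measurable without
any regularity of the loss. -/
theorem measurable_gradient (f : Param d → ℝ) : Measurable (∇ f) := by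
  have : ∇ f = fun x => (InnerProductSpace.toDual ℝ (Param d)).symm (fderiv ℝ f x) := rfl
  rw [this]
  exact (InnerProductSpace.toDual ℝ (Param d)).symm.continuous.measurable.comp
    (measurable_fderiv ℝ f)

theorem measurable_clip (C : ℝ) : Measurable (clip C : Param d → Param d) := by
  unfold clip; fun_prop

/-- The sampled indices range over a finite set, so joint measurability is checked for each fixed
value and no measurable structure on X is needed. -/
theorem measurable_stochasticGradient {κ : Param d → Param d} (hκ : Measurable κ)
    (l : Param d → X → ℝ) (D : Fin n → Fin m → X) (i : Fin n) :
    Measurable fun z : (Fin n → Fin m) × Param d => κ (∇ (fun y => l y (D i (z.1 i))) z.2) :=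
  measurable_from_prod_countable_right fun xi =>
    hκ.comp (measurable_gradient fun y => l y (D i (xi i)))

theorem measurable_pairNoise (i : Fin n) :
    Measurable fun u : G.edgeSet → Param d => pairNoise G u i := by
  unfold pairNoise
  refine Finset.measurable_sum _ fun j _ => ?_
  split_ifs <;> fun_prop

theorem measurable_halfStep {κ : Param d → Param d} (hκ : Measurable κ)
    (l : Param d → X → ℝ) (D : Fin n → Fin m → X) (eta : ℝ) :
    Measurable fun z : StepNoise G m d × (Fin n → Param d) =>
      halfStep G κ l D eta z.1.1 z.1.2.1 z.1.2.2 z.2 := by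
  unfold halfStep
  refine measurable_pi_lambda _ fun i => ?_
  have h1 : Measurable fun z : StepNoise G m d × (Fin n → Param d) =>
      κ (∇ (fun y => l y (D i (z.1.1 i))) (z.2 i)) :=
    (measurable_stochasticGradient hκ l D i).comp
      (g := fun z : (Fin n → Fin m) × Param d => κ (∇ (fun y => l y (D i (z.1 i))) z.2))
      (f := fun z : StepNoise G m d × (Fin n → Param d) => (z.1.1, z.2 i)) (by fun_prop)
  have h2 : Measurable fun z : StepNoise G m d × (Fin n → Param d) => pairNoise G z.1.2.1 i :=
    (measurable_pairNoise G i).comp (by fun_prop)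
  exact Measurable.sub (by fun_prop) (((h1.add h2).add (by fun_prop)).const_smul eta)

theorem measurable_gossip (W : Matrix (Fin n) (Fin n) ℝ) :
    Measurable (gossip W : (Fin n → Param d) → Fin n → Param d) := by
  unfold gossip; fun_prop

theorem measurable_iterate {κ : Param d → Param d} (hκ : Measurable κ)
    (l : Param d → X → ℝ) (W : Matrix (Fin n) (Fin n) ℝ) (eta : ℕ → ℝ) (x0 : Fin n → Param d)
    (D : Fin n → Fin m → X) (t : ℕ) :
    Measurable fun w : Secrets G T d × Private n m T d =>
      iterate G κ l W eta x0 D w.1 w.2 t := by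
  induction t with
  | zero => exact measurable_const
  | succ t ih =>
    by_cases h : t < T
    · simp only [iterate, dif_pos h]
      refine (measurable_gossip W).comp ?_
      exact (measurable_halfStep G hκ l D (eta t)).comp
        (f := fun w : Secrets G T d × Private n m T d =>
          ((w.2.1 ⟨t, h⟩, (fun e => w.1 e ⟨t, h⟩), w.2.2 ⟨t, h⟩),
            iterate G κ l W eta x0 D w.1 w.2 t)) (by fun_prop)
    · simpa only [iterate, dif_neg h] using ih

theorem measurable_transcript {κ : Param d → Param d} (hκ : Measurable κ)
    (l : Param d → X → ℝ) (W : Matrix (Fin n) (Fin n) ℝ) (eta : ℕ → ℝ) (x0 : Fin n → Param d)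
    (D : Fin n → Fin m → X) :
    Measurable fun w : Secrets G T d × Private n m T d =>
      transcript G κ l W eta x0 D w.1 w.2 := by
  refine measurable_pi_lambda _ fun t => ?_
  have := measurable_iterate (T := T) G hκ l W eta x0 D t
  exact (measurable_halfStep G hκ l D (eta t)).comp
    (f := fun w : Secrets G T d × Private n m T d =>
      ((w.2.1 t, (fun e => w.1 e t), w.2.2 t),
        iterate G κ l W eta x0 D w.1 w.2 t)) (by fun_prop)

end Measurability

/-! ### Privacy -/

theorem norm_clip_le {d : ℕ} {C : ℝ} (hC : 0 ≤ C) (g : Param d) : ‖clip C g‖ ≤ C := by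
  rw [clip, norm_smul, Real.norm_of_nonneg (le_min zero_le_one (div_nonneg hC (norm_nonneg g)))]
  rcases eq_or_ne g 0 with rfl | hg
  · simpa using hC
  · calc min 1 (C / ‖g‖) * ‖g‖ ≤ C / ‖g‖ * ‖g‖ := by gcongr; exact min_le_right _ _
      _ = C := div_mul_cancel₀ _ (norm_ne_zero_iff.2 hg)

theorem pairNoise_add {n d : ℕ} (G : SimpleGraph (Fin n)) [DecidableRel G.Adj]
    (u u' : G.edgeSet → Param d) (i : Fin n) :
    pairNoise G (fun e => u e + u' e) i = pairNoise G u i + pairNoise G u' i := by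
  simp only [pairNoise, ← Finset.sum_add_distrib]
  refine Finset.sum_congr rfl fun j _ => ?_
  split_ifs
  · rfl
  · rw [neg_add]

/-- The iterates depend only on the noise of the past. -/
theorem iterate_congr {n d m T : ℕ} {X : Type*} (G : SimpleGraph (Fin n)) [DecidableRel G.Adj]
    {κ : Param d → Param d} {l : Param d → X → ℝ} {W : Matrix (Fin n) (Fin n) ℝ} {eta : ℕ → ℝ}
    {x0 : Fin n → Param d} {D : Fin n → Fin m → X} {u u' : Secrets G T d}
    {r r' : Private n m T d} {t : ℕ}
    (h : ∀ s : Fin T, s.1 < t → (∀ e, u e s = u' e s) ∧ r.1 s = r'.1 s ∧ r.2 s = r'.2 s) :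
    iterate G κ l W eta x0 D u r t = iterate G κ l W eta x0 D u' r' t := by
  induction t with
  | zero => rfl
  | succ t ih =>
    have ih' := ih fun s hs => h s (hs.trans (Nat.lt_succ_self t))
    by_cases hT : t < T
    · obtain ⟨h1, h2, h3⟩ := h ⟨t, hT⟩ (Nat.lt_succ_self t)
      simp only [iterate, dif_pos hT, ih', h1, h2, h3]
    · simp only [iterate, dif_neg hT, ih']

theorem decorSecLDP {n d m T q : ℕ} {X : Type*} (G : SimpleGraph (Fin n)) [DecidableRel G.Adj]
    {C : ℝ} (l : Param d → X → ℝ) (W : Matrix (Fin n) (Fin n) ℝ) (eta : ℕ → ℝ)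
    (x0 : Fin n → Param d) {eps delta : ℝ} (hm : 0 < m) (hT : 0 < T) (hC : 0 < C)
    (heps : 0 < eps) (hdelta : 0 < delta) (hle : eps ≤ Real.log (1 / delta))
    (hG : IsKConnected (q + 1) G) :
    DecorSecLDP (m := m) (T := T) G q C l W eta x0 (varCor G q T C eps delta)
      (varCdp n q T C eps delta) eps delta := by
  classical
  intro I hI D D' ⟨i₀, hi₀, hD⟩ s B hB
  have : NeZero m := ⟨hm.ne'⟩
  have hn := hG.lt
  set lam := Real.log (1 / delta) with hlam
  have hlam0 : 0 < lam := heps.trans_le hle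
  have ha := minAlgConn_pos hG
  have hN : (0 : ℝ) < (n : ℝ) - q := by
    have : (q : ℝ) < n := by exact_mod_cast (by omega : q < n)
    linarith
  have hT' : (0 : ℝ) < T := by exact_mod_cast hT
  have hcor : 0 < varCor G q T C eps delta := by
    rw [varCor, ← hlam]; positivity
  have hcdp : 0 < varCdp n q T C eps delta := by
    rw [varCdp, ← hlam]; positivity
  obtain ⟨φ, ψ, hφ0, hflow, hφ, hψ⟩ := exists_hidden_flow G hG hI hi₀
  replace hφ := hφ.trans (one_div_le_one_div_of_le ha (minAlgConn_le hI))
  set vcor := varCor G q T C eps delta with hvcor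
  set vcdp := varCdp n q T C eps delta with hvcdp
  set H := hiddenFrom G I
  -- The drawn noise, with the secrets known to the adversary frozen at `s`.
  let mix : (Fin T → StepNoise G m d) → Secrets G T d × Private n m T d := fun w =>
    (fun e => if e ∈ H then (regroup G m T d w).1 e else s e, (regroup G m T d w).2)
  have hreg : Measurable (regroup G m T d) := (measurePreserving_regroup G m T d vcor vcdp).measurable
  have hmix0 : Measurable fun w : Secrets G T d × Private n m T d =>
      ((fun e => if e ∈ H then w.1 e else s e, w.2) : Secrets G T d × Private n m T d) := by
    refine Measurable.prodMk (measurable_pi_lambda _ fun e => ?_) measurable_snd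
    split_ifs <;> fun_prop
  have hmix : Measurable mix := hmix0.comp hreg
  let x : (Fin n → Fin m → X) → (Fin T → StepNoise G m d) → ℕ → Fin n → Param d := fun D w t =>
    iterate G (clip C) l W eta x0 D (mix w).1 (mix w).2 t
  have hxm : ∀ D t, Measurable fun w => x D w t := fun D t =>
    (measurable_iterate G (measurable_clip C) l W eta x0 D t).comp hmix
  let g : (Fin n → Fin m → X) → (Fin n → Fin m) → Param d → Param d := fun D xi y =>
    clip C (∇ (fun z => l z (D i₀ (xi i₀))) y)
  -- What the noise has to hide at one iteration.
  let Δ : (Fin n → Param d) → (Fin n → Fin m) → Param d := fun y xi => g D xi (y i₀) - g D' xi (y i₀)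
  have hg : ∀ D xi y, ‖g D xi y‖ ≤ C := fun D xi y => norm_clip_le hC.le _
  have hΔ : ∀ y xi, ‖Δ y xi‖ ≤ 2 * C := fun y xi =>
    (norm_sub_le _ _).trans (by linarith [hg D xi (y i₀), hg D' xi (y i₀)])
  -- Δ is evaluated along the run on D, whose state at time t depends only on earlier noise. Hence Φ
  -- is adapted, and given the past and the sampled indices it is a translation of the Gaussian
  -- noises.
  let Φ : (Fin T → StepNoise G m d) → Fin T → StepNoise G m d := fun w t =>
    ((w t).1, (w t).2.1 + (fun e => φ e • Δ (x D w t) (w t).1),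
      (w t).2.2 + fun k => ψ k • Δ (x D w t) (w t).1)
  have hgm : ∀ D, Measurable fun z : (Fin n → Fin m) × Param d => g D z.1 z.2 := fun D =>
    measurable_stochasticGradient (measurable_clip C) l D i₀
  have hΦm : Measurable Φ := by
    refine measurable_pi_lambda _ fun t => ?_
    have h1 : ∀ D', Measurable fun w : Fin T → StepNoise G m d => g D' (w t).1 (x D w t i₀) :=
      fun D' => (hgm D').comp (g := fun z : (Fin n → Fin m) × Param d => g D' z.1 z.2)
        (f := fun w : Fin T → StepNoise G m d => ((w t).1, x D w t i₀)) (by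
          have := hxm D t
          fun_prop)
    have h2 : Measurable fun w : Fin T → StepNoise G m d => Δ (x D w t) (w t).1 :=
      (h1 D).sub (h1 D')
    fun_prop
  have hdep : ∀ D (w w' : Fin T → StepNoise G m d) (t : ℕ), (∀ r : Fin T, r.1 < t → w r = w' r) →
      x D w t = x D w' t := by
    intro D w w' t h
    refine iterate_congr G fun r hr => ?_
    simp only [mix, regroup, h r hr, and_self, and_true]
    intro e
    split_ifs <;> simp [h r hr]
  -- From the same state, D' with shifted noise makes the same broadcast as D: at i₀ the shift adds
  -- exactly the missing Δ, and at every other user the shifts of edge noise and private noise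
  -- cancel.
  have hstep : ∀ (w : Fin T → StepNoise G m d) (t : Fin T),
      halfStep G (clip C) l D' (eta t) ((mix (Φ w)).2.1 t) (fun e => (mix (Φ w)).1 e t)
        ((mix (Φ w)).2.2 t) (x D w t)
      = halfStep G (clip C) l D (eta t) ((mix w).2.1 t) (fun e => (mix w).1 e t)
        ((mix w).2.2 t) (x D w t) := by
    intro w t
    set δ := Δ (x D w t) (w t).1 with hδ
    have h1 : (fun e => (mix (Φ w)).1 e t) = fun e => (mix w).1 e t + φ e • δ := by
      funext e
      by_cases he : e ∈ H
      · simp only [mix, regroup, if_pos he, Φ, Pi.add_apply, hδ]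
      · simp only [mix, if_neg he, hφ0 e he, zero_smul, add_zero]
    have h2 : (mix (Φ w)).2.2 t = fun k => (mix w).2.2 t k + ψ k • δ := rfl
    have h3 : (mix (Φ w)).2.1 t = (mix w).2.1 t := rfl
    rw [h1, h2, h3]
    funext k
    simp only [halfStep, pairNoise_add]
    congr 2
    have hk := hflow d δ k
    by_cases hk0 : k = i₀
    · subst hk0
      rw [if_pos rfl] at hk
      have e1 : δ = clip C (∇ (fun y => l y (D k ((mix w).2.1 t k))) (x D w t k))
        - clip C (∇ (fun y => l y (D' k ((mix w).2.1 t k))) (x D w t k)) := rfl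
      have e2 := eq_add_of_sub_eq e1.symm
      rw [e2, show pairNoise G (fun e => φ e • δ) k = δ - ψ k • δ from eq_sub_of_add_eq hk]
      abel
    · rw [if_neg hk0] at hk
      rw [← hD k hk0]
      have e3 : pairNoise G (fun e => φ e • δ) k = -(ψ k • δ) := eq_neg_of_add_eq_zero_left hk
      rw [e3]; abel
  have hcoup : ∀ (w : Fin T → StepNoise G m d) (t : ℕ), x D' (Φ w) t = x D w t := by
    intro w t
    induction t with
    | zero => rfl
    | succ t ih =>
      by_cases h : t < T
      · have h1 := hstep w ⟨t, h⟩
        simp only [x, iterate, dif_pos h] at ih ⊢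
        rw [ih]
        exact congrArg (gossip W) h1
      · simp only [x, iterate, dif_neg h] at ih ⊢
        exact ih
  have htr : ∀ w, transcript G (clip C) l W eta x0 D' (mix (Φ w)).1 (mix (Φ w)).2
      = transcript G (clip C) l W eta x0 D (mix w).1 (mix w).2 := by
    intro w
    funext t
    have h1 := hstep w t
    have h2 := hcoup w t
    simp only [x] at h1 h2
    rw [transcript, transcript, h2]
    exact h1
  -- The variances are tuned so that the edge noise, 4C²/(a_q σ_cor²), and the private noise,
  -- 4C²/((n - q) σ_cdp²), each account for half of this budget.
  set R := eps ^ 2 / (4 * T * lam) with hR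
  have hcost : ∀ y xi, (∑ e, ‖φ e • Δ y xi‖ ^ 2) / vcor + (∑ i, ‖ψ i • Δ y xi‖ ^ 2) / vcdp ≤ R := by
    intro y xi
    have hD2 : ‖Δ y xi‖ ^ 2 ≤ 4 * C ^ 2 := by
      nlinarith [hΔ y xi, norm_nonneg (Δ y xi)]
    simp only [norm_smul, mul_pow, Real.norm_eq_abs, sq_abs, ← Finset.sum_mul]
    calc (∑ e, φ e ^ 2) * ‖Δ y xi‖ ^ 2 / vcor + (∑ i, ψ i ^ 2) * ‖Δ y xi‖ ^ 2 / vcdp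
        ≤ (1 / minAlgConn q G) * (4 * C ^ 2) / vcor + (1 / ((n : ℝ) - q)) * (4 * C ^ 2) / vcdp := by
          rw [hψ]; gcongr
      _ = R := by
          rw [hR, hvcor, hvcdp, varCor, varCdp, ← hlam]
          field_simp
          ring
  -- This order makes the term log(1/δ)/(a - 1) equal to ε/2. The accumulated cost adds ε/4 + ε²/(8
  -- log(1/δ)), at most 3ε/8 because ε ≤ log(1/δ); the total 7ε/8 fits.
  set a : ℝ := 1 + 2 * lam / eps with hadef
  have ha1 : 1 < a := by
    have : 0 < 2 * lam / eps := by positivity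
    linarith
  have hab := Real.HolderConjugate.conjExponent ha1
  have hb := hab.symm.pos
  have hholder := HolderShift.pi_adapted hb (μ := fun _ : Fin T => stepLaw G m d vcor vcdp) (Φ := Φ)
    (K := fun _ => ENNReal.ofReal (Real.exp ((a - 1) / 2 * R))) hΦm
    (by
      intro t w w' h
      have h1 : x D w t = x D w' t := hdep D w w' t fun r hr => h r (le_of_lt hr)
      simp only [Φ, h1, h t le_rfl])
    (by
      intro t w
      have h1 : ∀ z, x D (Function.update w t z) t = x D w t := fun z =>
        hdep D _ _ t fun r hr => Function.update_of_ne (Fin.ne_of_lt hr) _ _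
      simp only [Φ, h1, Function.update_self]
      exact holderShift_stepLaw G hab hcor hcdp (fun xi e => φ e • Δ (x D w t) xi)
        (fun xi k => ψ k • Δ (x D w t) xi) (hcost _))
  have hK : ∏ _t : Fin T, ENNReal.ofReal (Real.exp ((a - 1) / 2 * R))
      = ENNReal.ofReal (Real.exp ((a - 1) / 2 * (T * R))) := by
    rw [Finset.prod_const, Finset.card_univ, Fintype.card_fin,
      ← ENNReal.ofReal_pow (Real.exp_nonneg _), ← Real.exp_nat_mul]
    congr 2; ring
  rw [hK] at hholder
  have htm : ∀ D, Measurable fun w => transcript G (clip C) l W eta x0 D (mix w).1 (mix w).2 :=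
    fun D => (measurable_transcript G (measurable_clip C) l W eta x0 D).comp hmix
  have hfin := hholder.measure_le hab hdelta (eps := eps) (by
    rw [← hlam]
    have e1 : a * (T * R) / 2 + lam / (a - 1) = eps ^ 2 / (8 * lam) + 3 / 4 * eps := by
      rw [hadef, hR]; field_simp; ring
    rw [e1]
    have : eps ^ 2 / (8 * lam) ≤ eps / 8 := by
      rw [div_le_div_iff₀ (by positivity) (by norm_num)]
      nlinarith
    linarith) (htm D' hB) hΦm
  have hset : ∀ D, fullLaw G m T d vcor vcdp {w | transcript G (clip C) l W eta x0 D
      (fun e => if e ∈ H then w.1 e else s e) w.2 ∈ B}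
      = (Measure.pi fun _ : Fin T => stepLaw G m d vcor vcdp)
        ((fun w => transcript G (clip C) l W eta x0 D (mix w).1 (mix w).2) ⁻¹' B) := by
    intro D
    rw [← (measurePreserving_regroup G m T d vcor vcdp).measure_preimage]
    · rfl
    · exact (((measurable_transcript G (measurable_clip C) l W eta x0 D).comp hmix0) hB).nullMeasurableSet
  have hpre : Φ ⁻¹' ((fun w => transcript G (clip C) l W eta x0 D' (mix w).1 (mix w).2) ⁻¹' B)
      = (fun w => transcript G (clip C) l W eta x0 D (mix w).1 (mix w).2) ⁻¹' B := by
    ext w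
    simp only [Set.mem_preimage, htr]
  rw [hpre, ← hset D, ← hset D'] at hfin
  exact hfin

/-! ### Smooth losses -/

/-- The quadratic upper bound for functions with Lipschitz gradient. -/
theorem le_add_inner_gradient {E : Type*} [NormedAddCommGroup E] [InnerProductSpace ℝ E]
    [CompleteSpace E] {f : E → ℝ} (hf : Differentiable ℝ f) {L : ℝ}
    (hL : ∀ x y, ‖∇ f x - ∇ f y‖ ≤ L * ‖x - y‖) (x y : E) :
    f y ≤ f x + inner ℝ (∇ f x) (y - x) + L / 2 * ‖y - x‖ ^ 2 := by
  set v := y - x with hv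
  -- By Cauchy–Schwarz and the Lipschitz bound this function has nonpositive derivative on (0, 1);
  -- the claim is h(1) ≤ h(0).
  let h : ℝ → ℝ := fun t => f (x + t • v) - t * inner ℝ (∇ f x) v - L / 2 * t ^ 2 * ‖v‖ ^ 2
  have hd : ∀ t, HasDerivAt h
      (inner ℝ (∇ f (x + t • v)) v - inner ℝ (∇ f x) v - L * t * ‖v‖ ^ 2) t := by
    intro t
    have h1 : HasDerivAt (fun t : ℝ => x + t • v) v t := by
      simpa using ((hasDerivAt_id t).smul_const v).const_add x
    have h2 := (hf (x + t • v)).hasGradientAt.hasFDerivAt.comp_hasDerivAt t h1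
    have h3 : HasDerivAt (fun t : ℝ => t * inner ℝ (∇ f x) v) (inner ℝ (∇ f x) v) t := by
      simpa using (hasDerivAt_id t).mul_const (inner ℝ (∇ f x) v)
    have h4 : HasDerivAt (fun t : ℝ => L / 2 * t ^ 2 * ‖v‖ ^ 2) (L * t * ‖v‖ ^ 2) t := by
      have := (((hasDerivAt_id t).pow 2).const_mul (L / 2)).mul_const (‖v‖ ^ 2)
      refine this.congr_deriv ?_
      simp only [id, Nat.cast_ofNat]; ring
    have h5 := (h2.sub h3).sub h4
    exact h5
  have hanti : AntitoneOn h (Set.Icc 0 1) := by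
    refine antitoneOn_of_deriv_nonpos (convex_Icc 0 1)
      (fun t _ => (hd t).continuousAt.continuousWithinAt)
      (fun t _ => (hd t).differentiableAt.differentiableWithinAt) fun t ht => ?_
    rw [interior_Icc] at ht
    rw [(hd t).deriv, ← inner_sub_left]
    have h1 := real_inner_le_norm (∇ f (x + t • v) - ∇ f x) v
    have h2 := hL (x + t • v) x
    rw [add_sub_cancel_left, norm_smul, Real.norm_of_nonneg ht.1.le] at h2
    nlinarith [mul_le_mul_of_nonneg_right h2 (norm_nonneg v)]
  have h01 := hanti (Set.left_mem_Icc.2 zero_le_one) (Set.right_mem_Icc.2 zero_le_one) zero_le_one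
  simp only [h, hv, one_smul, zero_smul, add_zero, add_sub_cancel] at h01
  rw [hv]
  norm_num at h01 ⊢
  linarith

theorem gradient_const_mul_sum {E ι : Type*} [NormedAddCommGroup E] [InnerProductSpace ℝ E]
    [CompleteSpace E] [Fintype ι] {f : ι → E → ℝ} (hf : ∀ i, Differentiable ℝ (f i)) (c : ℝ)
    (x : E) : HasGradientAt (fun y => c * ∑ i, f i y) (c • ∑ i, ∇ (f i) x) x := by
  rw [hasGradientAt_iff_hasFDerivAt]
  have h1 : HasFDerivAt (fun y => c * ∑ i, f i y)
      (c • ∑ i, InnerProductSpace.toDual ℝ E (∇ (f i) x)) x :=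
    (HasFDerivAt.fun_sum fun i _ => (hf i x).hasGradientAt.hasFDerivAt).const_mul c
  simpa using h1

section Loss

variable {n d m : ℕ} {X : Type*} {l : Param d → X → ℝ} {D : Fin n → Fin m → X}
  {L P M sigma zeta : ℝ}

theorem gradient_localLoss (h : LossAssumptions l D L P M sigma zeta) (i : Fin n) (x : Param d) :
    ∇ (localLoss l D i) x = (1 / (m : ℝ)) • ∑ j, ∇ (fun y => l y (D i j)) x :=
  (gradient_const_mul_sum (fun j => h.differentiable i j) (1 / (m : ℝ)) x).gradient

theorem differentiable_localLoss (h : LossAssumptions l D L P M sigma zeta) (i : Fin n) :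
    Differentiable ℝ (localLoss l D i) := fun x =>
  (gradient_const_mul_sum (fun j => h.differentiable i j) (1 / (m : ℝ)) x).differentiableAt

theorem gradient_globalLoss (h : LossAssumptions l D L P M sigma zeta) (x : Param d) :
    ∇ (globalLoss l D) x = (1 / (n : ℝ)) • ∑ i, ∇ (localLoss l D i) x :=
  (gradient_const_mul_sum (fun i => differentiable_localLoss h i) (1 / (n : ℝ)) x).gradient

theorem differentiable_globalLoss (h : LossAssumptions l D L P M sigma zeta) :
    Differentiable ℝ (globalLoss l D) := fun x =>
  (gradient_const_mul_sum (fun i => differentiable_localLoss h i) (1 / (n : ℝ)) x).differentiableAt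

theorem lipschitz_gradient_globalLoss (h : LossAssumptions l D L P M sigma zeta) (hn : 0 < n)
    (x y : Param d) : ‖∇ (globalLoss l D) x - ∇ (globalLoss l D) y‖ ≤ L * ‖x - y‖ := by
  have hn' : (0 : ℝ) < n := by exact_mod_cast hn
  rw [gradient_globalLoss h, gradient_globalLoss h, ← smul_sub, ← Finset.sum_sub_distrib, norm_smul,
    Real.norm_of_nonneg (by positivity)]
  calc 1 / (n : ℝ) * ‖∑ i, (∇ (localLoss l D i) x - ∇ (localLoss l D i) y)‖
      ≤ 1 / (n : ℝ) * ∑ _i : Fin n, L * ‖x - y‖ := by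
        gcongr
        exact norm_sum_le_of_le _ fun i _ => h.smooth i x y
    _ = L * ‖x - y‖ := by
        rw [Finset.sum_const, Finset.card_univ, Fintype.card_fin, nsmul_eq_mul]
        field_simp

theorem lossInf_le (h : LossAssumptions l D L P M sigma zeta) (x : Param d) :
    lossInf l D ≤ globalLoss l D x := ciInf_le h.bddBelow x

/-- Stochastic gradients grow at most linearly. -/
theorem exists_norm_gradient_le (h : LossAssumptions l D L P M sigma zeta) (hn : 0 < n)
    (hm : 0 < m) (hL : 0 < L) (hM : 0 ≤ M) :
    ∃ a b : ℝ, 0 ≤ a ∧ 0 ≤ b ∧ ∀ i j x, ‖∇ (fun y => l y (D i j)) x‖ ≤ a + b * ‖x‖ := by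
  have hn' : (0 : ℝ) < n := by exact_mod_cast hn
  have hm' : (0 : ℝ) < m := by exact_mod_cast hm
  set c := Real.sqrt (n * m) with hc
  have hloc : ∀ i x, ‖∇ (localLoss l D i) x‖ ≤ ∑ k, ‖∇ (localLoss l D k) 0‖ + L * ‖x‖ := by
    intro i x
    have h1 := h.smooth i x 0
    rw [sub_zero] at h1
    have h2 := norm_sub_norm_le (∇ (localLoss l D i) x) (∇ (localLoss l D i) 0)
    have h3 := Finset.single_le_sum (f := fun k => ‖∇ (localLoss l D k) 0‖)
      (fun k _ => norm_nonneg _) (Finset.mem_univ i)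
    linarith
  have hglob : ∀ x, ‖∇ (globalLoss l D) x‖ ≤ ‖∇ (globalLoss l D) 0‖ + L * ‖x‖ := by
    intro x
    have h1 := lipschitz_gradient_globalLoss h hn x 0
    rw [sub_zero] at h1
    have h2 := norm_sub_norm_le (∇ (globalLoss l D) x) (∇ (globalLoss l D) 0)
    linarith
  -- At a constant family the noise assumption bounds the average of nm nonnegative terms, hence
  -- each of them with the factor √(nm). The loss in this constant is harmless: the growth bound
  -- only serves to make moments finite.
  have hnoise : ∀ i j x, ‖∇ (fun y => l y (D i j)) x - ∇ (localLoss l D i) x‖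
      ≤ c * (|sigma| + Real.sqrt M * ‖∇ (globalLoss l D) x‖) := by
    intro i j x
    have h1 := h.noise fun _ => x
    simp only [Finset.sum_const, Finset.card_univ, Fintype.card_fin, nsmul_eq_mul] at h1
    have h2 : ‖∇ (fun y => l y (D i j)) x - ∇ (localLoss l D i) x‖ ^ 2
        ≤ ∑ i, ∑ j, ‖∇ (fun y => l y (D i j)) x - ∇ (localLoss l D i) x‖ ^ 2 :=
      (Finset.single_le_sum (f := fun j => ‖∇ (fun y => l y (D i j)) x - ∇ (localLoss l D i) x‖ ^ 2)
        (fun k _ => sq_nonneg _) (Finset.mem_univ j)).trans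
      (Finset.single_le_sum
        (f := fun i => ∑ j, ‖∇ (fun y => l y (D i j)) x - ∇ (localLoss l D i) x‖ ^ 2)
        (fun k _ => Finset.sum_nonneg fun _ _ => sq_nonneg _) (Finset.mem_univ i))
    rw [← Finset.mul_sum] at h1
    have h3 : M / n * (n * ‖∇ (globalLoss l D) x‖ ^ 2) = M * ‖∇ (globalLoss l D) x‖ ^ 2 := by
      field_simp
    rw [h3, ← mul_assoc, one_div_mul_one_div, div_mul_eq_mul_div, one_mul,
      div_le_iff₀ (by positivity)] at h1
    have h4 : ‖∇ (fun y => l y (D i j)) x - ∇ (localLoss l D i) x‖ ^ 2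
        ≤ (c * (|sigma| + Real.sqrt M * ‖∇ (globalLoss l D) x‖)) ^ 2 := by
      rw [mul_pow, hc, Real.sq_sqrt (by positivity)]
      refine h2.trans (h1.trans ?_)
      rw [mul_comm]
      have : sigma ^ 2 + M * ‖∇ (globalLoss l D) x‖ ^ 2
          ≤ (|sigma| + Real.sqrt M * ‖∇ (globalLoss l D) x‖) ^ 2 := by
        have e := Real.sq_sqrt hM
        have e2 : 0 ≤ |sigma| * (Real.sqrt M * ‖∇ (globalLoss l D) x‖) := by positivity
        rw [add_sq, sq_abs, mul_pow, e]
        linarith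
      gcongr
    exact (abs_le_of_sq_le_sq' h4 (by positivity)).2
  refine ⟨∑ k, ‖∇ (localLoss l D k) 0‖ + c * (|sigma| + Real.sqrt M * ‖∇ (globalLoss l D) 0‖),
    L + c * Real.sqrt M * L, by positivity, by positivity, fun i j x => ?_⟩
  have h1 := norm_add_le (∇ (fun y => l y (D i j)) x - ∇ (localLoss l D i) x) (∇ (localLoss l D i) x)
  rw [sub_add_cancel] at h1
  have h2 := mul_le_mul_of_nonneg_left (hglob x) (by positivity : 0 ≤ c * Real.sqrt M)
  linarith [hnoise i j x, hloc i x]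

end Loss

/-! ### Second moments of sums of independent centered variables -/

section Moments

variable {ι A : Type*} [Fintype ι] [MeasurableSpace A] {μ : ι → Measure A}
  [∀ i, IsProbabilityMeasure (μ i)]

theorem integral_add_sum_sq_pi {X : ι → A → ℝ} (hX : ∀ i, MemLp (X i) 2 (μ i))
    (h0 : ∀ i, ∫ a, X i a ∂μ i = 0) (c : ℝ) :
    ∫ w, (c + ∑ i, X i (w i)) ^ 2 ∂Measure.pi μ = c ^ 2 + ∑ i, ∫ a, X i a ^ 2 ∂μ i := by
  have hm : ∀ i, MemLp (fun w : ι → A => X i (w i)) 2 (Measure.pi μ) := fun i =>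
    (hX i).comp_measurePreserving (measurePreserving_eval μ i)
  have hs : MemLp (fun w : ι → A => ∑ i, X i (w i)) 2 (Measure.pi μ) :=
    memLp_finsetSum _ fun i _ => hm i
  have hi0 : ∫ w, ∑ i, X i (w i) ∂Measure.pi μ = 0 := by
    rw [integral_finsetSum _ fun i _ => (hm i).integrable one_le_two]
    refine Finset.sum_eq_zero fun i _ => ?_
    rw [integral_comp_eval (hX i).aestronglyMeasurable, h0 i]
  have hv := variance_sum_pi hX
  rw [variance_of_integral_eq_zero (by
    convert hs.aestronglyMeasurable.aemeasurable using 1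
    ext w; simp) (by simpa using hi0)] at hv
  have e : ∀ w : ι → A, (c + ∑ i, X i (w i)) ^ 2
      = c ^ 2 + 2 * c * ∑ i, X i (w i) + (∑ i, X i (w i)) ^ 2 := fun w => by ring
  simp_rw [e]
  have hi1 : Integrable (fun w : ι → A => 2 * c * ∑ i, X i (w i)) (Measure.pi μ) :=
    (hs.integrable one_le_two).const_mul _
  have hi2 : Integrable (fun w : ι → A => c ^ 2 + 2 * c * ∑ i, X i (w i)) (Measure.pi μ) :=
    (integrable_const _).add hi1
  rw [integral_add hi2 hs.integrable_sq, integral_add (integrable_const _) hi1,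
    integral_const_mul, hi0]
  simp only [integral_const, probReal_univ, one_smul, mul_zero, add_zero, add_right_inj]
  simp only [Finset.sum_apply] at hv
  rw [hv]
  refine Finset.sum_congr rfl fun i _ => ?_
  exact variance_of_integral_eq_zero (hX i).aestronglyMeasurable.aemeasurable (h0 i)

theorem memLp_sum_pi {d : ℕ} {Y : ι → A → Param d} (hY : ∀ i, MemLp (Y i) 2 (μ i)) :
    MemLp (fun w : ι → A => ∑ i, Y i (w i)) 2 (Measure.pi μ) :=
  memLp_finsetSum _ fun i _ => (hY i).comp_measurePreserving (measurePreserving_eval μ i)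

theorem integral_sum_pi {d : ℕ} {Y : ι → A → Param d} (hY : ∀ i, MemLp (Y i) 2 (μ i))
    (h0 : ∀ i, ∫ a, Y i a ∂μ i = 0) : ∫ w, ∑ i, Y i (w i) ∂Measure.pi μ = 0 := by
  have hi : ∀ i, Integrable (fun w : ι → A => Y i (w i)) (Measure.pi μ) := fun i =>
    ((hY i).comp_measurePreserving (measurePreserving_eval μ i)).integrable one_le_two
  rw [integral_finsetSum _ fun i _ => hi i]
  refine Finset.sum_eq_zero fun i _ => ?_
  exact (integral_comp_eval (hY i).aestronglyMeasurable).trans (h0 i)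

theorem integral_norm_add_sum_sq_pi {d : ℕ} {Y : ι → A → Param d}
    (hY : ∀ i, MemLp (Y i) 2 (μ i)) (h0 : ∀ i, ∫ a, Y i a ∂μ i = 0) (c : Param d) :
    ∫ w, ‖c + ∑ i, Y i (w i)‖ ^ 2 ∂Measure.pi μ = ‖c‖ ^ 2 + ∑ i, ∫ a, ‖Y i a‖ ^ 2 ∂μ i := by
  have hk : ∀ i (k : Fin d), MemLp (fun a => Y i a k) 2 (μ i) := fun i k =>
    (hY i).continuousLinearMap_comp (EuclideanSpace.proj (𝕜 := ℝ) k)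
  have hk0 : ∀ i (k : Fin d), ∫ a, Y i a k ∂μ i = 0 := fun i k => by
    have := ContinuousLinearMap.integral_comp_comm (EuclideanSpace.proj (𝕜 := ℝ) k)
      ((hY i).integrable one_le_two)
    simpa [h0 i] using this
  have hs : MemLp (fun w : ι → A => c + ∑ i, Y i (w i)) 2 (Measure.pi μ) :=
    (memLp_const c).add (memLp_sum_pi hY)
  simp_rw [EuclideanSpace.real_norm_sq_eq]
  have hi : ∀ k, Integrable (fun w : ι → A => (c + ∑ i, Y i (w i)) k ^ 2) (Measure.pi μ) :=
    fun k => (hs.continuousLinearMap_comp (EuclideanSpace.proj (𝕜 := ℝ) k)).integrable_sq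
  rw [integral_finsetSum _ fun k _ => hi k, Finset.sum_congr rfl fun i _ =>
    integral_finsetSum Finset.univ fun k _ => (hk i k).integrable_sq, Finset.sum_comm,
    ← Finset.sum_add_distrib]
  refine Finset.sum_congr rfl fun k _ => ?_
  rw [← integral_add_sum_sq_pi (fun i => hk i k) (fun i => hk0 i k) (c k)]
  simp

end Moments

theorem integral_uniformOn_univ {m : ℕ} {E : Type*} [NormedAddCommGroup E] [NormedSpace ℝ E]
    [CompleteSpace E] (hm : 0 < m) (f : Fin m → E) :
    ∫ j, f j ∂uniformOn (Set.univ : Set (Fin m)) = (1 / (m : ℝ)) • ∑ j, f j := by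
  have : NeZero m := ⟨hm.ne'⟩
  rw [integral_fintype (.of_finite), Finset.smul_sum]
  refine Finset.sum_congr rfl fun j _ => ?_
  congr 1
  rw [Measure.real, uniformOn_univ]
  simp

/-! ### Moments of affine functions of the noise of one iteration -/

section StepLaw

variable {n m d : ℕ} (G : SimpleGraph (Fin n)) [DecidableRel G.Adj] {vcor vcdp : ℝ}

/-- An affine function of the noise of one iteration. -/
def affineNoise {G : SimpleGraph (Fin n)} [DecidableRel G.Adj] (c : Param d)
    (Y : Fin n → Fin m → Param d) (B : G.edgeSet → ℝ) (A : Fin n → ℝ) (z : StepNoise G m d) :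
    Param d :=
  c + ∑ i, Y i (z.1 i) + ∑ e, B e • z.2.1 e + ∑ i, A i • z.2.2 i

variable {G}

theorem memLp_smul_gaussian (a v : ℝ) : MemLp (fun x : Param d => a • x) 2 (gaussian d v) :=
  (memLp_gaussian d v).const_smul a

theorem integral_smul_gaussian (a v : ℝ) : ∫ x : Param d, a • x ∂gaussian d v = 0 := by
  rw [integral_smul, integral_gaussian, smul_zero]

theorem integral_norm_smul_sq_gaussian (a : ℝ) {v : ℝ} (hv : 0 ≤ v) :
    ∫ x : Param d, ‖a • x‖ ^ 2 ∂gaussian d v = a ^ 2 * (d * v) := by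
  simp_rw [norm_smul, mul_pow, Real.norm_eq_abs, sq_abs]
  rw [integral_const_mul, integral_norm_sq_gaussian d hv]

theorem memLp_affineNoise (c : Param d) (Y : Fin n → Fin m → Param d) (B : G.edgeSet → ℝ)
    (A : Fin n → ℝ) : MemLp (affineNoise c Y B A) 2 (stepLaw G m d vcor vcdp) := by
  have h1 : MemLp (fun xi : Fin n → Fin m => ∑ i, Y i (xi i)) 2
      (uniformOn (Set.univ : Set (Fin n → Fin m))) :=
    MemLp.of_discrete
  have h2 := memLp_sum_pi (μ := fun _ : G.edgeSet => gaussian d vcor)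
    (Y := fun e x => B e • x) fun e => memLp_smul_gaussian (B e) vcor
  have h3 := memLp_sum_pi (μ := fun _ : Fin n => gaussian d vcdp)
    (Y := fun i x => A i • x) fun i => memLp_smul_gaussian (A i) vcdp
  have h1' := h1.comp_fst ((Measure.pi fun _ : G.edgeSet => gaussian d vcor).prod
      (Measure.pi fun _ : Fin n => gaussian d vcdp))
  have h2' := (h2.comp_fst (Measure.pi fun _ : Fin n => gaussian d vcdp)).comp_snd
    (uniformOn (Set.univ : Set (Fin n → Fin m)))
  have h3' := (h3.comp_snd (Measure.pi fun _ : G.edgeSet => gaussian d vcor)).comp_snd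
    (uniformOn (Set.univ : Set (Fin n → Fin m)))
  exact (((memLp_const c).add h1').add h2').add h3'

variable [NeZero m]

/-- The three noise sources are independent and centred, the samples thanks to `hY`, so second
moments add. They are integrated out by Fubini: private noise, then edge noise, then samples. -/
theorem integral_norm_sq_affineNoise (hcor : 0 ≤ vcor) (hcdp : 0 ≤ vcdp) (c : Param d)
    {Y : Fin n → Fin m → Param d} (hY : ∀ i, ∑ j, Y i j = 0) (B : G.edgeSet → ℝ) (A : Fin n → ℝ) :
    ∫ z, ‖affineNoise c Y B A z‖ ^ 2 ∂stepLaw G m d vcor vcdp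
      = ‖c‖ ^ 2 + ∑ i, (1 / (m : ℝ)) * ∑ j, ‖Y i j‖ ^ 2 + d * vcor * ∑ e, B e ^ 2
        + d * vcdp * ∑ i, A i ^ 2 := by
  have hinteg : Integrable (fun z => ‖affineNoise c Y B A z‖ ^ 2) (stepLaw G m d vcor vcdp) :=
    (memLp_affineNoise c Y B A).integrable_norm_pow two_ne_zero
  unfold stepLaw at hinteg ⊢
  rw [integral_prod _ hinteg]
  have h1 : ∀ᵐ xi ∂uniformOn (Set.univ : Set (Fin n → Fin m)),
      ∫ y, ‖affineNoise c Y B A (xi, y)‖ ^ 2 ∂(Measure.pi fun _ : G.edgeSet => gaussian d vcor).prod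
        (Measure.pi fun _ : Fin n => gaussian d vcdp)
      = ‖c + ∑ i, Y i (xi i)‖ ^ 2 + (∑ e, B e ^ 2 * (d * vcor) + ∑ i, A i ^ 2 * (d * vcdp)) := by
    filter_upwards [hinteg.prod_right_ae] with xi hxi
    rw [integral_prod _ hxi]
    have h2 : ∀ u : G.edgeSet → Param d, ∫ v, ‖affineNoise c Y B A (xi, u, v)‖ ^ 2
        ∂(Measure.pi fun _ : Fin n => gaussian d vcdp)
        = ‖c + ∑ i, Y i (xi i) + ∑ e, B e • u e‖ ^ 2 + ∑ i, A i ^ 2 * (d * vcdp) := by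
      intro u
      have := integral_norm_add_sum_sq_pi (μ := fun _ : Fin n => gaussian d vcdp)
        (Y := fun i x => A i • x) (fun i => memLp_smul_gaussian (A i) vcdp)
        (fun i => integral_smul_gaussian (A i) vcdp) (c + ∑ i, Y i (xi i) + ∑ e, B e • u e)
      simp_rw [integral_norm_smul_sq_gaussian _ hcdp] at this
      exact this
    simp_rw [h2]
    have h3 := integral_norm_add_sum_sq_pi (μ := fun _ : G.edgeSet => gaussian d vcor)
        (Y := fun e x => B e • x) (fun e => memLp_smul_gaussian (B e) vcor)
        (fun e => integral_smul_gaussian (B e) vcor) (c + ∑ i, Y i (xi i))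
    simp_rw [integral_norm_smul_sq_gaussian _ hcor] at h3
    have h5 : MemLp (fun u : G.edgeSet → Param d => c + ∑ i, Y i (xi i) + ∑ e, B e • u e) 2
        (Measure.pi fun _ : G.edgeSet => gaussian d vcor) :=
      (memLp_const (c + ∑ i, Y i (xi i))).add (memLp_sum_pi (μ := fun _ : G.edgeSet => gaussian d vcor)
        (Y := fun e x => B e • x) fun e => memLp_smul_gaussian (B e) vcor)
    rw [integral_add (h5.integrable_norm_pow two_ne_zero) (integrable_const _), h3, integral_const,
      probReal_univ, one_smul, add_assoc]
  rw [integral_congr_ae h1, integral_add Integrable.of_finite (integrable_const _),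
    uniformOn_univ_pi]
  have h4 := integral_norm_add_sum_sq_pi
    (μ := fun _ : Fin n => uniformOn (Set.univ : Set (Fin m))) (Y := Y)
    (fun i => MemLp.of_discrete) (fun i => by
      rw [integral_uniformOn_univ (NeZero.pos m), hY, smul_zero]) c
  simp_rw [integral_uniformOn_univ (NeZero.pos m), smul_eq_mul] at h4
  rw [h4, ← Finset.sum_mul, ← Finset.sum_mul]
  simp only [integral_const, probReal_univ, one_smul]
  ring

theorem integral_affineNoise (c : Param d) {Y : Fin n → Fin m → Param d}
    (hY : ∀ i, ∑ j, Y i j = 0) (B : G.edgeSet → ℝ) (A : Fin n → ℝ) :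
    ∫ z, affineNoise c Y B A z ∂stepLaw G m d vcor vcdp = c := by
  have hinteg : Integrable (affineNoise c Y B A) (stepLaw G m d vcor vcdp) :=
    (memLp_affineNoise c Y B A).integrable one_le_two
  unfold stepLaw at hinteg ⊢
  rw [integral_prod _ hinteg]
  have h1 : ∀ᵐ xi ∂uniformOn (Set.univ : Set (Fin n → Fin m)),
      ∫ y, affineNoise c Y B A (xi, y) ∂(Measure.pi fun _ : G.edgeSet => gaussian d vcor).prod
        (Measure.pi fun _ : Fin n => gaussian d vcdp) = c + ∑ i, Y i (xi i) := by
    filter_upwards [hinteg.prod_right_ae] with xi hxi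
    rw [integral_prod _ hxi]
    have h2 : ∀ u : G.edgeSet → Param d, ∫ v, affineNoise c Y B A (xi, u, v)
        ∂(Measure.pi fun _ : Fin n => gaussian d vcdp)
        = c + ∑ i, Y i (xi i) + ∑ e, B e • u e := by
      intro u
      have := integral_sum_pi (μ := fun _ : Fin n => gaussian d vcdp)
        (Y := fun i x => A i • x) (fun i => memLp_smul_gaussian (A i) vcdp)
        (fun i => integral_smul_gaussian (A i) vcdp)
      simp only [affineNoise]
      rw [integral_add (integrable_const _) ((memLp_sum_pi fun i =>
        memLp_smul_gaussian (A i) vcdp).integrable one_le_two), this]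
      simp
    simp_rw [h2]
    have h3 := integral_sum_pi (μ := fun _ : G.edgeSet => gaussian d vcor)
        (Y := fun e x => B e • x) (fun e => memLp_smul_gaussian (B e) vcor)
        (fun e => integral_smul_gaussian (B e) vcor)
    rw [integral_add (integrable_const _) ((memLp_sum_pi fun e =>
        memLp_smul_gaussian (B e) vcor).integrable one_le_two), h3]
    simp
  rw [integral_congr_ae h1, integral_add (integrable_const _) Integrable.of_finite,
    uniformOn_univ_pi]
  have h4 := integral_sum_pi
    (μ := fun _ : Fin n => uniformOn (Set.univ : Set (Fin m))) (Y := Y)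
    (fun i => MemLp.of_discrete) (fun i => by
      rw [integral_uniformOn_univ (NeZero.pos m), hY, smul_zero])
  rw [h4]
  simp

end StepLaw

/-! ### Averages and gossip -/

section Average

variable {n d : ℕ}

theorem sum_norm_sub_average_sq (hn : 0 < n) (a : Fin n → Param d) :
    ∑ i, ‖a i - average a‖ ^ 2 = ∑ i, ‖a i‖ ^ 2 - n * ‖average a‖ ^ 2 := by
  have hn' : (n : ℝ) ≠ 0 := by exact_mod_cast hn.ne'
  have h : ∑ i, a i = (n : ℝ) • average a := by
    rw [average, smul_smul, mul_one_div_cancel hn', one_smul]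
  simp only [norm_sub_sq_real, Finset.sum_add_distrib, Finset.sum_sub_distrib, ← Finset.mul_sum,
    ← sum_inner, h, real_inner_smul_left, real_inner_self_eq_norm_sq, Finset.sum_const,
    Finset.card_univ, Fintype.card_fin, nsmul_eq_mul]
  ring

theorem norm_average_sq_le (hn : 0 < n) (a : Fin n → Param d) :
    ‖average a‖ ^ 2 ≤ (1 / (n : ℝ)) * ∑ i, ‖a i‖ ^ 2 := by
  have hn' : (0 : ℝ) < n := by exact_mod_cast hn
  have h := sum_norm_sub_average_sq hn a
  have h0 : 0 ≤ ∑ i, ‖a i - average a‖ ^ 2 := Finset.sum_nonneg fun _ _ => sq_nonneg _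
  rw [one_div_mul_eq_div, le_div_iff₀ hn']
  linarith

theorem sum_norm_sub_average_sq_le (hn : 0 < n) (a : Fin n → Param d) :
    ∑ i, ‖a i - average a‖ ^ 2 ≤ ∑ i, ‖a i‖ ^ 2 := by
  rw [sum_norm_sub_average_sq hn]
  have : 0 ≤ (n : ℝ) * ‖average a‖ ^ 2 := by positivity
  linarith

theorem sum_norm_sub_average_sq_eq (hn : 0 < n) (x : Fin n → Param d) :
    ∑ i, ‖x i - average x‖ ^ 2 = n * consensusDist x := by
  have hn' : (n : ℝ) ≠ 0 := by exact_mod_cast hn.ne'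
  rw [consensusDist]; field_simp

theorem consensusDist_nonneg (x : Fin n → Param d) : 0 ≤ consensusDist x := by
  rw [consensusDist]; positivity

theorem average_sub (a b : Fin n → Param d) :
    average (fun i => a i - b i) = average a - average b := by
  simp [average, smul_sub]

theorem average_smul (c : ℝ) (a : Fin n → Param d) :
    average (fun i => c • a i) = c • average a := by
  simp only [average, ← Finset.smul_sum, smul_comm c]

variable {G : SimpleGraph (Fin n)} {W : Matrix (Fin n) (Fin n) ℝ} {p : ℝ}

theorem average_gossip (hW : IsMixingMatrix d G W p) (y : Fin n → Param d) :
    average (gossip W y) = average y := by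
  have h := sum_col_of_mem_doublyStochastic hW.stochastic
  simp only [average, gossip]
  rw [Finset.sum_comm]
  simp [← Finset.sum_smul, h]

theorem gossip_sub_average (W : Matrix (Fin n) (Fin n) ℝ) (y : Fin n → Param d) (k : Fin n) :
    gossip W y k - average y = ∑ j, (W k j - 1 / (n : ℝ)) • y j := by
  simp [gossip, average, sub_smul, Finset.sum_sub_distrib, Finset.smul_sum]

theorem consensusDist_gossip (hW : IsMixingMatrix d G W p) (y : Fin n → Param d) :
    consensusDist (gossip W y)
      = (1 / (n : ℝ)) * ∑ k, ‖∑ j, (W k j - 1 / (n : ℝ)) • y j‖ ^ 2 := by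
  simp only [consensusDist, average_gossip hW, gossip_sub_average]

/-- The contraction is tested on a family concentrated at one user, which bounds a column of W -
11ᵀ/n. The factor ‖y‖² cannot be dropped: for d = 0 the contraction says nothing about W. -/
theorem sum_coeff_sq_mul_le (hW : IsMixingMatrix d G W p) (hn : 0 < n) (j : Fin n) (y : Param d) :
    ∑ k, (W k j - 1 / (n : ℝ)) ^ 2 * ‖y‖ ^ 2 ≤ (1 - p) * ‖y‖ ^ 2 := by
  have h := hW.contraction (fun i => if i = j then y else 0)
  simp only [gossip_sub_average] at h
  simp only [smul_ite, smul_zero, Finset.sum_ite_eq', Finset.mem_univ, if_true, norm_smul, mul_pow,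
    Real.norm_eq_abs, sq_abs] at h
  refine h.trans (mul_le_mul_of_nonneg_left ?_ (by linarith [hW.rate_le_one]))
  refine (sum_norm_sub_average_sq_le hn _).trans (le_of_eq ?_)
  rw [Finset.sum_eq_single j (fun i _ hi => by simp [hi]) (by simp)]
  simp

/-- The noise of the edges after gossip. -/
theorem sum_sum_edgeValue_sq [DecidableRel G.Adj] (hW : W.IsSymm) :
    ∑ k, ∑ e : G.edgeSet,
        edgeValue (fun i j => (W k i - 1 / (n : ℝ)) - (W k j - 1 / (n : ℝ))) e.1 ^ 2
      = 2 * (mixingHeterogeneity G W * G.edgeFinset.card) := by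
  have h1 : ∀ k, 2 * ∑ e : G.edgeSet,
      edgeValue (fun i j => (W k i - 1 / (n : ℝ)) - (W k j - 1 / (n : ℝ))) e.1 ^ 2
      = ∑ i, ∑ j, if G.Adj i j then (W i k - W j k) ^ 2 else 0 := by
    intro k
    have key := sum_neighborSet_edge G (fun e =>
      edgeValue (fun i j => (W k i - 1 / (n : ℝ)) - (W k j - 1 / (n : ℝ))) e.1 ^ 2)
    rw [two_smul, ← two_mul] at key
    rw [← key]
    refine Finset.sum_congr rfl fun i _ => ?_
    rw [sum_neighborSet G i fun j _ =>
      edgeValue (fun i j => (W k i - 1 / (n : ℝ)) - (W k j - 1 / (n : ℝ))) s(i, j) ^ 2]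
    refine Finset.sum_congr rfl fun j _ => ?_
    rw [edgeValue_sq (fun i j => by ring), hW.apply i k, hW.apply j k]
    by_cases h : G.Adj i j <;> simp [h]
  have h2 : ∑ k, ∑ i, ∑ j, (if G.Adj i j then (W i k - W j k) ^ 2 else 0)
      = ∑ i, ∑ j, if G.Adj i j then ∑ k, (W i k - W j k) ^ 2 else 0 := by
    rw [Finset.sum_comm]
    refine Finset.sum_congr rfl fun i _ => ?_
    rw [Finset.sum_comm]
    refine Finset.sum_congr rfl fun j _ => ?_
    by_cases h : G.Adj i j <;> simp [h]
  have h3 : ∑ i, ∑ k, (if G.Adj i k then (1 : ℝ) else 0) = 2 * G.edgeFinset.card := by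
    have key := sum_neighborSet_edge G (fun _ => (1 : ℝ))
    simp only [Finset.sum_congr rfl fun i _ => sum_neighborSet G i fun _ _ => (1 : ℝ)] at key
    simp only [dite_eq_ite] at key
    rw [key]
    simp [SimpleGraph.edgeFinset, two_mul]
  have h4 : 2 * ∑ k, ∑ e : G.edgeSet,
        edgeValue (fun i j => (W k i - 1 / (n : ℝ)) - (W k j - 1 / (n : ℝ))) e.1 ^ 2
      = ∑ i, ∑ j, if G.Adj i j then ∑ k, (W i k - W j k) ^ 2 else 0 := by
    rw [← h2, Finset.mul_sum]
    exact Finset.sum_congr rfl fun k _ => h1 k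
  rw [mixingHeterogeneity, h3, ← h4]
  -- Without edges the quotient defining H is 0/0, read as 0, and both sides vanish.
  rcases eq_or_ne (G.edgeFinset.card) 0 with h0 | h0
  · have : IsEmpty G.edgeSet := by
      rw [Finset.card_eq_zero, SimpleGraph.edgeFinset, Set.toFinset_eq_empty] at h0
      exact Set.isEmpty_coe_sort.2 h0
    simp
  · have : (G.edgeFinset.card : ℝ) ≠ 0 := by exact_mod_cast h0
    field_simp

end Average

/-! ### One iteration of the algorithm -/

section Step

variable {n d m : ℕ} {X : Type*} (G : SimpleGraph (Fin n)) [DecidableRel G.Adj]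

/-- One iteration without clipping. -/
def stepMap (l : Param d → X → ℝ) (W : Matrix (Fin n) (Fin n) ℝ) (D : Fin n → Fin m → X)
    (eta : ℝ) (x : Fin n → Param d) (z : StepNoise G m d) : Fin n → Param d :=
  gossip W (halfStep G id l D eta z.1 z.2.1 z.2.2 x)

variable {l : Param d → X → ℝ} {D : Fin n → Fin m → X}

/-- Deviation of the stochastic gradient from the local gradient. -/
def gradDev (l : Param d → X → ℝ) (D : Fin n → Fin m → X) (x : Fin n → Param d) (i : Fin n)
    (j : Fin m) : Param d :=
  ∇ (fun y => l y (D i j)) (x i) - ∇ (localLoss l D i) (x i)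

/-- Two choices of weights matter: 1/n for the average, where the edge coefficients vanish, and W_kj
- 1/n for the deviation of user k from the average after gossip. -/
theorem sum_smul_halfStep (eta : ℝ) (x : Fin n → Param d) (a : Fin n → ℝ) (z : StepNoise G m d) :
    ∑ j, a j • halfStep G id l D eta z.1 z.2.1 z.2.2 x j
      = affineNoise (∑ j, a j • (x j - eta • ∇ (localLoss l D j) (x j)))
          (fun i j => (-(eta * a i)) • gradDev l D x i j)
          (fun e => -eta * edgeValue (fun i j => a i - a j) e.1) (fun i => -(eta * a i)) z := by
  have h := sum_smul_pairNoise G (fun i => -eta * a i) z.2.1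
  have h' : ∀ e : G.edgeSet, edgeValue (fun i j => -eta * a i - -eta * a j) e.1
      = -eta * edgeValue (fun i j => a i - a j) e.1 := by
    rintro ⟨e, he⟩
    induction e using Sym2.ind with
    | _ i j => simp only [edgeValue_mk]; split_ifs <;> ring
  simp_rw [h'] at h
  rw [affineNoise, ← h, ← Finset.sum_add_distrib, ← Finset.sum_add_distrib,
    ← Finset.sum_add_distrib]
  refine Finset.sum_congr rfl fun i _ => ?_
  simp only [halfStep, gradDev, id]
  module

variable {L P M sigma zeta : ℝ}

theorem sum_gradDev (h : LossAssumptions l D L P M sigma zeta) (hm : 0 < m) (x : Fin n → Param d)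
    (i : Fin n) : ∑ j, gradDev l D x i j = 0 := by
  have hm' : (m : ℝ) ≠ 0 := by exact_mod_cast hm.ne'
  simp only [gradDev, Finset.sum_sub_distrib, gradient_localLoss h, Finset.sum_const,
    Finset.card_univ, Fintype.card_fin]
  rw [← Nat.cast_smul_eq_nsmul ℝ, smul_smul, mul_one_div_cancel hm', one_smul, sub_self]

theorem sum_gradDev_sq_le (h : LossAssumptions l D L P M sigma zeta) (hn : 0 < n)
    (hM : 0 ≤ M) (x : Fin n → Param d) :
    ∑ i, (1 / (m : ℝ)) * ∑ j, ‖gradDev l D x i j‖ ^ 2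
      ≤ n * (sigma ^ 2 + 2 * M * (‖∇ (globalLoss l D) (average x)‖ ^ 2 + L ^ 2 * consensusDist x)) := by
  have hn' : (0 : ℝ) < n := by exact_mod_cast hn
  have h1 := h.noise x
  have h2 : ∑ i, ‖∇ (globalLoss l D) (x i)‖ ^ 2
      ≤ 2 * n * (‖∇ (globalLoss l D) (average x)‖ ^ 2 + L ^ 2 * consensusDist x) := by
    calc ∑ i, ‖∇ (globalLoss l D) (x i)‖ ^ 2
        ≤ ∑ i, (2 * ‖∇ (globalLoss l D) (average x)‖ ^ 2 + 2 * L ^ 2 * ‖x i - average x‖ ^ 2) := by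
          refine Finset.sum_le_sum fun i _ => ?_
          have e1 := lipschitz_gradient_globalLoss h hn (x i) (average x)
          have e2 := norm_sub_norm_le (∇ (globalLoss l D) (x i)) (∇ (globalLoss l D) (average x))
          have e3 : ‖∇ (globalLoss l D) (x i)‖ ≤
            ‖∇ (globalLoss l D) (average x)‖ + L * ‖x i - average x‖ := by linarith
          calc ‖∇ (globalLoss l D) (x i)‖ ^ 2
              ≤ (‖∇ (globalLoss l D) (average x)‖ + L * ‖x i - average x‖) ^ 2 := by gcongr
            _ ≤ _ := by nlinarith [sq_nonneg (‖∇ (globalLoss l D) (average x)‖ - L * ‖x i - average x‖)]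
      _ = _ := by
          rw [Finset.sum_add_distrib, ← Finset.mul_sum, ← Finset.mul_sum,
            sum_norm_sub_average_sq_eq hn, Finset.sum_const, Finset.card_univ, Fintype.card_fin, nsmul_eq_mul]
          ring
  rw [one_div_mul_eq_div, div_le_iff₀ hn'] at h1
  refine h1.trans ?_
  have h3 : M / n * ∑ i, ‖∇ (globalLoss l D) (x i)‖ ^ 2
      ≤ M / n * (2 * n * (‖∇ (globalLoss l D) (average x)‖ ^ 2 + L ^ 2 * consensusDist x)) := by
    gcongr
  have h4 : M / n * (2 * n * (‖∇ (globalLoss l D) (average x)‖ ^ 2 + L ^ 2 * consensusDist x))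
      = 2 * M * (‖∇ (globalLoss l D) (average x)‖ ^ 2 + L ^ 2 * consensusDist x) := by
    field_simp
  nlinarith

theorem norm_gradient_sub_average_sq_le (h : LossAssumptions l D L P M sigma zeta) (hn : 0 < n)
    (x : Fin n → Param d) :
    ‖∇ (globalLoss l D) (average x) - average (fun i => ∇ (localLoss l D i) (x i))‖ ^ 2
      ≤ L ^ 2 * consensusDist x := by
  have e : ∇ (globalLoss l D) (average x) = average (fun i => ∇ (localLoss l D i) (average x)) :=
    gradient_globalLoss h _
  rw [e, ← average_sub]
  refine (norm_average_sq_le hn _).trans ?_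
  rw [consensusDist, ← mul_assoc, mul_comm (L ^ 2), mul_assoc, Finset.mul_sum Finset.univ _ (L ^ 2)]
  refine mul_le_mul_of_nonneg_left (Finset.sum_le_sum fun i _ => ?_) (by positivity)
  have := h.smooth i (average x) (x i)
  rw [norm_sub_rev (average x)] at this
  rw [← mul_pow]
  gcongr

theorem sum_norm_gradient_localLoss_sq_le (h : LossAssumptions l D L P M sigma zeta) (hn : 0 < n)
    (x : Fin n → Param d) :
    ∑ i, ‖∇ (localLoss l D i) (x i)‖ ^ 2
      ≤ n * (2 * (zeta ^ 2 + max 1 P * ‖∇ (globalLoss l D) (average x)‖ ^ 2)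
        + 2 * (L ^ 2 * consensusDist x)) := by
  have hn' : (0 : ℝ) < n := by exact_mod_cast hn
  have h1 := h.heterogeneity (average x)
  rw [one_div_mul_eq_div, div_le_iff₀ hn'] at h1
  have h2 : P * ‖∇ (globalLoss l D) (average x)‖ ^ 2
      ≤ max 1 P * ‖∇ (globalLoss l D) (average x)‖ ^ 2 := by
    gcongr; exact le_max_right _ _
  calc ∑ i, ‖∇ (localLoss l D i) (x i)‖ ^ 2
      ≤ ∑ i, (2 * ‖∇ (localLoss l D i) (average x)‖ ^ 2 + 2 * L ^ 2 * ‖x i - average x‖ ^ 2) := by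
        refine Finset.sum_le_sum fun i _ => ?_
        have e1 := h.smooth i (x i) (average x)
        have e2 := norm_sub_norm_le (∇ (localLoss l D i) (x i)) (∇ (localLoss l D i) (average x))
        have e3 : ‖∇ (localLoss l D i) (x i)‖ ≤
          ‖∇ (localLoss l D i) (average x)‖ + L * ‖x i - average x‖ := by linarith
        calc ‖∇ (localLoss l D i) (x i)‖ ^ 2
            ≤ (‖∇ (localLoss l D i) (average x)‖ + L * ‖x i - average x‖) ^ 2 := by gcongr
          _ ≤ _ := by
            nlinarith [sq_nonneg (‖∇ (localLoss l D i) (average x)‖ - L * ‖x i - average x‖)]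
    _ = 2 * ∑ i, ‖∇ (localLoss l D i) (average x)‖ ^ 2 + 2 * L ^ 2 * (n * consensusDist x) := by
        rw [Finset.sum_add_distrib, ← Finset.mul_sum, ← Finset.mul_sum,
          sum_norm_sub_average_sq_eq hn]
    _ ≤ _ := by nlinarith

end Step

/-! ### Scalar inequalities behind the one-step estimates -/

/-- The condition ηL ≤ 1 lets the negative h² term absorb the quadratic one. The condition ηLM/n ≤
1/4 spends half of the decrease (η/2)g² on the multiplicative sampling noise and raises the factor
of ηL²Ξ from 1/2 to 3/4. -/
theorem descent_algebra {n L M eta sigma Ξ S v F g h r : ℝ} (hn' : 0 < n) (hL : 0 < L)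
    (heta : 0 ≤ eta) (hetaL : eta * L ≤ 1) (hetaM : eta * (L * M / n) ≤ 1 / 4) (hΞ0 : 0 ≤ Ξ)
    (hS : S ≤ n * (sigma ^ 2 + 2 * M * (g ^ 2 + L ^ 2 * Ξ))) (hr : r ≤ L ^ 2 * Ξ) :
    F + -(eta / 2) * (g ^ 2 + h ^ 2 - r)
        + L / 2 * (eta ^ 2 * h ^ 2 + (eta / n) ^ 2 * S + v * (eta ^ 2 / n))
      ≤ F - eta / 4 * g ^ 2 + 3 / 4 * eta * L ^ 2 * Ξ
        + L * eta ^ 2 / (2 * n) * (sigma ^ 2 + v) := by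
  have k1 : (eta / n) ^ 2 * S
      ≤ (eta / n) ^ 2 * (n * (sigma ^ 2 + 2 * M * (g ^ 2 + L ^ 2 * Ξ))) := by gcongr
  have k2 : (eta / n) ^ 2 * (n * (sigma ^ 2 + 2 * M * (g ^ 2 + L ^ 2 * Ξ)))
      = eta ^ 2 / n * sigma ^ 2 + 2 * (eta ^ 2 * M / n) * (g ^ 2 + L ^ 2 * Ξ) := by
    field_simp
  have k3 : L * (eta ^ 2 * M / n) ≤ eta / 4 := by
    have : L * (eta ^ 2 * M / n) = eta * (eta * (L * M / n)) := by ring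
    rw [this]
    linarith [mul_le_mul_of_nonneg_left hetaM heta]
  have k4 : L * (eta ^ 2 * M / n) * (g ^ 2 + L ^ 2 * Ξ) ≤ eta / 4 * (g ^ 2 + L ^ 2 * Ξ) := by
    gcongr
  have k5 : L * (eta ^ 2 * h ^ 2) ≤ eta * h ^ 2 := by
    have e : L * (eta ^ 2 * h ^ 2) = eta * L * (eta * h ^ 2) := by ring
    have := mul_le_mul_of_nonneg_right hetaL (by positivity : 0 ≤ eta * h ^ 2)
    linarith
  have k6 : eta / 2 * r ≤ eta / 2 * (L ^ 2 * Ξ) := by gcongr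
  have k7 : L * eta ^ 2 / (2 * n) * (sigma ^ 2 + v)
      = L / 2 * (eta ^ 2 / n * sigma ^ 2) + L / 2 * (v * (eta ^ 2 / n)) := by
    field_simp
  have k8 := mul_le_mul_of_nonneg_left (k1.trans_eq k2) (by positivity : 0 ≤ L / 2)
  rw [k7]
  linarith

/-- Here (1 - p)(1 + p/2) ≤ 1 - p/2, and the stepsize condition keeps the feedback of Ξ through the
gradients below p/24, whence 1 - 11p/24. -/
theorem consensus_algebra {L M P eta sigma zeta Ξ g p : ℝ} (hp : 0 < p) (hp1 : p ≤ 1)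
    (hP : 1 ≤ P) (hM : 0 ≤ M) (hΞ0 : 0 ≤ Ξ)
    (heta : 48 * (1 - p) * (3 * P + p * M) * (eta * L) ^ 2 ≤ p ^ 2) :
    (1 - p) * ((1 + p / 2) * Ξ
        + 3 / p * (eta ^ 2 * (2 * (zeta ^ 2 + P * g ^ 2) + 2 * (L ^ 2 * Ξ))))
      + eta ^ 2 * (1 - p) * (sigma ^ 2 + 2 * M * (g ^ 2 + L ^ 2 * Ξ))
      ≤ (1 - 11 / 24 * p) * Ξ + 2 * (1 - p) / p * (3 * P + p * M) * eta ^ 2 * g ^ 2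
        + eta ^ 2 * ((1 - p) * (6 * zeta ^ 2 / p + sigma ^ 2)) := by
  have hq : 0 ≤ 1 - p := by linarith
  have c1 : (1 - p) * ((1 + p / 2) * Ξ
      + 3 / p * (eta ^ 2 * (2 * (zeta ^ 2 + P * g ^ 2) + 2 * (L ^ 2 * Ξ))))
      + eta ^ 2 * (1 - p) * (sigma ^ 2 + 2 * M * (g ^ 2 + L ^ 2 * Ξ))
      = ((1 - p) * (1 + p / 2) + 2 * (1 - p) / p * (3 + p * M) * (eta * L) ^ 2) * Ξ
        + 2 * (1 - p) / p * (3 * P + p * M) * eta ^ 2 * g ^ 2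
        + eta ^ 2 * ((1 - p) * (6 * zeta ^ 2 / p + sigma ^ 2)) := by
    field_simp; ring
  rw [c1]
  have c2 : 2 * (1 - p) / p * (3 + p * M) * (eta * L) ^ 2 ≤ p / 24 := by
    have c3 : 48 * (1 - p) * (3 + p * M) * (eta * L) ^ 2 ≤ p ^ 2 := by
      refine le_trans ?_ heta
      gcongr
      linarith
    have c4 : 2 * (1 - p) / p * (3 + p * M) * (eta * L) ^ 2
        = 48 * (1 - p) * (3 + p * M) * (eta * L) ^ 2 / (24 * p) := by field_simp; ring
    have c5 : p / 24 = p ^ 2 / (24 * p) := by field_simp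
    rw [c4, c5]
    gcongr
  have c5 : (1 - p) * (1 + p / 2) ≤ 1 - p / 2 := by nlinarith only [sq_nonneg p]
  have c6 : ((1 - p) * (1 + p / 2) + 2 * (1 - p) / p * (3 + p * M) * (eta * L) ^ 2) * Ξ
      ≤ (1 - 11 / 24 * p) * Ξ := by
    refine mul_le_mul_of_nonneg_right ?_ hΞ0
    linarith
  linarith

/-- Young's inequality with weight p/2, and 1 + 2/p ≤ 3/p for p ≤ 1. -/
theorem norm_sub_smul_sq_le {E : Type*} [NormedAddCommGroup E] [InnerProductSpace ℝ E] {p : ℝ}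
    (hp : 0 < p) (hp1 : p ≤ 1) (eta : ℝ) (u v : E) :
    ‖u - eta • v‖ ^ 2 ≤ (1 + p / 2) * ‖u‖ ^ 2 + 3 / p * (eta ^ 2 * ‖v‖ ^ 2) := by
  have e2 : ‖u - eta • v‖ ≤ ‖u‖ + |eta| * ‖v‖ := by
    refine (norm_sub_le _ _).trans_eq ?_
    rw [norm_smul, Real.norm_eq_abs]
  have e3 : ‖u - eta • v‖ ^ 2 ≤ (‖u‖ + |eta| * ‖v‖) ^ 2 := by gcongr
  refine e3.trans ?_
  rw [← sq_abs eta, ← mul_pow]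
  generalize ‖u‖ = r
  generalize |eta| * ‖v‖ = s
  have e4 : 2 * r * s ≤ p / 2 * r ^ 2 + 2 / p * s ^ 2 := by
    have : p / 2 * r ^ 2 + 2 / p * s ^ 2 - 2 * r * s = (p * r - 2 * s) ^ 2 / (2 * p) := by
      field_simp; ring
    have : 0 ≤ (p * r - 2 * s) ^ 2 / (2 * p) := by positivity
    linarith
  have e5 : 1 + 2 / p ≤ 3 / p := by
    rw [← sub_nonneg]
    have : 3 / p - (1 + 2 / p) = (1 - p) / p := by field_simp; ring
    rw [this]; exact div_nonneg (by linarith) hp.le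
  have e6 := mul_le_mul_of_nonneg_right e5 (sq_nonneg s)
  linarith

/-! ### Expected loss and consensus distance after one iteration -/

section OneStep

variable {n d m : ℕ} {X : Type*} {G : SimpleGraph (Fin n)} [DecidableRel G.Adj]
  {l : Param d → X → ℝ} {D : Fin n → Fin m → X} {W : Matrix (Fin n) (Fin n) ℝ}
  {L P M sigma zeta p : ℝ}

theorem measurable_globalLoss (h : LossAssumptions l D L P M sigma zeta) :
    Measurable (globalLoss l D) := (differentiable_globalLoss h).continuous.measurable

/-- The loss of a square integrable random point is integrable. -/
theorem integrable_globalLoss_comp (h : LossAssumptions l D L P M sigma zeta) (hn : 0 < n)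
    {Ω : Type*} [MeasurableSpace Ω] {μ : Measure Ω} [IsFiniteMeasure μ] {y : Ω → Param d}
    (hy : MemLp y 2 μ) : Integrable (fun w => globalLoss l D (y w)) μ := by
  have h1 : Integrable (fun w => |lossInf l D| + (|globalLoss l D 0|
      + ‖∇ (globalLoss l D) 0‖ * ‖y w‖ + |L| / 2 * ‖y w‖ ^ 2)) μ :=
    (integrable_const _).add (((integrable_const _).add
      ((hy.integrable one_le_two).norm.const_mul _)).add
        ((hy.integrable_norm_pow two_ne_zero).const_mul _))
  refine h1.mono' ((differentiable_globalLoss h).continuous.comp_aestronglyMeasurable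
    hy.aestronglyMeasurable) (Filter.Eventually.of_forall fun w => ?_)
  have h2 := le_add_inner_gradient (differentiable_globalLoss h)
    (lipschitz_gradient_globalLoss h hn) 0 (y w)
  rw [sub_zero] at h2
  have h3 := real_inner_le_norm (∇ (globalLoss l D) 0) (y w)
  have h4 := lossInf_le h (y w)
  have h5 : L / 2 * ‖y w‖ ^ 2 ≤ |L| / 2 * ‖y w‖ ^ 2 := by gcongr; exact le_abs_self L
  have h6 : 0 ≤ ‖∇ (globalLoss l D) 0‖ * ‖y w‖ := by positivity
  have h7 : 0 ≤ |L| / 2 * ‖y w‖ ^ 2 := by positivity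
  rw [Real.norm_eq_abs, abs_le]
  constructor
  · linarith [neg_abs_le (lossInf l D), abs_nonneg (globalLoss l D 0)]
  · linarith [le_abs_self (globalLoss l D 0), abs_nonneg (lossInf l D)]

/-- The squared gradient at a square integrable random point is integrable. -/
theorem integrable_norm_gradient_sq_comp (h : LossAssumptions l D L P M sigma zeta) (hn : 0 < n)
    {Ω : Type*} [MeasurableSpace Ω] {μ : Measure Ω} [IsFiniteMeasure μ] {y : Ω → Param d}
    (hy : MemLp y 2 μ) : Integrable (fun w => ‖∇ (globalLoss l D) (y w)‖ ^ 2) μ := by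
  have h1 : MemLp (fun w => ‖∇ (globalLoss l D) 0‖ + L * ‖y w‖) 2 μ :=
    (memLp_const ‖∇ (globalLoss l D) 0‖).add (hy.norm.const_mul L)
  have h2 : MemLp (fun w => ∇ (globalLoss l D) (y w)) 2 μ := by
    refine h1.mono ((measurable_gradient (globalLoss l D)).comp_aemeasurable
      hy.aestronglyMeasurable.aemeasurable).aestronglyMeasurable
      (Filter.Eventually.of_forall fun w => ?_)
    have h3 := lipschitz_gradient_globalLoss h hn (y w) 0
    rw [sub_zero] at h3
    have h4 := norm_sub_norm_le (∇ (globalLoss l D) (y w)) (∇ (globalLoss l D) 0)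
    exact (by linarith : _ ≤ _).trans (Real.le_norm_self _)
  exact h2.integrable_norm_pow two_ne_zero

theorem average_halfStep_sub (eta : ℝ)
    (x : Fin n → Param d) (z : StepNoise G m d) :
    average (halfStep G id l D eta z.1 z.2.1 z.2.2 x) - average x
      = affineNoise (-(eta • average fun i => ∇ (localLoss l D i) (x i)))
          (fun i j => (-(eta * (1 / (n : ℝ)))) • gradDev l D x i j)
          (fun _ => 0) (fun _ => -(eta * (1 / (n : ℝ)))) z := by
  have h1 := sum_smul_halfStep G (l := l) (D := D) eta x (fun _ => 1 / (n : ℝ)) z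
  have h2 : ∀ e : G.edgeSet, -eta * edgeValue (fun _ _ : Fin n => 1 / (n : ℝ) - 1 / (n : ℝ)) e.1 = 0 := by
    rintro ⟨e, he⟩
    induction e using Sym2.ind with
    | _ i j => simp [edgeValue_mk]
  simp only [h2] at h1
  rw [average, Finset.smul_sum, h1]
  simp only [affineNoise, smul_sub, Finset.sum_sub_distrib]
  have h3 : ∑ j, (1 / (n : ℝ)) • x j = average x := by rw [average, Finset.smul_sum]
  have h4 : ∑ j, (1 / (n : ℝ)) • eta • ∇ (localLoss l D j) (x j)
      = eta • average fun i => ∇ (localLoss l D i) (x i) := by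
    rw [average, Finset.smul_sum, Finset.smul_sum]
    exact Finset.sum_congr rfl fun i _ => smul_comm _ _ _
  rw [h3, h4]
  abel

variable [NeZero m] {vcor vcdp : ℝ}

/-- Expected decrease of the loss in one iteration. -/
theorem integral_globalLoss_stepMap_le (h : LossAssumptions l D L P M sigma zeta) (hn : 0 < n)
    (hL : 0 < L) (hM : 0 ≤ M) (hW : IsMixingMatrix d G W p) (hcor : 0 ≤ vcor) (hcdp : 0 ≤ vcdp)
    {eta : ℝ} (heta : 0 ≤ eta) (hetaL : eta * L ≤ 1) (hetaM : eta * (L * M / n) ≤ 1 / 4)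
    (x : Fin n → Param d) :
    ∫ z, globalLoss l D (average (stepMap G l W D eta x z)) ∂stepLaw G m d vcor vcdp
      ≤ globalLoss l D (average x) - eta / 4 * ‖∇ (globalLoss l D) (average x)‖ ^ 2
        + 3 / 4 * eta * L ^ 2 * consensusDist x
        + L * eta ^ 2 / (2 * n) * (sigma ^ 2 + d * vcdp) := by
  have hn' : (0 : ℝ) < n := by exact_mod_cast hn
  set f := globalLoss l D
  set g := ∇ f (average x) with hg
  set hb := average fun i => ∇ (localLoss l D i) (x i) with hhb
  set Ξ := consensusDist x with hΞ
  have hΞ0 : 0 ≤ Ξ := consensusDist_nonneg x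
  let c : Param d := -(eta • hb)
  let Y : Fin n → Fin m → Param d := fun i j => (-(eta * (1 / (n : ℝ)))) • gradDev l D x i j
  let A : Fin n → ℝ := fun _ => -(eta * (1 / (n : ℝ)))
  let V : StepNoise G m d → Param d := affineNoise c Y (fun _ => 0) A
  have hY : ∀ i, ∑ j, Y i j = 0 := fun i => by
    simp only [Y, ← Finset.smul_sum, sum_gradDev h (NeZero.pos m), smul_zero]
  -- Gossip preserves the average and constant weights cancel the edge noise, so the edge
  -- coefficients are zero.
  have hV : ∀ z, average (stepMap G l W D eta x z) - average x = V z := fun z => by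
    rw [stepMap, average_gossip hW, average_halfStep_sub]
  have hVm : MemLp V 2 (stepLaw G m d vcor vcdp) := memLp_affineNoise c Y _ A
  have hV1 : ∫ z, V z ∂stepLaw G m d vcor vcdp = c := integral_affineNoise c hY _ A
  have hV2 : ∫ z, ‖V z‖ ^ 2 ∂stepLaw G m d vcor vcdp = _ :=
    integral_norm_sq_affineNoise hcor hcdp c hY _ A
  have hx : ∀ z, average (stepMap G l W D eta x z) = average x + V z := fun z => by
    rw [← hV z]; abel
  have hi1 : Integrable (fun z => inner ℝ g (V z)) (stepLaw G m d vcor vcdp) :=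
    (hVm.integrable one_le_two).const_inner g
  have hi2 : Integrable (fun z => ‖V z‖ ^ 2) (stepLaw G m d vcor vcdp) :=
    hVm.integrable_norm_pow two_ne_zero
  have hi3 : Integrable (fun z => f (average x) + inner ℝ g (V z)) (stepLaw G m d vcor vcdp) :=
    (integrable_const (f (average x))).add hi1
  have hdev := sum_gradDev_sq_le h hn hM x
  have hgh := norm_gradient_sub_average_sq_le h hn x
  rw [← hg, ← hhb, ← hΞ] at hgh
  have h1 : ∫ z, f (average (stepMap G l W D eta x z)) ∂stepLaw G m d vcor vcdp
      ≤ ∫ z, (f (average x) + inner ℝ g (V z) + L / 2 * ‖V z‖ ^ 2) ∂stepLaw G m d vcor vcdp := by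
    refine integral_mono ?_ (hi3.add (hi2.const_mul _)) fun z => ?_
    · simp_rw [hx]
      exact integrable_globalLoss_comp h hn ((memLp_const (average x)).add hVm)
    · have := le_add_inner_gradient (differentiable_globalLoss h)
        (lipschitz_gradient_globalLoss h hn) (average x) (average (stepMap G l W D eta x z))
      rw [hV z] at this
      exact this
  rw [integral_add hi3 (hi2.const_mul _), integral_add (integrable_const _) hi1,
    integral_const_mul, integral_inner (hVm.integrable one_le_two) g, hV1, hV2] at h1
  simp only [integral_const, probReal_univ, one_smul] at h1
  refine h1.trans ?_
  have e1 : ∑ i, 1 / (m : ℝ) * ∑ j, ‖Y i j‖ ^ 2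
      = (eta / n) ^ 2 * ∑ i, 1 / (m : ℝ) * ∑ j, ‖gradDev l D x i j‖ ^ 2 := by
    simp only [Y, norm_smul, mul_pow, Real.norm_eq_abs, sq_abs, neg_sq, ← Finset.mul_sum]
    ring
  have e2 : ∑ i, A i ^ 2 = eta ^ 2 / n := by
    simp only [A, neg_sq, Finset.sum_const, Finset.card_univ, Fintype.card_fin, nsmul_eq_mul]
    field_simp
  have e3 : ‖c‖ ^ 2 = eta ^ 2 * ‖hb‖ ^ 2 := by
    simp only [c, norm_neg, norm_smul, mul_pow, Real.norm_eq_abs, sq_abs]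
  -- Polarisation keeps both negative squares; the error ‖g - hb‖² is controlled by the consensus
  -- distance through smoothness.
  have e4 : inner ℝ g c = -(eta / 2) * (‖g‖ ^ 2 + ‖hb‖ ^ 2 - ‖g - hb‖ ^ 2) := by
    simp only [c, inner_neg_right, real_inner_smul_right, norm_sub_sq_real]; ring
  rw [e1, e2, e3, e4]
  simp only [ne_eq, OfNat.ofNat_ne_zero, not_false_eq_true, zero_pow, Finset.sum_const_zero,
    mul_zero, add_zero]
  exact descent_algebra hn' hL heta hetaL hetaM hΞ0 hdev hgh

/-- Expected consensus distance after one iteration. -/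
theorem integral_consensusDist_stepMap_le (h : LossAssumptions l D L P M sigma zeta) (hn : 0 < n)
    (hM : 0 ≤ M) (hW : IsMixingMatrix d G W p) (hcor : 0 ≤ vcor) (hcdp : 0 ≤ vcdp)
    {eta : ℝ} (heta : 48 * (1 - p) * (3 * max 1 P + p * M) * (eta * L) ^ 2 ≤ p ^ 2)
    (x : Fin n → Param d) :
    ∫ z, consensusDist (stepMap G l W D eta x z) ∂stepLaw G m d vcor vcdp
      ≤ (1 - 11 / 24 * p) * consensusDist x
        + 2 * (1 - p) / p * (3 * max 1 P + p * M) * eta ^ 2 * ‖∇ (globalLoss l D) (average x)‖ ^ 2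
        + eta ^ 2 * ((1 - p) * (6 * zeta ^ 2 / p + sigma ^ 2) + d / n *
          (2 * vcor * (mixingHeterogeneity G W * G.edgeFinset.card) + vcdp * distToAverageSq W)) := by
  have hn' : (0 : ℝ) < n := by exact_mod_cast hn
  have hp := hW.rate_pos
  have hp1 := hW.rate_le_one
  set g := ∇ (globalLoss l D) (average x) with hg
  set Ξ := consensusDist x with hΞ
  have hΞ0 : 0 ≤ Ξ := consensusDist_nonneg x
  -- Gossip followed by subtraction of the average has matrix W - 11ᵀ/n.
  let w : Fin n → Fin n → ℝ := fun k j => W k j - 1 / (n : ℝ)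
  let a : Fin n → Param d := fun j => x j - eta • ∇ (localLoss l D j) (x j)
  let c : Fin n → Param d := fun k => ∑ j, w k j • a j
  let Y : Fin n → Fin n → Fin m → Param d := fun k i j => (-(eta * w k i)) • gradDev l D x i j
  let B : Fin n → G.edgeSet → ℝ := fun k e => -eta * edgeValue (fun i j => w k i - w k j) e.1
  let A : Fin n → Fin n → ℝ := fun k i => -(eta * w k i)
  have hY : ∀ k i, ∑ j, Y k i j = 0 := fun k i => by
    simp only [Y, ← Finset.smul_sum, sum_gradDev h (NeZero.pos m), smul_zero]
  have h1 : ∀ z, consensusDist (stepMap G l W D eta x z)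
      = (1 / (n : ℝ)) * ∑ k, ‖affineNoise (c k) (Y k) (B k) (A k) z‖ ^ 2 := by
    intro z
    rw [stepMap, consensusDist_gossip hW]
    congr 1
    refine Finset.sum_congr rfl fun k _ => ?_
    rw [sum_smul_halfStep G (l := l) (D := D) eta x (fun j => W k j - 1 / (n : ℝ)) z]
  simp_rw [h1]
  rw [integral_const_mul, integral_finsetSum _ fun k _ =>
    (memLp_affineNoise (c k) (Y k) (B k) (A k)).integrable_norm_pow two_ne_zero]
  simp_rw [integral_norm_sq_affineNoise hcor hcdp (c _) (hY _) (B _) (A _)]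
  simp only [Finset.sum_add_distrib, ← Finset.mul_sum]
  have hdet : ∑ k, ‖c k‖ ^ 2 ≤ (1 - p) * ((1 + p / 2) * (n * Ξ)
      + 3 / p * (eta ^ 2 * ∑ i, ‖∇ (localLoss l D i) (x i)‖ ^ 2)) := by
    have h2 := hW.contraction a
    simp only [gossip_sub_average] at h2
    refine h2.trans (mul_le_mul_of_nonneg_left ?_ (by linarith))
    have h3 : average a = average x - eta • average fun j => ∇ (localLoss l D j) (x j) := by
      rw [← average_smul, ← average_sub]
    have h4 := sum_norm_sub_average_sq_le hn fun j => ∇ (localLoss l D j) (x j)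
    set F : Fin n → Param d := fun j => ∇ (localLoss l D j) (x j) with hF
    calc ∑ i, ‖a i - average a‖ ^ 2
        ≤ ∑ i, ((1 + p / 2) * ‖x i - average x‖ ^ 2 + 3 / p * (eta ^ 2 * ‖F i - average F‖ ^ 2)) := by
          refine Finset.sum_le_sum fun i _ => ?_
          have e1 : a i - average a = (x i - average x) - eta • (F i - average F) := by
            rw [h3]; simp only [a, hF]; module
          rw [e1]
          exact norm_sub_smul_sq_le hp hp1 eta _ _
      _ = (1 + p / 2) * (n * Ξ) + 3 / p * (eta ^ 2 * ∑ i, ‖F i - average F‖ ^ 2) := by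
          rw [Finset.sum_add_distrib, ← Finset.mul_sum, ← Finset.mul_sum, ← Finset.mul_sum,
            sum_norm_sub_average_sq_eq hn]
      _ ≤ _ := by gcongr
  -- After exchanging sums, each user's sampling deviation meets a full column of W - 11ᵀ/n, which
  -- contributes at most a factor 1 - p.
  have hsto : ∑ k, ∑ i, 1 / (m : ℝ) * ∑ j, ‖Y k i j‖ ^ 2
      ≤ eta ^ 2 * (1 - p) * ∑ i, 1 / (m : ℝ) * ∑ j, ‖gradDev l D x i j‖ ^ 2 := by
    rw [Finset.sum_comm, Finset.mul_sum]
    refine Finset.sum_le_sum fun i _ => ?_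
    rw [← Finset.mul_sum, Finset.sum_comm, mul_left_comm]
    refine mul_le_mul_of_nonneg_left ?_ (by positivity)
    rw [Finset.mul_sum]
    refine Finset.sum_le_sum fun j _ => ?_
    have h2 := sum_coeff_sq_mul_le hW hn i (gradDev l D x i j)
    calc ∑ k, ‖Y k i j‖ ^ 2 = eta ^ 2 * ∑ k, (W k i - 1 / (n : ℝ)) ^ 2 * ‖gradDev l D x i j‖ ^ 2 := by
          rw [Finset.mul_sum]
          refine Finset.sum_congr rfl fun k _ => ?_
          simp only [Y, w, norm_smul, mul_pow, Real.norm_eq_abs, sq_abs, neg_sq]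
          ring
      _ ≤ eta ^ 2 * ((1 - p) * ‖gradDev l D x i j‖ ^ 2) := by gcongr
      _ = _ := by ring
  have hedge : ∑ k, ∑ e, B k e ^ 2
      = eta ^ 2 * (2 * (mixingHeterogeneity G W * G.edgeFinset.card)) := by
    rw [← sum_sum_edgeValue_sq hW.symm, Finset.mul_sum]
    refine Finset.sum_congr rfl fun k _ => ?_
    rw [Finset.mul_sum]
    refine Finset.sum_congr rfl fun e _ => ?_
    simp only [B, w]; ring
  have hpriv : ∑ k, ∑ i, A k i ^ 2 = eta ^ 2 * distToAverageSq W := by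
    rw [distToAverageSq, Finset.mul_sum]
    refine Finset.sum_congr rfl fun k _ => ?_
    rw [Finset.mul_sum]
    refine Finset.sum_congr rfl fun e _ => ?_
    simp only [A, w]; ring
  rw [hedge, hpriv]
  have hloc := sum_norm_gradient_localLoss_sq_le h hn x
  have hdev := sum_gradDev_sq_le h hn hM x
  rw [← hg, ← hΞ] at hloc hdev
  set HE := mixingHeterogeneity G W * (G.edgeFinset.card : ℝ)
  set om := distToAverageSq W
  set S₁ := ∑ i, ‖∇ (localLoss l D i) (x i)‖ ^ 2
  set S₂ := ∑ i, 1 / (m : ℝ) * ∑ j, ‖gradDev l D x i j‖ ^ 2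
  set P' := max 1 P with hP'
  have hP1 : 1 ≤ P' := le_max_left _ _
  have hq : 0 ≤ 1 - p := by linarith
  have b1 : ∑ k, ‖c k‖ ^ 2 ≤ n * ((1 - p) * ((1 + p / 2) * Ξ
      + 3 / p * (eta ^ 2 * (2 * (zeta ^ 2 + P' * ‖g‖ ^ 2) + 2 * (L ^ 2 * Ξ))))) := by
    refine hdet.trans ?_
    calc (1 - p) * ((1 + p / 2) * (n * Ξ) + 3 / p * (eta ^ 2 * S₁))
        ≤ (1 - p) * ((1 + p / 2) * (n * Ξ) + 3 / p * (eta ^ 2 *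
          (n * (2 * (zeta ^ 2 + P' * ‖g‖ ^ 2) + 2 * (L ^ 2 * Ξ))))) := by gcongr
      _ = _ := by ring
  have b2 : ∑ k, ∑ i, 1 / (m : ℝ) * ∑ j, ‖Y k i j‖ ^ 2
      ≤ n * (eta ^ 2 * (1 - p) * (sigma ^ 2 + 2 * M * (‖g‖ ^ 2 + L ^ 2 * Ξ))) := by
    refine hsto.trans ?_
    calc eta ^ 2 * (1 - p) * S₂
        ≤ eta ^ 2 * (1 - p) * (n * (sigma ^ 2 + 2 * M * (‖g‖ ^ 2 + L ^ 2 * Ξ))) := by gcongr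
      _ = _ := by ring
  simp only [Finset.mul_sum] at b2 ⊢
  rw [one_div_mul_eq_div, div_le_iff₀ hn']
  have b3 : d / (n : ℝ) * (2 * vcor * HE + vcdp * om) * n = d * (2 * vcor * HE + vcdp * om) := by
    field_simp
  have b5 := mul_le_mul_of_nonneg_left
    (consensus_algebra (sigma := sigma) (zeta := zeta) (g := ‖g‖) hp hp1 hP1 hM hΞ0 heta) hn'.le
  have b6 := congrArg (fun r => eta ^ 2 * r) b3
  linarith

end OneStep

/-! ### The iterates as a Markov chain -/

/-- In a product of probability spaces, a function of the past is independent of the present. -/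
theorem indepFun_of_past {T : ℕ} {A E : Type*} [MeasurableSpace A] [Nonempty A] [MeasurableSpace E]
    {μ : Fin T → Measure A} [∀ t, IsProbabilityMeasure (μ t)] {Y : (Fin T → A) → E}
    (hY : Measurable Y) (t : Fin T)
    (hdep : ∀ w w', (∀ s, s < t → w s = w' s) → Y w = Y w') :
    IndepFun Y (fun w => w t) (Measure.pi μ) := by
  classical
  obtain ⟨z₀⟩ := ‹Nonempty A›
  have h1 : iIndepFun (fun (s : Fin T) (w : Fin T → A) => w s) (Measure.pi μ) :=
    iIndepFun_pi (X := fun _ a => a) fun _ => measurable_id.aemeasurable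
  let S : Finset (Fin T) := Finset.univ.filter (· < t)
  have h2 := h1.indepFun_finset S {t} (by simp [S]) fun s => measurable_pi_apply s
  -- `Y` factors through the coordinates before t: the others may be filled with `z₀`, since `Y`
  -- ignores them.
  let ext : (S → A) → Fin T → A := fun v s => if h : s ∈ S then v ⟨s, h⟩ else z₀
  have hext : Measurable ext := by
    refine measurable_pi_lambda _ fun s => ?_
    by_cases h : s ∈ S
    · simp only [ext, dif_pos h]; fun_prop
    · simp only [ext, dif_neg h]; fun_prop
  have hlast : Measurable fun v : (({t} : Finset (Fin T)) → A) =>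
      v ⟨t, Finset.mem_singleton_self t⟩ := measurable_pi_apply _
  have h3 := h2.comp (hY.comp hext) hlast
  convert h3 using 1
  swap
  · rfl
  ext w
  refine hdep _ _ fun s hs => ?_
  have : s ∈ S := by simp [S, hs]
  simp [ext, this]

section Chain

variable {n d m T : ℕ} {X : Type*} {G : SimpleGraph (Fin n)} [DecidableRel G.Adj]
  {l : Param d → X → ℝ} {D : Fin n → Fin m → X} {W : Matrix (Fin n) (Fin n) ℝ}
  {L P M sigma zeta p : ℝ}

theorem measurable_stepMap (eta : ℝ) :
    Measurable fun y : (Fin n → Param d) × StepNoise G m d => stepMap G l W D eta y.1 y.2 :=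
  (measurable_gossip W).comp
    ((measurable_halfStep G measurable_id l D eta).comp measurable_swap)

/-- Only the values of κ at stochastic gradients matter, so clipping with bounded gradients and no
clipping are treated at once. -/
theorem iterate_succ_eq_stepMap {κ : Param d → Param d}
    (hκ : ∀ i j x, κ (∇ (fun y => l y (D i j)) x) = ∇ (fun y => l y (D i j)) x)
    (eta : ℕ → ℝ) (x0 : Fin n → Param d) (w : Fin T → StepNoise G m d) (t : Fin T) :
    iterate G κ l W eta x0 D (regroup G m T d w).1 (regroup G m T d w).2 (t + 1)
      = stepMap G l W D (eta t)
        (iterate G κ l W eta x0 D (regroup G m T d w).1 (regroup G m T d w).2 t) (w t) := by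
  rw [iterate, dif_pos t.2]
  rw [stepMap]
  congr 1
  funext i
  simp only [halfStep, hκ, id]
  rfl

/-- Law of the local models after `t` iterations. -/
def iterateLaw (G : SimpleGraph (Fin n)) [DecidableRel G.Adj] (κ : Param d → Param d)
    (l : Param d → X → ℝ) (W : Matrix (Fin n) (Fin n) ℝ) (eta : ℕ → ℝ) (x0 : Fin n → Param d)
    (D : Fin n → Fin m → X) (T : ℕ) (vcor vcdp : ℝ) (t : ℕ) : Measure (Fin n → Param d) :=
  (fullLaw G m T d vcor vcdp).map fun w => iterate G κ l W eta x0 D w.1 w.2 t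

variable [NeZero m] {vcor vcdp : ℝ}

instance isProbabilityMeasure_fullLaw : IsProbabilityMeasure (fullLaw G m T d vcor vcdp) := by
  rw [← (measurePreserving_regroup G m T d vcor vcdp).map_eq]
  exact Measure.isProbabilityMeasure_map
    (measurePreserving_regroup G m T d vcor vcdp).measurable.aemeasurable

theorem iterateLaw_zero (κ : Param d → Param d) (eta : ℕ → ℝ) (x0 : Fin n → Param d) :
    iterateLaw G κ l W eta x0 D T vcor vcdp 0 = Measure.dirac x0 := by
  simp [iterateLaw, iterate]

/-- The state at time t is a function of past noise, hence independent of the fresh noise; this is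
the Markov property, obtained after regrouping the randomness by time. -/
theorem iterateLaw_succ {κ : Param d → Param d} (hκm : Measurable κ)
    (hκ : ∀ i j x, κ (∇ (fun y => l y (D i j)) x) = ∇ (fun y => l y (D i j)) x)
    (eta : ℕ → ℝ) (x0 : Fin n → Param d) {t : ℕ} (ht : t < T) :
    iterateLaw G κ l W eta x0 D T vcor vcdp (t + 1)
      = ((iterateLaw G κ l W eta x0 D T vcor vcdp t).prod (stepLaw G m d vcor vcdp)).map
        fun y => stepMap G l W D (eta t) y.1 y.2 := by
  have hreg := measurePreserving_regroup G m T d vcor vcdp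
  have hm := fun t => measurable_iterate (T := T) G hκm l W eta x0 D t
  let Y : ℕ → (Fin T → StepNoise G m d) → Fin n → Param d := fun t w =>
    iterate G κ l W eta x0 D (regroup G m T d w).1 (regroup G m T d w).2 t
  have hY : ∀ t, Measurable (Y t) := fun t => (hm t).comp hreg.measurable
  have hlaw : ∀ t, iterateLaw G κ l W eta x0 D T vcor vcdp t
      = (Measure.pi fun _ : Fin T => stepLaw G m d vcor vcdp).map (Y t) := fun t => by
    rw [iterateLaw, ← hreg.map_eq, Measure.map_map (hm t) hreg.measurable]
    rfl
  have hind := indepFun_of_past (μ := fun _ : Fin T => stepLaw G m d vcor vcdp) (hY t) ⟨t, ht⟩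
    fun w w' h => iterate_congr G fun s hs => by
      simp [regroup, h s hs]
  rw [indepFun_iff_map_prod_eq_prod_map_map (hY t).aemeasurable
    (measurable_pi_apply _).aemeasurable, (measurePreserving_eval _ _).map_eq] at hind
  rw [hlaw, hlaw, ← hind, Measure.map_map (measurable_stepMap (eta t))
    ((hY t).prodMk (measurable_pi_apply _))]
  congr 1
  funext w
  exact iterate_succ_eq_stepMap hκ eta x0 w ⟨t, ht⟩

/-- Square integrability survives an iteration because stochastic gradients grow at most linearly.
-/
theorem memLp_stepMap (h : LossAssumptions l D L P M sigma zeta) (hn : 0 < n) (hL : 0 < L)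
    (hM : 0 ≤ M) (eta : ℝ) {ρ : Measure (Fin n → Param d)} [IsProbabilityMeasure ρ]
    (hρ : ∀ i, MemLp (fun x : Fin n → Param d => x i) 2 ρ) (i : Fin n) :
    MemLp (fun y : (Fin n → Param d) × StepNoise G m d => stepMap G l W D eta y.1 y.2 i) 2
      (ρ.prod (stepLaw G m d vcor vcdp)) := by
  set ν := ρ.prod (stepLaw G m d vcor vcdp) with hν
  obtain ⟨a, b, ha, hb, hab⟩ := exists_norm_gradient_le h hn (NeZero.pos m) hL hM
  have hx : ∀ j, MemLp (fun y : (Fin n → Param d) × StepNoise G m d => y.1 j) 2 ν := fun j =>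
    (hρ j).comp_fst _
  have hu : ∀ e : G.edgeSet,
      MemLp (fun y : (Fin n → Param d) × StepNoise G m d => y.2.2.1 e) 2 ν := fun e =>
    ((((memLp_gaussian d vcor).comp_measurePreserving
      (measurePreserving_eval (fun _ : G.edgeSet => gaussian d vcor) e)).comp_fst
        (Measure.pi fun _ : Fin n => gaussian d vcdp)).comp_snd
          (uniformOn (Set.univ : Set (Fin n → Fin m)))).comp_snd ρ
  have hv : ∀ j : Fin n,
      MemLp (fun y : (Fin n → Param d) × StepNoise G m d => y.2.2.2 j) 2 ν := fun j =>
    ((((memLp_gaussian d vcdp).comp_measurePreserving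
      (measurePreserving_eval (fun _ : Fin n => gaussian d vcdp) j)).comp_snd
        (Measure.pi fun _ : G.edgeSet => gaussian d vcor)).comp_snd
          (uniformOn (Set.univ : Set (Fin n → Fin m)))).comp_snd ρ
  have hp : ∀ j, MemLp (fun y : (Fin n → Param d) × StepNoise G m d =>
      pairNoise G y.2.2.1 j) 2 ν := by
    intro j
    unfold pairNoise
    refine memLp_finsetSum _ fun k _ => ?_
    split_ifs
    · exact hu _
    · exact (hu _).neg
  have hg : ∀ j, MemLp (fun y : (Fin n → Param d) × StepNoise G m d =>
      ∇ (fun z => l z (D j (y.2.1 j))) (y.1 j)) 2 ν := by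
    intro j
    have h1 : MemLp (fun y : (Fin n → Param d) × StepNoise G m d => a + b * ‖y.1 j‖) 2 ν :=
      (memLp_const a).add ((hx j).norm.const_mul b)
    refine h1.mono ((measurable_stochasticGradient measurable_id l D j).comp
      (g := fun z : (Fin n → Fin m) × Param d => id (∇ (fun y => l y (D j (z.1 j))) z.2))
      (f := fun y : (Fin n → Param d) × StepNoise G m d => (y.2.1, y.1 j))
      (by fun_prop)).aestronglyMeasurable (Filter.Eventually.of_forall fun y => ?_)
    exact (hab j (y.2.1 j) (y.1 j)).trans (Real.le_norm_self _)
  unfold stepMap gossip halfStep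
  refine memLp_finsetSum _ fun j _ => ?_
  have hh := ((hx j).sub ((((hg j).add (hp j)).add (hv j)).const_smul eta)).const_smul (W i j)
  exact hh

theorem memLp_iterateLaw (h : LossAssumptions l D L P M sigma zeta) (hn : 0 < n) (hL : 0 < L)
    (hM : 0 ≤ M) {κ : Param d → Param d} (hκm : Measurable κ)
    (hκ : ∀ i j x, κ (∇ (fun y => l y (D i j)) x) = ∇ (fun y => l y (D i j)) x)
    (eta : ℕ → ℝ) (x0 : Fin n → Param d) {t : ℕ} (ht : t ≤ T) (i : Fin n) :
    MemLp (fun x : Fin n → Param d => x i) 2 (iterateLaw G κ l W eta x0 D T vcor vcdp t) := by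
  induction t generalizing i with
  | zero =>
    rw [iterateLaw_zero]
    exact (memLp_const (x0 i)).ae_eq ((ae_dirac_iff (measurableSet_eq_fun (by fun_prop)
      (by fun_prop))).2 rfl)
  | succ t ih =>
    have : IsProbabilityMeasure (iterateLaw G κ l W eta x0 D T vcor vcdp t) :=
      Measure.isProbabilityMeasure_map (measurable_iterate G hκm l W eta x0 D t).aemeasurable
    rw [iterateLaw_succ hκm hκ eta x0 (by omega),
      memLp_map_measure_iff (measurable_pi_apply i).aestronglyMeasurable
        (measurable_stepMap (eta t)).aemeasurable]
    exact memLp_stepMap h hn hL hM (eta t) (fun j => ih (by omega) j) i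

end Chain

/-! ### Recursions in expectation -/

section Recursion

variable {n d m T : ℕ} {X : Type*} {G : SimpleGraph (Fin n)} [DecidableRel G.Adj]
  {l : Param d → X → ℝ} {D : Fin n → Fin m → X} {W : Matrix (Fin n) (Fin n) ℝ}
  {L P M sigma zeta p : ℝ}

theorem memLp_average {Ω : Type*} [MeasurableSpace Ω] {μ : Measure Ω} {y : Ω → Fin n → Param d}
    (hy : ∀ i, MemLp (fun w => y w i) 2 μ) : MemLp (fun w => average (y w)) 2 μ := by
  unfold average
  have hh := (memLp_finsetSum (μ := μ) (f := fun i w => y w i) Finset.univ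
    fun i _ => hy i).const_smul (1 / (n : ℝ))
  exact hh

theorem integrable_consensusDist {Ω : Type*} [MeasurableSpace Ω] {μ : Measure Ω}
    {y : Ω → Fin n → Param d} (hy : ∀ i, MemLp (fun w => y w i) 2 μ) :
    Integrable (fun w => consensusDist (y w)) μ := by
  unfold consensusDist
  exact (integrable_finsetSum _ fun i _ =>
    ((hy i).sub (memLp_average hy)).integrable_norm_pow two_ne_zero).const_mul _

theorem measurable_average : Measurable (average : (Fin n → Param d) → Param d) := by
  unfold average; fun_prop

theorem measurable_consensusDist : Measurable (consensusDist : (Fin n → Param d) → ℝ) := by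
  unfold consensusDist
  have := measurable_average (n := n) (d := d)
  fun_prop

variable {vcor vcdp : ℝ} {κ : Param d → Param d}

/-- Expected global loss at the average model after `t` iterations. -/
def meanLoss (G : SimpleGraph (Fin n)) [DecidableRel G.Adj] (κ : Param d → Param d)
    (l : Param d → X → ℝ) (W : Matrix (Fin n) (Fin n) ℝ) (eta : ℕ → ℝ) (x0 : Fin n → Param d)
    (D : Fin n → Fin m → X) (T : ℕ) (vcor vcdp : ℝ) (t : ℕ) : ℝ :=
  ∫ x, globalLoss l D (average x) ∂iterateLaw G κ l W eta x0 D T vcor vcdp t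

/-- Expected squared gradient norm at the average model after `t` iterations. -/
def meanGradSq (G : SimpleGraph (Fin n)) [DecidableRel G.Adj] (κ : Param d → Param d)
    (l : Param d → X → ℝ) (W : Matrix (Fin n) (Fin n) ℝ) (eta : ℕ → ℝ) (x0 : Fin n → Param d)
    (D : Fin n → Fin m → X) (T : ℕ) (vcor vcdp : ℝ) (t : ℕ) : ℝ :=
  ∫ x, ‖∇ (globalLoss l D) (average x)‖ ^ 2 ∂iterateLaw G κ l W eta x0 D T vcor vcdp t

/-- Expected consensus distance after `t` iterations. -/
def meanConsensus (G : SimpleGraph (Fin n)) [DecidableRel G.Adj] (κ : Param d → Param d)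
    (l : Param d → X → ℝ) (W : Matrix (Fin n) (Fin n) ℝ) (eta : ℕ → ℝ) (x0 : Fin n → Param d)
    (D : Fin n → Fin m → X) (T : ℕ) (vcor vcdp : ℝ) (t : ℕ) : ℝ :=
  ∫ x, consensusDist x ∂iterateLaw G κ l W eta x0 D T vcor vcdp t

theorem meanGradSq_nonneg (eta : ℕ → ℝ) (x0 : Fin n → Param d) (t : ℕ) :
    0 ≤ meanGradSq G κ l W eta x0 D T vcor vcdp t := integral_nonneg fun _ => sq_nonneg _

theorem meanConsensus_nonneg (eta : ℕ → ℝ) (x0 : Fin n → Param d) (t : ℕ) :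
    0 ≤ meanConsensus G κ l W eta x0 D T vcor vcdp t :=
  integral_nonneg fun _ => consensusDist_nonneg _

theorem integral_globalLoss_iterate (h : LossAssumptions l D L P M sigma zeta)
    (hκm : Measurable κ) (eta : ℕ → ℝ) (x0 : Fin n → Param d) (t : ℕ) :
    ∫ w, globalLoss l D (average (iterate G κ l W eta x0 D w.1 w.2 t)) ∂fullLaw G m T d vcor vcdp
      = meanLoss G κ l W eta x0 D T vcor vcdp t := by
  exact (integral_map (f := fun x => globalLoss l D (average x))
    (measurable_iterate G hκm l W eta x0 D t).aemeasurable
    ((measurable_globalLoss h).comp measurable_average).aestronglyMeasurable).symm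

theorem integral_gradSq_iterate (hκm : Measurable κ) (eta : ℕ → ℝ) (x0 : Fin n → Param d)
    (t : ℕ) :
    ∫ w, ‖∇ (globalLoss l D) (average (iterate G κ l W eta x0 D w.1 w.2 t))‖ ^ 2
        ∂fullLaw G m T d vcor vcdp
      = meanGradSq G κ l W eta x0 D T vcor vcdp t := by
  exact (integral_map (f := fun x => ‖∇ (globalLoss l D) (average x)‖ ^ 2)
    (measurable_iterate G hκm l W eta x0 D t).aemeasurable
    (((measurable_gradient _).comp measurable_average).norm.pow_const 2).aestronglyMeasurable).symm

variable [NeZero m]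

theorem isProbabilityMeasure_iterateLaw (hκm : Measurable κ) (eta : ℕ → ℝ)
    (x0 : Fin n → Param d) (t : ℕ) :
    IsProbabilityMeasure (iterateLaw G κ l W eta x0 D T vcor vcdp t) :=
  Measure.isProbabilityMeasure_map (measurable_iterate G hκm l W eta x0 D t).aemeasurable

/-- A one-step bound on a conditional expectation gives a bound on the expectations. -/
theorem integral_iterateLaw_succ_le (h : LossAssumptions l D L P M sigma zeta) (hn : 0 < n)
    (hL : 0 < L) (hM : 0 ≤ M) (hκm : Measurable κ)
    (hκ : ∀ i j x, κ (∇ (fun y => l y (D i j)) x) = ∇ (fun y => l y (D i j)) x)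
    (eta : ℕ → ℝ) (x0 : Fin n → Param d) {t : ℕ} (ht : t < T) {Φ Ψ : (Fin n → Param d) → ℝ}
    (hΦ : Measurable Φ)
    (hΦi : ∀ ν : Measure ((Fin n → Param d) × StepNoise G m d), IsProbabilityMeasure ν →
      ∀ y : (Fin n → Param d) × StepNoise G m d → Fin n → Param d,
      (∀ i, MemLp (fun w => y w i) 2 ν) → Integrable (fun w => Φ (y w)) ν)
    (hΨ : Integrable Ψ (iterateLaw G κ l W eta x0 D T vcor vcdp t))
    (hle : ∀ x, ∫ z, Φ (stepMap G l W D (eta t) x z) ∂stepLaw G m d vcor vcdp ≤ Ψ x) :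
    ∫ x, Φ x ∂iterateLaw G κ l W eta x0 D T vcor vcdp (t + 1)
      ≤ ∫ x, Ψ x ∂iterateLaw G κ l W eta x0 D T vcor vcdp t := by
  have := isProbabilityMeasure_iterateLaw (G := G) (l := l) (W := W) (D := D) (T := T)
    (vcor := vcor) (vcdp := vcdp) hκm eta x0 t
  have hi := hΦi _ inferInstance _ (memLp_stepMap (G := G) (W := W) (vcor := vcor) (vcdp := vcdp)
    h hn hL hM (eta t)
    (memLp_iterateLaw (G := G) (W := W) (T := T) (vcor := vcor) (vcdp := vcdp)
      h hn hL hM hκm hκ eta x0 ht.le))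
  rw [iterateLaw_succ hκm hκ eta x0 ht, integral_map (measurable_stepMap (eta t)).aemeasurable
    hΦ.aestronglyMeasurable, integral_prod _ hi]
  exact integral_mono hi.integral_prod_left hΨ hle

theorem meanLoss_zero (h : LossAssumptions l D L P M sigma zeta) (eta : ℕ → ℝ)
    (x0 : Fin n → Param d) :
    meanLoss G κ l W eta x0 D T vcor vcdp 0 = globalLoss l D (average x0) := by
  rw [meanLoss, iterateLaw_zero]
  exact integral_dirac' _ _ ((measurable_globalLoss h).comp measurable_average).stronglyMeasurable

theorem meanConsensus_zero (eta : ℕ → ℝ) (x0 : Fin n → Param d) :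
    meanConsensus G κ l W eta x0 D T vcor vcdp 0 = consensusDist x0 := by
  rw [meanConsensus, iterateLaw_zero]
  exact integral_dirac' _ _ measurable_consensusDist.stronglyMeasurable

section Integrability

variable (h : LossAssumptions l D L P M sigma zeta) (hn : 0 < n) (hL : 0 < L) (hM : 0 ≤ M)
  (hκm : Measurable κ)
  (hκ : ∀ i j x, κ (∇ (fun y => l y (D i j)) x) = ∇ (fun y => l y (D i j)) x)
  (eta : ℕ → ℝ) (x0 : Fin n → Param d) {t : ℕ} (ht : t ≤ T)

include h hn hL hM hκm hκ ht

theorem integrable_globalLoss_iterateLaw : Integrable (fun x => globalLoss l D (average x))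
    (iterateLaw G κ l W eta x0 D T vcor vcdp t) :=
  have := isProbabilityMeasure_iterateLaw (G := G) (l := l) (W := W) (D := D) (T := T)
    (vcor := vcor) (vcdp := vcdp) hκm eta x0 t
  integrable_globalLoss_comp h hn (memLp_average (memLp_iterateLaw h hn hL hM hκm hκ eta x0 ht))

theorem integrable_gradSq_iterateLaw :
    Integrable (fun x => ‖∇ (globalLoss l D) (average x)‖ ^ 2)
      (iterateLaw G κ l W eta x0 D T vcor vcdp t) :=
  have := isProbabilityMeasure_iterateLaw (G := G) (l := l) (W := W) (D := D) (T := T)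
    (vcor := vcor) (vcdp := vcdp) hκm eta x0 t
  integrable_norm_gradient_sq_comp h hn
    (memLp_average (memLp_iterateLaw h hn hL hM hκm hκ eta x0 ht))

theorem integrable_consensusDist_iterateLaw :
    Integrable consensusDist (iterateLaw G κ l W eta x0 D T vcor vcdp t) :=
  integrable_consensusDist (memLp_iterateLaw h hn hL hM hκm hκ eta x0 ht)

theorem lossInf_le_meanLoss : lossInf l D ≤ meanLoss G κ l W eta x0 D T vcor vcdp t := by
  have := isProbabilityMeasure_iterateLaw (G := G) (l := l) (W := W) (D := D) (T := T)
    (vcor := vcor) (vcdp := vcdp) hκm eta x0 t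
  have h1 := integral_mono (integrable_const (lossInf l D))
    (integrable_globalLoss_iterateLaw (G := G) (W := W) (vcor := vcor) (vcdp := vcdp)
      h hn hL hM hκm hκ eta x0 ht) fun x => lossInf_le h (average x)
  simpa [meanLoss] using h1

theorem meanGradSq_ge_of_isPL {mu : ℝ} (hPL : IsPL l D mu) :
    2 * mu * (meanLoss G κ l W eta x0 D T vcor vcdp t - lossInf l D)
      ≤ meanGradSq G κ l W eta x0 D T vcor vcdp t := by
  have := isProbabilityMeasure_iterateLaw (G := G) (l := l) (W := W) (D := D) (T := T)
    (vcor := vcor) (vcdp := vcdp) hκm eta x0 t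
  have hi := integrable_globalLoss_iterateLaw (G := G) (W := W) (vcor := vcor) (vcdp := vcdp)
      h hn hL hM hκm hκ eta x0 ht
  have h1 := integral_mono ((hi.sub (integrable_const (lossInf l D))).const_mul (2 * mu))
    (integrable_gradSq_iterateLaw (G := G) (W := W) (vcor := vcor) (vcdp := vcdp)
      h hn hL hM hκm hκ eta x0 ht) fun x => hPL (average x)
  rw [integral_const_mul] at h1
  simp only [Pi.sub_apply] at h1
  rw [integral_sub hi (integrable_const _)] at h1
  simpa [meanLoss, meanGradSq] using h1

theorem integrable_globalLoss_iterate :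
    Integrable (fun w => globalLoss l D (average (iterate G κ l W eta x0 D w.1 w.2 t)))
      (fullLaw G m T d vcor vcdp) :=
  (integrable_map_measure ((measurable_globalLoss h).comp measurable_average).aestronglyMeasurable
    (measurable_iterate G hκm l W eta x0 D t).aemeasurable).1
    (integrable_globalLoss_iterateLaw h hn hL hM hκm hκ eta x0 ht)

theorem integrable_gradSq_iterate :
    Integrable (fun w => ‖∇ (globalLoss l D) (average (iterate G κ l W eta x0 D w.1 w.2 t))‖ ^ 2)
      (fullLaw G m T d vcor vcdp) :=
  (integrable_map_measure (((measurable_gradient _).comp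
    measurable_average).norm.pow_const 2).aestronglyMeasurable
    (measurable_iterate G hκm l W eta x0 D t).aemeasurable).1
    (integrable_gradSq_iterateLaw h hn hL hM hκm hκ eta x0 ht)

end Integrability

theorem meanLoss_succ_le (h : LossAssumptions l D L P M sigma zeta) (hn : 0 < n)
    (hL : 0 < L) (hM : 0 ≤ M) (hW : IsMixingMatrix d G W p) (hcor : 0 ≤ vcor) (hcdp : 0 ≤ vcdp)
    (hκm : Measurable κ)
    (hκ : ∀ i j x, κ (∇ (fun y => l y (D i j)) x) = ∇ (fun y => l y (D i j)) x)
    (eta : ℕ → ℝ) (x0 : Fin n → Param d) {t : ℕ} (ht : t < T) (heta : 0 ≤ eta t)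
    (hetaL : eta t * L ≤ 1) (hetaM : eta t * (L * M / n) ≤ 1 / 4) :
    meanLoss G κ l W eta x0 D T vcor vcdp (t + 1)
      ≤ meanLoss G κ l W eta x0 D T vcor vcdp t
        - eta t / 4 * meanGradSq G κ l W eta x0 D T vcor vcdp t
        + 3 / 4 * eta t * L ^ 2 * meanConsensus G κ l W eta x0 D T vcor vcdp t
        + L * eta t ^ 2 / (2 * n) * (sigma ^ 2 + d * vcdp) := by
  have := isProbabilityMeasure_iterateLaw (G := G) (l := l) (W := W) (D := D) (T := T)
    (vcor := vcor) (vcdp := vcdp) hκm eta x0 t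
  have i1 := integrable_globalLoss_iterateLaw (G := G) (W := W) (vcor := vcor) (vcdp := vcdp)
    h hn hL hM hκm hκ eta x0 ht.le
  have i2 := (integrable_gradSq_iterateLaw (G := G) (W := W) (vcor := vcor) (vcdp := vcdp)
    h hn hL hM hκm hκ eta x0 ht.le).const_mul (eta t / 4)
  have i3 := (integrable_consensusDist_iterateLaw (G := G) (W := W) (vcor := vcor) (vcdp := vcdp)
    h hn hL hM hκm hκ eta x0 ht.le).const_mul (3 / 4 * eta t * L ^ 2)
  have key := integral_iterateLaw_succ_le (G := G) (W := W) (vcor := vcor) (vcdp := vcdp)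
    h hn hL hM hκm hκ eta x0 ht ((measurable_globalLoss h).comp measurable_average)
    (fun ν _ y hy => integrable_globalLoss_comp h hn (memLp_average hy))
    (((i1.sub i2).add i3).add
      (integrable_const (L * eta t ^ 2 / (2 * n) * (sigma ^ 2 + d * vcdp))))
    (fun x => integral_globalLoss_stepMap_le h hn hL hM hW hcor hcdp heta hetaL hetaM x)
  refine key.trans_eq ?_
  rw [integral_add' ((i1.sub i2).add i3) (integrable_const _), integral_add' (i1.sub i2) i3,
    integral_sub' i1 i2, integral_const_mul, integral_const_mul]
  simp [meanLoss, meanGradSq, meanConsensus]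

theorem meanConsensus_succ_le (h : LossAssumptions l D L P M sigma zeta) (hn : 0 < n)
    (hL : 0 < L) (hM : 0 ≤ M) (hW : IsMixingMatrix d G W p) (hcor : 0 ≤ vcor) (hcdp : 0 ≤ vcdp)
    (hκm : Measurable κ)
    (hκ : ∀ i j x, κ (∇ (fun y => l y (D i j)) x) = ∇ (fun y => l y (D i j)) x)
    (eta : ℕ → ℝ) (x0 : Fin n → Param d) {t : ℕ} (ht : t < T)
    (heta : 48 * (1 - p) * (3 * max 1 P + p * M) * (eta t * L) ^ 2 ≤ p ^ 2) :
    meanConsensus G κ l W eta x0 D T vcor vcdp (t + 1)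
      ≤ (1 - 11 / 24 * p) * meanConsensus G κ l W eta x0 D T vcor vcdp t
        + 2 * (1 - p) / p * (3 * max 1 P + p * M) * eta t ^ 2
          * meanGradSq G κ l W eta x0 D T vcor vcdp t
        + eta t ^ 2 * ((1 - p) * (6 * zeta ^ 2 / p + sigma ^ 2)
          + d / n * (2 * vcor * (mixingHeterogeneity G W * G.edgeFinset.card)
            + vcdp * distToAverageSq W)) := by
  have := isProbabilityMeasure_iterateLaw (G := G) (l := l) (W := W) (D := D) (T := T)
    (vcor := vcor) (vcdp := vcdp) hκm eta x0 t
  have i2 := (integrable_gradSq_iterateLaw (G := G) (W := W) (vcor := vcor) (vcdp := vcdp)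
    h hn hL hM hκm hκ eta x0 ht.le).const_mul
      (2 * (1 - p) / p * (3 * max 1 P + p * M) * eta t ^ 2)
  have i3 := (integrable_consensusDist_iterateLaw (G := G) (W := W) (vcor := vcor) (vcdp := vcdp)
    h hn hL hM hκm hκ eta x0 ht.le).const_mul (1 - 11 / 24 * p)
  have key := integral_iterateLaw_succ_le (G := G) (W := W) (vcor := vcor) (vcdp := vcdp)
    h hn hL hM hκm hκ eta x0 ht measurable_consensusDist
    (fun ν _ y hy => integrable_consensusDist hy)
    ((i3.add i2).add (integrable_const _))
    (fun x => integral_consensusDist_stepMap_le h hn hM hW hcor hcdp heta x)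
  refine key.trans_eq ?_
  rw [integral_add' (i3.add i2) (integrable_const _), integral_add' i3 i2,
    integral_const_mul, integral_const_mul]
  simp [meanGradSq, meanConsensus]

end Recursion

/-! ### Lyapunov arguments -/

/-- With bp = 4ηL² the consensus error in the loss is (3/16)pbΞ, which the contraction absorbs:
11/24 - 3/16 = 13/48. The gradient term fed back through Ξ costs at most 4θ out of the available
1/4. -/
theorem lyapunov_step {e e' Ξ Ξ' g η b p L A ν r θ : ℝ} (hp : 0 < p) (hη : 0 ≤ η) (hg : 0 ≤ g)
    (hb : b = 4 * η * L ^ 2 / p) (hA : L ^ 2 * A * η ^ 2 ≤ θ * p)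
    (he' : e' ≤ e - η / 4 * g + 3 / 4 * η * L ^ 2 * Ξ + r)
    (hΞ' : Ξ' ≤ (1 - 11 / 24 * p) * Ξ + A * η ^ 2 * g + η ^ 2 * ν) :
    e' + b * Ξ' ≤ e + (1 - 13 / 48 * p) * (b * Ξ) - (1 / 4 - 4 * θ) * η * g + r
      + b * η ^ 2 * ν := by
  have hb0 : 0 ≤ b := by rw [hb]; positivity
  have hbp : b * p = 4 * η * L ^ 2 := by rw [hb]; field_simp
  have h1 := mul_le_mul_of_nonneg_left hΞ' hb0
  have h2 : b * A * η ^ 2 ≤ 4 * θ * η := by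
    have : b * A * η ^ 2 = 4 * η / p * (L ^ 2 * A * η ^ 2) := by rw [hb]; ring
    rw [this]
    calc 4 * η / p * (L ^ 2 * A * η ^ 2) ≤ 4 * η / p * (θ * p) := by gcongr
      _ = 4 * θ * η := by field_simp
  have h3 := mul_le_mul_of_nonneg_right h2 hg
  have h4 : 3 / 4 * η * L ^ 2 * Ξ = 3 / 16 * (b * p) * Ξ := by rw [hbp]; ring
  rw [h4] at he'
  linarith

/-- Taking θ = 1/24 leaves ηg/12, which is at least ημe/6 by the PL inequality; the consensus part
contracts by 13p/48, more than ημ/6 since ημ ≤ p. The weight b' belongs to the next, smaller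
stepsize. -/
theorem lyapunov_step_pl {e e' Ξ Ξ' g η b b' p L A ν r mu : ℝ} (hp : 0 < p) (hη : 0 ≤ η)
    (hΞ : 0 ≤ Ξ) (hg : 0 ≤ g) (hΞ'0 : 0 ≤ Ξ') (hb : b = 4 * η * L ^ 2 / p) (hb' : b' ≤ b)
    (hA : L ^ 2 * A * η ^ 2 ≤ p / 24) (hpl : 2 * mu * e ≤ g) (hmu : η * mu ≤ p)
    (he' : e' ≤ e - η / 4 * g + 3 / 4 * η * L ^ 2 * Ξ + r)
    (hΞ' : Ξ' ≤ (1 - 11 / 24 * p) * Ξ + A * η ^ 2 * g + η ^ 2 * ν) :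
    e' + b' * Ξ' ≤ (1 - η * mu / 6) * (e + b * Ξ) + r + b * η ^ 2 * ν := by
  have hb0 : 0 ≤ b := by rw [hb]; positivity
  have h1 := lyapunov_step (θ := 1 / 24) hp hη hg hb (by linarith) he' hΞ'
  have h2 := mul_le_mul_of_nonneg_right hb' hΞ'0
  have h3 := mul_le_mul_of_nonneg_left hpl hη
  have h4 : η * mu * (b * Ξ) ≤ p * (b * Ξ) := by gcongr
  have h5 : 0 ≤ p * (b * Ξ) := by positivity
  linarith

/-- Termwise comparison: 1/(t + k) ≤ 1/(t + 2) ≤ log((t + 2)/(t + 1)), and the logarithms telescope.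
-/
theorem sum_inv_le_log {k : ℝ} (hk : 2 ≤ k) (T : ℕ) :
    ∑ t ∈ Finset.range T, 1 / ((t : ℝ) + k) ≤ Real.log (T + 1) := by
  induction T with
  | zero => simp
  | succ T ih =>
    rw [Finset.sum_range_succ]
    have hT : (0 : ℝ) < T + 1 := by positivity
    have h1 : 1 / ((T : ℝ) + k) ≤ 1 / (T + 2) := by gcongr
    have h2 := Real.one_sub_inv_le_log_of_pos (by positivity : 0 < ((T : ℝ) + 2) / (T + 1))
    rw [Real.log_div (by positivity) hT.ne', inv_div] at h2
    have h3 : 1 - ((T : ℝ) + 1) / (T + 2) = 1 / (T + 2) := by field_simp; ring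
    push_cast
    rw [show (T : ℝ) + 1 + 1 = T + 2 by ring]
    linarith

/-- The weight u² grows by a relative amount of about 2/u, less than the contraction 8/(3u). -/
theorem weight_mul_le {u : ℝ} (hu : 1 ≤ u) : (u + 1) ^ 2 * (1 - 8 / (3 * u)) ≤ u ^ 2 := by
  have h : u ^ 2 - (u + 1) ^ 2 * (1 - 8 / (3 * u)) = (2 * u ^ 2 + 13 * u + 8) / (3 * u) := by
    field_simp; ring
  have : 0 ≤ (2 * u ^ 2 + 13 * u + 8) / (3 * u) := by positivity
  linarith

/-- Convergence of `V` under a contraction by `1 - η μ / 6` with decreasing stepsizes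
`η = 16 / (μ (t + k))`. -/
theorem le_of_decreasing_steps {V : ℕ → ℝ} {T : ℕ} {mu k α β : ℝ} (hT : 0 < T) (hmu : 0 < mu)
    (hk : 3 ≤ k) (hα : 0 ≤ α) (hβ : 0 ≤ β) (hV : ∀ t ≤ T, 0 ≤ V t)
    (hstep : ∀ t < T, V (t + 1) ≤ (1 - 16 / (mu * (t + k)) * mu / 6) * V t
      + α * (16 / (mu * (t + k))) ^ 2 + β * (16 / (mu * (t + k))) ^ 3) :
    V T ≤ k ^ 2 * V 0 / T ^ 2 + 512 * α / (mu ^ 2 * T)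
      + 8192 * β * Real.log (T + 1) / (mu ^ 3 * T ^ 2) := by
  have main : ∀ t ≤ T, ((t : ℝ) + k) ^ 2 * V t ≤ k ^ 2 * V 0 + 512 * α / mu ^ 2 * t
      + 8192 * β / mu ^ 3 * ∑ s ∈ Finset.range t, 1 / ((s : ℝ) + k) := by
    intro t
    induction t with
    | zero => simp
    | succ t ih =>
      intro ht
      have ih := ih (by omega)
      have hst := hstep t (by omega)
      have hV0 := hV t (by omega)
      have hu : 3 ≤ (t : ℝ) + k := by linarith [(Nat.cast_nonneg t : (0 : ℝ) ≤ t)]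
      rw [Finset.sum_range_succ]
      push_cast
      generalize ∑ s ∈ Finset.range t, 1 / ((s : ℝ) + k) = S at ih ⊢
      rw [show (t : ℝ) + 1 + k = t + k + 1 by ring]
      generalize (t : ℝ) + k = u at *
      have hu0 : 0 < u := by linarith
      have e1 : 1 - 16 / (mu * u) * mu / 6 = 1 - 8 / (3 * u) := by field_simp; ring
      rw [e1] at hst
      have h1 := mul_le_mul_of_nonneg_left hst (sq_nonneg (u + 1))
      have h2 := mul_le_mul_of_nonneg_right (weight_mul_le (by linarith : 1 ≤ u)) hV0
      have h3 : (u + 1) ^ 2 ≤ 2 * u ^ 2 := by nlinarith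
      have h4 : (u + 1) ^ 2 * (α * (16 / (mu * u)) ^ 2 + β * (16 / (mu * u)) ^ 3)
          ≤ 2 * u ^ 2 * (α * (16 / (mu * u)) ^ 2 + β * (16 / (mu * u)) ^ 3) := by gcongr
      have h5 : 2 * u ^ 2 * (α * (16 / (mu * u)) ^ 2 + β * (16 / (mu * u)) ^ 3)
          = 512 * α / mu ^ 2 + 8192 * β / mu ^ 3 * (1 / u) := by field_simp; ring
      linarith
  have h1 := main T le_rfl
  have h2 := sum_inv_le_log (by linarith : 2 ≤ k) T
  have hT' : (0 : ℝ) < T := by exact_mod_cast hT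
  have h3 : 8192 * β / mu ^ 3 * ∑ s ∈ Finset.range T, 1 / ((s : ℝ) + k)
      ≤ 8192 * β / mu ^ 3 * Real.log (T + 1) := by gcongr
  have h4 : (T : ℝ) ^ 2 * V T ≤ ((T : ℝ) + k) ^ 2 * V T := by
    have := hV T le_rfl
    gcongr
    linarith
  have h5 : V T ≤ (k ^ 2 * V 0 + 512 * α / mu ^ 2 * T
      + 8192 * β / mu ^ 3 * Real.log (T + 1)) / T ^ 2 := by
    rw [le_div_iff₀ (by positivity)]
    linarith
  refine h5.trans_eq ?_
  field_simp

/-- Telescoping for constant stepsizes. -/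
theorem sum_grad_le_of_constant_step {e Ξ g : ℕ → ℝ} {T : ℕ} {η p L A ν r : ℝ} (hp : 0 < p)
    (hη : 0 ≤ η) (hΞ : ∀ t, 0 ≤ Ξ t) (hg : ∀ t, 0 ≤ g t) (he : 0 ≤ e T)
    (hA : L ^ 2 * A * η ^ 2 ≤ p / 96)
    (he' : ∀ t < T, e (t + 1) ≤ e t - η / 4 * g t + 3 / 4 * η * L ^ 2 * Ξ t + r)
    (hΞ' : ∀ t < T, Ξ (t + 1) ≤ (1 - 11 / 24 * p) * Ξ t + A * η ^ 2 * g t + η ^ 2 * ν) :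
    η / 8 * ∑ t ∈ Finset.range T, g t
      ≤ e 0 + 4 * η * L ^ 2 / p * Ξ 0 + T * (r + 4 * η * L ^ 2 / p * η ^ 2 * ν) := by
  set b := 4 * η * L ^ 2 / p with hb
  have hb0 : 0 ≤ b := by rw [hb]; positivity
  have main : ∀ t ≤ T, e t + b * Ξ t + η / 8 * ∑ s ∈ Finset.range t, g s
      ≤ e 0 + b * Ξ 0 + t * (r + b * η ^ 2 * ν) := by
    intro t
    induction t with
    | zero => simp
    | succ t ih =>
      intro ht
      have ih := ih (by omega)
      -- This leaves a decrease of (5/24)ηg, of which 1/8 is kept.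
      have h1 := lyapunov_step (θ := 1 / 96) hp hη (hg t) hb (by linarith) (he' t (by omega))
        (hΞ' t (by omega))
      rw [Finset.sum_range_succ]
      push_cast
      have h2 : 0 ≤ p * (b * Ξ t) := mul_nonneg hp.le (mul_nonneg hb0 (hΞ t))
      have h3 : 0 ≤ η * g t := mul_nonneg hη (hg t)
      linarith
  have h1 := main T le_rfl
  have h2 : 0 ≤ b * Ξ T := mul_nonneg hb0 (hΞ T)
  linarith

/-! ### Stepsizes and rates -/

section Steps

variable {n : ℕ} {p P M L c η τ : ℝ}

/-- Each entry of `stepConst` secures one stepsize condition: the square root controls the consensus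
recursion, 2p gives ηL ≤ 1, and 4pM/n gives ηLM/n ≤ 1/4. -/
theorem sq_le_of_stepConst_le (hp : 0 < p) (hp1 : p ≤ 1) (hM : 0 ≤ M)
    (hc : stepConst n p P M ≤ c) :
    48 * (1 - p) * (3 * max 1 P + p * M) ≤ c ^ 2 := by
  have h1 : 4 * Real.sqrt (3 * (1 - p) * (3 * max 1 P + p * M)) ≤ c := (le_max_left _ _).trans hc
  have hP : 1 ≤ max 1 P := le_max_left _ _
  have h2 : 0 ≤ 3 * (1 - p) * (3 * max 1 P + p * M) := by
    have : 0 ≤ 1 - p := by linarith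
    positivity
  have h3 : (4 * Real.sqrt (3 * (1 - p) * (3 * max 1 P + p * M))) ^ 2 ≤ c ^ 2 := by gcongr
  rw [mul_pow, Real.sq_sqrt h2] at h3
  linarith

theorem two_mul_le_of_stepConst_le (hc : stepConst n p P M ≤ c) : 2 * p ≤ c :=
  ((le_max_left _ _).trans (le_max_right _ _)).trans hc

-- τ is 1 for the decreasing stepsizes and 1/2 for the constant one, which lowers the coefficient
-- p/24 in the consensus feedback to p/96.
variable (hp : 0 < p) (hp1 : p ≤ 1) (hM : 0 ≤ M) (hL : 0 < L) (hη : 0 ≤ η)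
  (hc : stepConst n p P M ≤ c) (hτ1 : τ ≤ 1) (hηc : η * (c * L) ≤ τ * p)

include hp hL hη hc hτ1 hηc in
theorem step_mul_smooth_le : η * L ≤ 1 := by
  have h1 := mul_le_mul_of_nonneg_left (two_mul_le_of_stepConst_le hc)
    (by positivity : 0 ≤ η * L)
  have h2 : τ * p ≤ 1 * p := by gcongr
  have h3 : p * (η * L) ≤ p * 1 := by linarith [mul_nonneg hp.le (mul_nonneg hη hL.le)]
  exact le_of_mul_le_mul_left h3 hp

include hp hL hη hc hτ1 hηc in
theorem step_mul_noise_le : η * (L * M / n) ≤ 1 / 4 := by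
  have h0 : 4 * p * M / n ≤ c := ((le_max_right _ _).trans (le_max_right _ _)).trans hc
  have h1 := mul_le_mul_of_nonneg_left h0 (by positivity : 0 ≤ η * L)
  have h2 : τ * p ≤ 1 * p := by gcongr
  have h3 : p * (η * (L * M / n)) ≤ p * (1 / 4) := by
    have : η * L * (4 * p * M / n) = 4 * (p * (η * (L * M / n))) := by ring
    linarith
  exact le_of_mul_le_mul_left h3 hp

include hp hp1 hM hL hη hc hηc in
theorem step_sq_le :
    48 * (1 - p) * (3 * max 1 P + p * M) * (η * L) ^ 2 ≤ (τ * p) ^ 2 := by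
  have h1 := mul_le_mul_of_nonneg_right (sq_le_of_stepConst_le hp hp1 hM hc) (sq_nonneg (η * L))
  have hc0 : 0 ≤ c := by linarith [two_mul_le_of_stepConst_le hc]
  have h2 : (η * (c * L)) ^ 2 ≤ (τ * p) ^ 2 := by gcongr
  linarith

include hp hp1 hM hL hη hc hηc in
theorem step_coeff_le :
    L ^ 2 * (2 * (1 - p) / p * (3 * max 1 P + p * M)) * η ^ 2 ≤ τ ^ 2 * p / 24 := by
  have h1 := step_sq_le hp hp1 hM hL hη hc hηc
  have h2 : L ^ 2 * (2 * (1 - p) / p * (3 * max 1 P + p * M)) * η ^ 2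
      = 48 * (1 - p) * (3 * max 1 P + p * M) * (η * L) ^ 2 / (24 * p) := by field_simp; ring
  rw [h2, div_le_iff₀ (by positivity)]
  linarith

end Steps

theorem mixingHeterogeneity_nonneg {n : ℕ} (G : SimpleGraph (Fin n)) [DecidableRel G.Adj]
    (W : Matrix (Fin n) (Fin n) ℝ) : 0 ≤ mixingHeterogeneity G W := by
  unfold mixingHeterogeneity
  refine div_nonneg (Finset.sum_nonneg fun i _ => Finset.sum_nonneg fun k _ => ?_)
    (mul_nonneg zero_le_two (Finset.sum_nonneg fun i _ => Finset.sum_nonneg fun k _ => ?_))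
  · split_ifs
    · exact Finset.sum_nonneg fun _ _ => sq_nonneg _
    · exact le_rfl
  · split_ifs <;> norm_num

theorem distToAverageSq_nonneg {n : ℕ} (W : Matrix (Fin n) (Fin n) ℝ) : 0 ≤ distToAverageSq W :=
  Finset.sum_nonneg fun _ _ => Finset.sum_nonneg fun _ _ => sq_nonneg _

/-! ### Convergence rates before inserting the variances -/

section Rates

variable {n d m T : ℕ} {X : Type*} {G : SimpleGraph (Fin n)} [DecidableRel G.Adj]
  {l : Param d → X → ℝ} {D : Fin n → Fin m → X} {W : Matrix (Fin n) (Fin n) ℝ}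
  {L P M sigma zeta p : ℝ}

/-- A gradient step of length 1/L decreases the loss by at least ‖g‖²/(2L), and it cannot pass below
the infimum. -/
theorem norm_gradient_sq_le (h : LossAssumptions l D L P M sigma zeta) (hn : 0 < n) (hL : 0 < L)
    (x : Param d) :
    ‖∇ (globalLoss l D) x‖ ^ 2 ≤ 2 * L * (globalLoss l D x - lossInf l D) := by
  set g := ∇ (globalLoss l D) x with hg
  have h1 := le_add_inner_gradient (differentiable_globalLoss h)
    (lipschitz_gradient_globalLoss h hn) x (x - (1 / L) • g)
  have h2 := lossInf_le h (x - (1 / L) • g)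
  have e : x - (1 / L) • g - x = -((1 / L) • g) := by abel
  rw [e, norm_neg, norm_smul, inner_neg_right, inner_smul_right, ← hg, real_inner_self_eq_norm_sq,
    Real.norm_of_nonneg (by positivity)] at h1
  have h3 : L / 2 * (1 / L * ‖g‖) ^ 2 = 1 / L * ‖g‖ ^ 2 / 2 := by field_simp
  rw [h3] at h1
  have h4 : 1 / L * ‖g‖ ^ 2 ≤ 2 * (globalLoss l D x - lossInf l D) := by linarith
  have h5 := mul_le_mul_of_nonneg_left h4 hL.le
  have h6 : L * (1 / L * ‖g‖ ^ 2) = ‖g‖ ^ 2 := by field_simp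
  linarith

variable [NeZero m] {vcor vcdp : ℝ} {κ : Param d → Param d}

variable (h : LossAssumptions l D L P M sigma zeta) (hn : 0 < n) (hL : 0 < L) (hM : 0 ≤ M)
  (hW : IsMixingMatrix d G W p) (hcor : 0 ≤ vcor) (hcdp : 0 ≤ vcdp)
  (hκm : Measurable κ)
  (hκ : ∀ i j x, κ (∇ (fun y => l y (D i j)) x) = ∇ (fun y => l y (D i j)) x)
  (x0 : Fin n → Param d)

include h hn hL hM hκm hκ in
theorem meanGradSq_le (eta : ℕ → ℝ) {t : ℕ} (ht : t ≤ T) :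
    meanGradSq G κ l W eta x0 D T vcor vcdp t
      ≤ 2 * L * (meanLoss G κ l W eta x0 D T vcor vcdp t - lossInf l D) := by
  have := isProbabilityMeasure_iterateLaw (G := G) (l := l) (W := W) (D := D) (T := T)
    (vcor := vcor) (vcdp := vcdp) hκm eta x0 t
  have hi := integrable_globalLoss_iterateLaw (G := G) (W := W) (vcor := vcor) (vcdp := vcdp)
      h hn hL hM hκm hκ eta x0 ht
  have h1 := integral_mono (integrable_gradSq_iterateLaw (G := G) (W := W) (vcor := vcor)
    (vcdp := vcdp) h hn hL hM hκm hκ eta x0 ht)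
    ((hi.sub (integrable_const (lossInf l D))).const_mul (2 * L))
    fun x => norm_gradient_sq_le h hn hL (average x)
  rw [integral_const_mul] at h1
  simp only [Pi.sub_apply] at h1
  rw [integral_sub hi (integrable_const _)] at h1
  simpa [meanLoss, meanGradSq] using h1

include h hn hL hM hW hcor hcdp hκm hκ

theorem meanLoss_pl_le (hT : 0 < T) {mu c : ℝ} (hmu : 0 < mu) (hPL : IsPL l D mu)
    (hc : stepConst n p P M ≤ c) (hcmu : mu ≤ c * L) :
    meanLoss G κ l W (stepPL mu L p c) x0 D T vcor vcdp T - lossInf l D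
      ≤ (16 * c * L / (mu * p)) ^ 2
          * (globalLoss l D (average x0) - lossInf l D
            + 4 * (p / (c * L)) * L ^ 2 / p * consensusDist x0) / T ^ 2
        + 512 * (L * (sigma ^ 2 + d * vcdp) / (2 * n)) / (mu ^ 2 * T)
        + 8192 * (4 * L ^ 2 / p * ((1 - p) * (6 * zeta ^ 2 / p + sigma ^ 2)
          + d / n * (2 * vcor * (mixingHeterogeneity G W * G.edgeFinset.card)
            + vcdp * distToAverageSq W))) * Real.log (T + 1) / (mu ^ 3 * T ^ 2) := by
  have hp := hW.rate_pos
  have hp1 := hW.rate_le_one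
  have hq : 0 ≤ 1 - p := by linarith
  set ν := (1 - p) * (6 * zeta ^ 2 / p + sigma ^ 2)
          + d / n * (2 * vcor * (mixingHeterogeneity G W * G.edgeFinset.card)
            + vcdp * distToAverageSq W) with hν
  have hν0 : 0 ≤ ν := by
    have := mixingHeterogeneity_nonneg G W
    have := distToAverageSq_nonneg W
    positivity
  have hn' : (0 : ℝ) < n := by exact_mod_cast hn
  set k := 16 * c * L / (mu * p) with hk
  have hc0 : 0 < c := by linarith [two_mul_le_of_stepConst_le hc]
  have hk16 : 16 ≤ k := by
    rw [hk, le_div_iff₀ (by positivity)]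
    have := mul_le_mul_of_nonneg_left hp1 hmu.le
    linarith
  have heta : ∀ t : ℕ, stepPL mu L p c t = 16 / (mu * (t + k)) := fun t => rfl
  have heta0 : ∀ t, 0 ≤ stepPL mu L p c t := fun t => by rw [heta]; positivity
  have hanti : ∀ t s : ℕ, t ≤ s → stepPL mu L p c s ≤ stepPL mu L p c t := fun t s hts => by
    rw [heta, heta]
    have : (t : ℝ) ≤ s := by exact_mod_cast hts
    gcongr
  have hfirst : stepPL mu L p c 0 = p / (c * L) := by
    rw [heta, hk]; push_cast; field_simp; ring
  have hle : ∀ t, stepPL mu L p c t * (c * L) ≤ 1 * p := fun t => by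
    have h1 := hanti 0 t (Nat.zero_le t)
    rw [hfirst, le_div_iff₀ (by positivity)] at h1
    linarith
  -- The consensus weight follows the current stepsize and so decreases along the run.
  let V : ℕ → ℝ := fun t => (meanLoss G κ l W (stepPL mu L p c) x0 D T vcor vcdp t - lossInf l D)
    + 4 * stepPL mu L p c t * L ^ 2 / p
      * meanConsensus G κ l W (stepPL mu L p c) x0 D T vcor vcdp t
  have hexc : ∀ t ≤ T,
      0 ≤ meanLoss G κ l W (stepPL mu L p c) x0 D T vcor vcdp t - lossInf l D := fun t ht =>
    sub_nonneg.2 (lossInf_le_meanLoss h hn hL hM hκm hκ _ x0 ht)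
  have hΞ : ∀ t, 0 ≤ meanConsensus G κ l W (stepPL mu L p c) x0 D T vcor vcdp t := fun t =>
    meanConsensus_nonneg _ x0 t
  have hb : ∀ t, 0 ≤ 4 * stepPL mu L p c t * L ^ 2 / p := fun t => by
    have := heta0 t
    positivity
  have key := le_of_decreasing_steps (V := V) (T := T) (mu := mu) (k := k)
    (α := L * (sigma ^ 2 + d * vcdp) / (2 * n)) (β := 4 * L ^ 2 / p * ν) hT hmu (by linarith)
    (by positivity) (by positivity)
    (fun t ht => add_nonneg (hexc t ht) (mul_nonneg (hb t) (hΞ t))) ?_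
  · have hV0 : V 0 = globalLoss l D (average x0) - lossInf l D
            + 4 * (p / (c * L)) * L ^ 2 / p * consensusDist x0 := by
      simp only [V, meanLoss_zero h, meanConsensus_zero, hfirst]
    rw [hV0] at key
    refine le_trans ?_ key
    exact le_add_of_nonneg_right (mul_nonneg (hb T) (hΞ T))
  · intro t ht
    rw [← heta t]
    have hs := lyapunov_step_pl hp (heta0 t) (hΞ t) (meanGradSq_nonneg _ x0 t) (hΞ (t + 1)) rfl
      (b' := 4 * stepPL mu L p c (t + 1) * L ^ 2 / p)
      (e' := meanLoss G κ l W (stepPL mu L p c) x0 D T vcor vcdp (t + 1) - lossInf l D)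
      (r := L * stepPL mu L p c t ^ 2 / (2 * n) * (sigma ^ 2 + d * vcdp))
      (by have := hanti t (t + 1) (Nat.le_succ t); gcongr)
      (by simpa using step_coeff_le hp hp1 hM hL (heta0 t) hc (hle t))
      (meanGradSq_ge_of_isPL h hn hL hM hκm hκ _ x0 ht.le hPL)
      (by have := mul_le_mul_of_nonneg_left hcmu (heta0 t); linarith [hle t])
      (by
        have := meanLoss_succ_le h hn hL hM hW hcor hcdp hκm hκ (stepPL mu L p c) x0 ht (heta0 t)
          (step_mul_smooth_le hp hL (heta0 t) hc le_rfl (hle t))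
          (step_mul_noise_le hp hL (heta0 t) hc le_rfl (hle t))
        linarith)
      (meanConsensus_succ_le h hn hL hM hW hcor hcdp hκm hκ (stepPL mu L p c) x0 ht
          (by simpa using step_sq_le hp hp1 hM hL (heta0 t) hc (hle t)))
    refine hs.trans_eq ?_
    simp only [V, ← hν]
    ring

theorem sum_meanGradSq_le {η c : ℝ} (hc : stepConst n p P M ≤ c) (hη : 0 ≤ η)
    (hηc : η * (c * L) ≤ 1 / 2 * p) :
    η / 8 * ∑ t ∈ Finset.range T, meanGradSq G κ l W (fun _ => η) x0 D T vcor vcdp t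
      ≤ (globalLoss l D (average x0) - lossInf l D) + 4 * η * L ^ 2 / p * consensusDist x0
        + T * (L * η ^ 2 / (2 * n) * (sigma ^ 2 + d * vcdp)
          + 4 * η * L ^ 2 / p * η ^ 2 * ((1 - p) * (6 * zeta ^ 2 / p + sigma ^ 2)
            + d / n * (2 * vcor * (mixingHeterogeneity G W * G.edgeFinset.card)
              + vcdp * distToAverageSq W))) := by
  have hp := hW.rate_pos
  have hp1 := hW.rate_le_one
  have key := sum_grad_le_of_constant_step (T := T) (p := p) (L := L) (η := η)
    (e := fun t => meanLoss G κ l W (fun _ => η) x0 D T vcor vcdp t - lossInf l D)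
    (Ξ := meanConsensus G κ l W (fun _ => η) x0 D T vcor vcdp)
    (g := meanGradSq G κ l W (fun _ => η) x0 D T vcor vcdp)
    hp hη (meanConsensus_nonneg _ x0) (meanGradSq_nonneg _ x0)
    (sub_nonneg.2 (lossInf_le_meanLoss h hn hL hM hκm hκ _ x0 le_rfl))
    (by linarith [step_coeff_le hp hp1 hM hL hη hc hηc])
    (r := L * η ^ 2 / (2 * n) * (sigma ^ 2 + d * vcdp))
    (fun t ht => by
      have := meanLoss_succ_le h hn hL hM hW hcor hcdp hκm hκ (fun _ => η) x0 ht hη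
          (step_mul_smooth_le hp hL hη hc (by norm_num) hηc)
          (step_mul_noise_le hp hL hη hc (by norm_num) hηc)
      linarith)
    (fun t ht => meanConsensus_succ_le h hn hL hM hW hcor hcdp hκm hκ (fun _ => η) x0 ht
          ((step_sq_le hp hp1 hM hL hη hc hηc).trans (by nlinarith)))
  simpa only [meanLoss_zero h, meanConsensus_zero] using key

/-- With stepsize zero a minimizing initial average stays minimizing. -/
theorem meanGradSq_eq_zero_of_step_zero (hf0 : globalLoss l D (average x0) - lossInf l D = 0)
    {t : ℕ} (ht : t ≤ T) : meanGradSq G κ l W (fun _ => 0) x0 D T vcor vcdp t = 0 := by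
  have hmono : ∀ t ≤ T, meanLoss G κ l W (fun _ => 0) x0 D T vcor vcdp t ≤ lossInf l D := by
    intro t
    induction t with
    | zero => intro _; rw [meanLoss_zero h]; linarith
    | succ t ih =>
      intro ht
      have := meanLoss_succ_le h hn hL hM hW hcor hcdp hκm hκ (fun _ => 0) x0
        (Nat.lt_of_succ_le ht) le_rfl (by simp) (by simp)
      simp only [zero_div, zero_mul, mul_zero, sub_zero, add_zero, ne_eq, OfNat.ofNat_ne_zero,
        not_false_eq_true, zero_pow] at this
      exact this.trans (ih (by omega))
  have h1 := meanGradSq_le (G := G) (W := W) (vcor := vcor) (vcdp := vcdp)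
    h hn hL hM hκm hκ x0 (fun _ => 0) ht
  refine le_antisymm (h1.trans ?_) (meanGradSq_nonneg _ x0 t)
  exact mul_nonpos_of_nonneg_of_nonpos (by positivity) (by linarith [hmono t ht])

end Rates

/-! ### Inserting the noise variances and collecting constants -/

theorem sqrt_add_le_add_sqrt {x y : ℝ} (hx : 0 ≤ x) (hy : 0 ≤ y) :
    Real.sqrt (x + y) ≤ Real.sqrt x + Real.sqrt y := by
  refine Real.sqrt_le_iff.2 ⟨by positivity, ?_⟩
  rw [add_sq, Real.sq_sqrt hx, Real.sq_sqrt hy]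
  have : 0 ≤ 2 * Real.sqrt x * Real.sqrt y := by positivity
  linarith

/-- Both variances are proportional to T, which cancels one factor 1/T in the noise terms. The
constant is 2^21 = 8192 · 4 · 2 · 32, the coefficient of the edge-noise term; the other terms need
less. -/
theorem pl_rate_algebra {N r a d T L C lam eps mu p c f0 Ξ0 sigma zeta HE ω lg : ℝ}
    (hN : 1 ≤ N) (hr : 0 < r) (ha : 0 < a) (hd : 0 ≤ d) (hT : 0 < T) (hL : 0 < L)
    (hlam : 0 ≤ lam) (heps : 0 < eps) (hmu : 0 < mu) (hp : 0 < p) (hp1 : p ≤ 1) (hc : 0 < c)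
    (hf0 : 0 ≤ f0) (hΞ0 : 0 ≤ Ξ0) (hω : 0 ≤ ω) (hlg : 0 ≤ lg) :
    (16 * c * L / (mu * p)) ^ 2 * (f0 + 4 * (p / (c * L)) * L ^ 2 / p * Ξ0) / T ^ 2
        + 512 * (L * (sigma ^ 2 + d * (32 * C ^ 2 * T * lam / (r * eps ^ 2))) / (2 * N))
          / (mu ^ 2 * T)
        + 8192 * (4 * L ^ 2 / p * ((1 - p) * (6 * zeta ^ 2 / p + sigma ^ 2)
          + d / N * (2 * (32 * C ^ 2 * T * lam / (a * eps ^ 2)) * HE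
            + 32 * C ^ 2 * T * lam / (r * eps ^ 2) * ω))) * lg / (mu ^ 3 * T ^ 2)
      ≤ 2097152 * (L * C ^ 2 * d * lam / (mu ^ 2 * N * r * eps ^ 2)
          + L / (mu ^ 2 * N * T) * (sigma ^ 2
            + lg * (L * C ^ 2 * d * lam / (mu * p * eps ^ 2)) * (HE / a + N / r * ω))
          + L ^ 2 / (mu ^ 3 * p ^ 2 * T ^ 2) * (lg * (1 - p) * (zeta ^ 2 + p * sigma ^ 2)
            + c ^ 2 * mu * f0 + c * mu * L * Ξ0)) := by
  have hN0 : 0 < N := by linarith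
  have hq : 0 ≤ 1 - p := by linarith
  have e1 : (16 * c * L / (mu * p)) ^ 2 * (f0 + 4 * (p / (c * L)) * L ^ 2 / p * Ξ0) / T ^ 2
      = 256 * (L ^ 2 / (mu ^ 3 * p ^ 2 * T ^ 2) * (c ^ 2 * mu * f0))
        + 1024 * (L ^ 2 / (mu ^ 3 * p ^ 2 * T ^ 2) * (c * mu * L * Ξ0)) := by
    field_simp; ring
  have e2 : 512 * (L * (sigma ^ 2 + d * (32 * C ^ 2 * T * lam / (r * eps ^ 2))) / (2 * N))
          / (mu ^ 2 * T)
      = 256 * (L / (mu ^ 2 * N * T) * sigma ^ 2)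
        + 8192 * (L * C ^ 2 * d * lam / (mu ^ 2 * N * r * eps ^ 2)) := by
    field_simp; ring
  have e3 : 8192 * (4 * L ^ 2 / p * ((1 - p) * (6 * zeta ^ 2 / p + sigma ^ 2)
          + d / N * (2 * (32 * C ^ 2 * T * lam / (a * eps ^ 2)) * HE
            + 32 * C ^ 2 * T * lam / (r * eps ^ 2) * ω))) * lg / (mu ^ 3 * T ^ 2)
      = 196608 * (L ^ 2 / (mu ^ 3 * p ^ 2 * T ^ 2) * (lg * (1 - p) * zeta ^ 2))
        + 32768 * (L ^ 2 / (mu ^ 3 * p ^ 2 * T ^ 2) * (lg * (1 - p) * (p * sigma ^ 2)))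
        + 2097152 * (L / (mu ^ 2 * N * T)
          * (lg * (L * C ^ 2 * d * lam / (mu * p * eps ^ 2)) * (HE / a)))
        + 1048576 * (L / (mu ^ 2 * N * T)
          * (lg * (L * C ^ 2 * d * lam / (mu * p * eps ^ 2)) * (1 / r * ω))) := by
    field_simp; ring
  -- The computation yields ω/r; the factor N ≥ 1 is slack.
  have b1 : L / (mu ^ 2 * N * T)
          * (lg * (L * C ^ 2 * d * lam / (mu * p * eps ^ 2)) * (1 / r * ω))
      ≤ L / (mu ^ 2 * N * T)
          * (lg * (L * C ^ 2 * d * lam / (mu * p * eps ^ 2)) * (N / r * ω)) := by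
    gcongr
  have p1 : 0 ≤ L ^ 2 / (mu ^ 3 * p ^ 2 * T ^ 2) * (c ^ 2 * mu * f0) := by positivity
  have p2 : 0 ≤ L ^ 2 / (mu ^ 3 * p ^ 2 * T ^ 2) * (c * mu * L * Ξ0) := by positivity
  have p3 : 0 ≤ L / (mu ^ 2 * N * T) * sigma ^ 2 := by positivity
  have p4 : 0 ≤ L * C ^ 2 * d * lam / (mu ^ 2 * N * r * eps ^ 2) := by positivity
  have p5 : 0 ≤ L ^ 2 / (mu ^ 3 * p ^ 2 * T ^ 2) * (lg * (1 - p) * zeta ^ 2) := by positivity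
  have p6 : 0 ≤ L ^ 2 / (mu ^ 3 * p ^ 2 * T ^ 2) * (lg * (1 - p) * (p * sigma ^ 2)) := by
    positivity
  have p7 : 0 ≤ L / (mu ^ 2 * N * T)
          * (lg * (L * C ^ 2 * d * lam / (mu * p * eps ^ 2)) * (1 / r * ω)) := by positivity
  rw [e1, e2, e3]
  linarith

/-- R balances f0/(TR) against LsR/N; both equal √(L f0 s/(NT)). The minimum is handled by 1/η ≤ B +
1/(2R) and η ≤ 2R. -/
theorem nc_step_algebra {N T L s f0 B : ℝ} (hN : 0 < N) (hT : 0 < T) (hL : 0 < L) (hs : 0 < s)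
    (hf0 : 0 < f0) (hB : 0 < B) :
    let η := min (1 / B) (2 * Real.sqrt (f0 * N / (L * T * s)))
    0 < η ∧ 8 * f0 / (η * T) + 4 * L * η * s / N
        ≤ 8 * f0 * B / T + 12 * Real.sqrt (L * f0 * s / (N * T))
      ∧ η ^ 2 ≤ 4 * (f0 * N / (L * T * s)) := by
  intro η
  set R := Real.sqrt (f0 * N / (L * T * s)) with hR
  have hR0 : 0 < R := Real.sqrt_pos.2 (by positivity)
  have hR2 : R ^ 2 = f0 * N / (L * T * s) := Real.sq_sqrt (by positivity)
  have hη : 0 < η := lt_min (by positivity) (by positivity)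
  have hη2 : η ≤ 2 * R := min_le_right _ _
  have hY : Real.sqrt (L * f0 * s / (N * T)) = L * s / N * R := by
    rw [show L * f0 * s / (N * T) = (L * s / N * R) ^ 2 by rw [mul_pow, hR2]; field_simp]
    exact Real.sqrt_sq (by positivity)
  have hf : f0 / (T * R) = L * s / N * R := by
    rw [div_eq_iff (by positivity)]
    have : L * s / N * R * (T * R) = L * s / N * T * R ^ 2 := by ring
    rw [this, hR2]; field_simp
  have hinv : 1 / η ≤ B + 1 / (2 * R) := by
    rcases min_choice (1 / B) (2 * R) with h | h
    · have : η = 1 / B := h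
      rw [this, one_div_one_div]
      have : 0 < 1 / (2 * R) := by positivity
      linarith
    · have : η = 2 * R := h
      rw [this]
      linarith
  refine ⟨hη, ?_, ?_⟩
  · have h1 : 8 * f0 / (η * T) = 8 * f0 / T * (1 / η) := by field_simp
    have h2 : 8 * f0 / T * (1 / η) ≤ 8 * f0 / T * (B + 1 / (2 * R)) := by gcongr
    have h3 : 8 * f0 / T * (B + 1 / (2 * R)) = 8 * f0 * B / T + 4 * (f0 / (T * R)) := by
      field_simp; ring
    have h4 : 4 * L * η * s / N ≤ 4 * L * (2 * R) * s / N := by gcongr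
    have h5 : 4 * L * (2 * R) * s / N = 8 * (L * s / N * R) := by ring
    rw [hY]
    rw [hf] at h3
    linarith
  · calc η ^ 2 ≤ (2 * R) ^ 2 := by gcongr
      _ = 4 * (f0 * N / (L * T * s)) := by rw [mul_pow, hR2]; norm_num

theorem nc_rate_algebra {N r a d T L C lam eps p c f0 Ξ0 sigma zeta HE ω S : ℝ}
    (hN : 1 ≤ N) (hr : 0 < r) (ha : 0 < a) (hd : 0 < d) (hT : 0 < T) (hL : 0 < L) (hC : 0 < C)
    (hlam : 0 < lam) (heps : 0 < eps) (hp : 0 < p) (hp1 : p ≤ 1) (hc : 0 < c)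
    (hf0 : 0 < f0) (hΞ0 : 0 ≤ Ξ0) (hHE : 0 ≤ HE) (hω : 0 ≤ ω) {vcdp vcor η : ℝ}
    (hvcdp : vcdp = 32 * C ^ 2 * T * lam / (r * eps ^ 2))
    (hvcor : vcor = 32 * C ^ 2 * T * lam / (a * eps ^ 2))
    (hη : η = min (p / (2 * c * L)) (2 * Real.sqrt (f0 * N / (L * T * (sigma ^ 2 + d * vcdp)))))
    (hS : η / 8 * S ≤ f0 + 4 * η * L ^ 2 / p * Ξ0
        + T * (L * η ^ 2 / (2 * N) * (sigma ^ 2 + d * vcdp)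
          + 4 * η * L ^ 2 / p * η ^ 2 * ((1 - p) * (6 * zeta ^ 2 / p + sigma ^ 2)
            + d / N * (2 * vcor * HE + vcdp * ω)))) :
    1 / T * S ≤ 2097152 * (C * Real.sqrt (L * f0 * d * lam) / (Real.sqrt (N * r) * eps)
        + Real.sqrt (L * f0 * sigma ^ 2 / (N * T)) + c * L * f0 / (p * T)
        + L ^ 2 / (p * T) * Ξ0
        + L * f0 * N / (p * T) * ((1 - p) * (zeta ^ 2 / p + sigma ^ 2) / (sigma ^ 2 + d * vcdp)
          + r * HE / (N * a) + ω)) := by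
  have hN0 : 0 < N := by linarith
  have hq : 0 ≤ 1 - p := by linarith
  have hv : 0 < vcdp := by rw [hvcdp]; positivity
  have hw : 0 < vcor := by rw [hvcor]; positivity
  have hdv : d * vcdp ≤ sigma ^ 2 + d * vcdp := by linarith [sq_nonneg sigma]
  -- The factor 6 comes from 32 ≤ 6².
  have hsqrt : Real.sqrt (L * f0 * (sigma ^ 2 + d * vcdp) / (N * T))
      ≤ Real.sqrt (L * f0 * sigma ^ 2 / (N * T))
        + 6 * (C * Real.sqrt (L * f0 * d * lam) / (Real.sqrt (N * r) * eps)) := by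
    have h1 : L * f0 * (sigma ^ 2 + d * vcdp) / (N * T)
        = L * f0 * sigma ^ 2 / (N * T) + L * f0 * (d * vcdp) / (N * T) := by ring
    rw [h1]
    refine (sqrt_add_le_add_sqrt (by positivity) (by positivity)).trans (add_le_add le_rfl ?_)
    refine Real.sqrt_le_iff.2 ⟨by positivity, ?_⟩
    rw [mul_pow, div_pow, mul_pow, mul_pow, Real.sq_sqrt (by positivity),
      Real.sq_sqrt (by positivity), hvcdp]
    have h2 : L * f0 * (d * (32 * C ^ 2 * T * lam / (r * eps ^ 2))) / (N * T)
        = 32 * (C ^ 2 * (L * f0 * d * lam) / (N * r * eps ^ 2)) := by field_simp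
    rw [h2]
    gcongr
    norm_num
  set s := sigma ^ 2 + d * vcdp with hs
  have hs0 : 0 < s := lt_of_lt_of_le (by positivity) hdv
  obtain ⟨hη0, h1, h2⟩ := nc_step_algebra hN0 hT hL hs0 hf0
    (by positivity : 0 < 2 * c * L / p)
  rw [one_div_div, ← hη] at hη0 h1 h2
  set ν := (1 - p) * (6 * zeta ^ 2 / p + sigma ^ 2) + d / N * (2 * vcor * HE + vcdp * ω) with hν
  have hν0 : 0 ≤ ν := by positivity
  have hbound : 1 / T * S ≤ 8 * f0 / (η * T) + 4 * L * η * s / N + 32 * (L ^ 2 / (p * T) * Ξ0)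
      + 32 * (L ^ 2 * η ^ 2 * ν / p) := by
    have h3 : 1 / T * S = 8 / (η * T) * (η / 8 * S) := by field_simp
    rw [h3]
    refine (mul_le_mul_of_nonneg_left hS (by positivity)).trans_eq ?_
    field_simp
    ring
  -- The second bound on η turns the consensus noise into a ratio ν/s. In it s ≥ d σ_cdp² cancels
  -- the private variance and leaves only graph quantities.
  have hlast : L ^ 2 * η ^ 2 * ν / p ≤ 4 * (L * f0 * N / (p * T) * (ν / s)) := by
    calc L ^ 2 * η ^ 2 * ν / p ≤ L ^ 2 * (4 * (f0 * N / (L * T * s))) * ν / p := by gcongr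
      _ = 4 * (L * f0 * N / (p * T) * (ν / s)) := by field_simp
  have hνs : ν / s ≤ 6 * ((1 - p) * (zeta ^ 2 / p + sigma ^ 2) / s + r * HE / (N * a) + ω) := by
    have h3 : (1 - p) * (6 * zeta ^ 2 / p + sigma ^ 2)
        ≤ 6 * ((1 - p) * (zeta ^ 2 / p + sigma ^ 2)) := by
      have : 0 ≤ (1 - p) * sigma ^ 2 := by positivity
      have e : (1 - p) * (6 * zeta ^ 2 / p + sigma ^ 2)
        = 6 * ((1 - p) * (zeta ^ 2 / p)) + (1 - p) * sigma ^ 2 := by ring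
      rw [e]; linarith
    have h4 : d / N * (2 * vcor * HE + vcdp * ω) / s
        ≤ d / N * (2 * vcor * HE + vcdp * ω) / (d * vcdp) := by gcongr
    have h5 : d / N * (2 * vcor * HE + vcdp * ω) / (d * vcdp)
        = 2 * (r * HE / (N * a)) + ω / N := by
      rw [hvcor, hvcdp]; field_simp
    have h6 : ω / N ≤ ω := div_le_self hω hN
    have h7 : (1 - p) * (6 * zeta ^ 2 / p + sigma ^ 2) / s
        ≤ 6 * ((1 - p) * (zeta ^ 2 / p + sigma ^ 2) / s) := by
      rw [← mul_div_assoc 6 ((1 - p) * (zeta ^ 2 / p + sigma ^ 2))]; gcongr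
    have h8 : 0 ≤ r * HE / (N * a) := by positivity
    rw [hν, add_div]
    linarith
  have hlast' : L * f0 * N / (p * T) * (ν / s) ≤ L * f0 * N / (p * T)
      * (6 * ((1 - p) * (zeta ^ 2 / p + sigma ^ 2) / s + r * HE / (N * a) + ω)) := by gcongr
  have q1 : 8 * f0 * (2 * c * L / p) / T = 16 * (c * L * f0 / (p * T)) := by field_simp; ring
  rw [q1] at h1
  have p1 : 0 ≤ C * Real.sqrt (L * f0 * d * lam) / (Real.sqrt (N * r) * eps) := by positivity
  have p2 : 0 ≤ Real.sqrt (L * f0 * sigma ^ 2 / (N * T)) := by positivity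
  have p3 : 0 ≤ c * L * f0 / (p * T) := by positivity
  have p4 : 0 ≤ L ^ 2 / (p * T) * Ξ0 := by positivity
  have p5 : 0 ≤ L * f0 * N / (p * T)
      * ((1 - p) * (zeta ^ 2 / p + sigma ^ 2) / s + r * HE / (N * a) + ω) := by positivity
  linarith

theorem clip_of_norm_le {d : ℕ} {C : ℝ} {g : Param d} (h : ‖g‖ ≤ C) : clip C g = g := by
  rcases eq_or_ne g 0 with rfl | hg
  · simp [clip]
  · rw [clip, min_eq_left ((one_le_div (norm_pos_iff.2 hg)).2 h), one_smul]

end Decor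

end

/-! ### Assembly of privacy and utility -/

theorem mainTheorem3 :
    ∃ K : ℝ, 0 < K ∧
      ∀ (n d m T q : ℕ) (X : Type*) (G : SimpleGraph (Fin n)) [DecidableRel G.Adj]
        (l : Decor.Param d → X → ℝ) (W : Matrix (Fin n) (Fin n) ℝ)
        (x0 : Fin n → Decor.Param d) (C p eps delta : ℝ),
        0 < m → 0 < T → 0 < C → 0 < eps → 0 < delta → delta < 1 →
        eps ≤ Real.log (1 / delta) →
        Decor.IsKConnected (q + 1) G →
        Decor.IsMixingMatrix d G W p →
        -- privacy, for arbitrary stepsizes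
        (∀ eta : ℕ → ℝ,
          Decor.DecorSecLDP (m := m) (T := T) G q C l W eta x0
            (Decor.varCor G q T C eps delta) (Decor.varCdp n q T C eps delta) eps delta) ∧
        -- utility
        (∀ (D : Fin n → Fin m → X) (L P M sigma zeta : ℝ) (κ : Decor.Param d → Decor.Param d),
          0 < L → 0 ≤ M →
          Decor.LossAssumptions l D L P M sigma zeta →
          -- clipping with bounded gradients, or no clipping
          ((κ = Decor.clip C ∧ ∀ i j x, ‖gradient (fun y => l y (D i j)) x‖ ≤ C) ∨ κ = id) →
          let vcdp : ℝ := Decor.varCdp n q T C eps delta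
          let law := Decor.fullLaw G m T d (Decor.varCor G q T C eps delta) vcdp
          let f : Decor.Param d → ℝ := Decor.globalLoss l D
          let f0 : ℝ := f (Decor.average x0) - Decor.lossInf l D
          let Xi0 : ℝ := Decor.consensusDist x0
          let HE : ℝ := Decor.mixingHeterogeneity G W * G.edgeFinset.card
          let a : ℝ := Decor.minAlgConn q G
          -- the PL case
          (∀ mu : ℝ, 0 < mu → Decor.IsPL l D mu →
            let c : ℝ := max (Decor.stepConst n p P M) (mu / L)
            let eta : ℕ → ℝ := Decor.stepPL mu L p c
            Integrable
              (fun w => f (Decor.average (Decor.iterate G κ l W eta x0 D w.1 w.2 T))) law ∧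
            (∫ w, f (Decor.average (Decor.iterate G κ l W eta x0 D w.1 w.2 T)) ∂law)
                - Decor.lossInf l D ≤
              K * (L * C ^ 2 * d * Real.log (1 / delta) / (mu ^ 2 * n * ((n : ℝ) - q) * eps ^ 2)
                + L / (mu ^ 2 * n * T) *
                    (sigma ^ 2 + Real.log (T + 1) *
                      (L * C ^ 2 * d * Real.log (1 / delta) / (mu * p * eps ^ 2)) *
                      (HE / a + n / ((n : ℝ) - q) * Decor.distToAverageSq W))
                + L ^ 2 / (mu ^ 3 * p ^ 2 * T ^ 2) *
                    (Real.log (T + 1) * (1 - p) * (zeta ^ 2 + p * sigma ^ 2)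
                      + c ^ 2 * mu * f0 + c * mu * L * Xi0))) ∧
          -- the non-convex case
          (let c : ℝ := Decor.stepConst n p P M
           let eta : ℕ → ℝ := fun _ => Decor.stepNC n d T L p c f0 sigma vcdp
           (∀ t < T, Integrable (fun w => ‖gradient f
              (Decor.average (Decor.iterate G κ l W eta x0 D w.1 w.2 t))‖ ^ 2) law) ∧
            (1 / (T : ℝ)) * ∑ t ∈ Finset.range T, (∫ w, ‖gradient f
                (Decor.average (Decor.iterate G κ l W eta x0 D w.1 w.2 t))‖ ^ 2 ∂law) ≤
              K * (C * Real.sqrt (L * f0 * d * Real.log (1 / delta))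
                    / (Real.sqrt (n * ((n : ℝ) - q)) * eps)
                + Real.sqrt (L * f0 * sigma ^ 2 / (n * T))
                + c * L * f0 / (p * T) + L ^ 2 / (p * T) * Xi0
                + L * f0 * n / (p * T) *
                    ((1 - p) * (zeta ^ 2 / p + sigma ^ 2) / (sigma ^ 2 + d * vcdp)
                      + ((n : ℝ) - q) * HE / (n * a) + Decor.distToAverageSq W)))) := by
  refine ⟨2097152, by norm_num, ?_⟩
  intro n d m T q X G _ l W x0 C p eps delta hm hT hC heps hdelta hdelta1 hle hG hW
  refine ⟨fun eta => Decor.decorSecLDP G l W eta x0 hm hT hC heps hdelta hle hG, ?_⟩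
  intro D L P M sigma zeta κ hL hM h hκ' vcdp law f f0 Xi0 HE a
  have : NeZero m := ⟨hm.ne'⟩
  have hqn : q + 1 < n := hG.lt
  have hn : 0 < n := by omega
  have hN : (1 : ℝ) ≤ n := by exact_mod_cast hn
  have hr : (0 : ℝ) < (n : ℝ) - q := by
    have : (q : ℝ) + 1 < n := by exact_mod_cast hqn
    linarith
  have ha : 0 < a := Decor.minAlgConn_pos hG
  have hT' : (0 : ℝ) < T := by exact_mod_cast hT
  have hlam : 0 < Real.log (1 / delta) := heps.trans_le hle
  have hp := hW.rate_pos
  have hp1 := hW.rate_le_one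
  have hκm : Measurable κ := by
    rcases hκ' with ⟨rfl, -⟩ | rfl
    · exact Decor.measurable_clip C
    · exact measurable_id
  have hκ : ∀ i j x, κ (gradient (fun y => l y (D i j)) x) = gradient (fun y => l y (D i j)) x := by
    rcases hκ' with ⟨rfl, hb⟩ | rfl
    · exact fun i j x => Decor.clip_of_norm_le (hb i j x)
    · exact fun _ _ _ => rfl
  have hcdp : 0 ≤ vcdp := by
    simp only [vcdp, Decor.varCdp]; positivity
  have hcor : 0 ≤ Decor.varCor G q T C eps delta := by
    have : 0 < Decor.minAlgConn q G := ha
    simp only [Decor.varCor]; positivity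
  have hf0 : 0 ≤ f0 := sub_nonneg.2 (Decor.lossInf_le h _)
  have hXi : 0 ≤ Xi0 := Decor.consensusDist_nonneg x0
  have hHE : 0 ≤ HE := mul_nonneg (Decor.mixingHeterogeneity_nonneg G W) (Nat.cast_nonneg _)
  have hω := Decor.distToAverageSq_nonneg W
  constructor
  · intro mu hmu hPL c eta
    have hc : Decor.stepConst n p P M ≤ c := le_max_left _ _
    have hcmu : mu ≤ c * L := (div_le_iff₀ hL).1 (le_max_right _ _)
    have hc0 : 0 < c := by linarith [Decor.two_mul_le_of_stepConst_le hc]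
    refine ⟨Decor.integrable_globalLoss_iterate h hn hL hM hκm hκ eta x0 le_rfl, ?_⟩
    have h1 := Decor.meanLoss_pl_le (T := T) h hn hL hM hW hcor hcdp hκm hκ x0 hT hmu hPL hc hcmu
    rw [← Decor.integral_globalLoss_iterate h hκm] at h1
    exact h1.trans (Decor.pl_rate_algebra hN hr ha (Nat.cast_nonneg d) hT' hL hlam.le heps hmu hp
      hp1 hc0 hf0 hXi hω (Real.log_nonneg (by linarith)))
  · intro c eta
    have hc0 : 0 < c := by
      linarith [Decor.two_mul_le_of_stepConst_le (le_refl (Decor.stepConst n p P M))]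
    refine ⟨fun t ht => Decor.integrable_gradSq_iterate h hn hL hM hκm hκ eta x0 ht.le, ?_⟩
    simp only [law, f, Decor.integral_gradSq_iterate hκm]
    have hrhs : 0 ≤ C * Real.sqrt (L * f0 * d * Real.log (1 / delta))
          / (Real.sqrt (n * ((n : ℝ) - q)) * eps)
        + Real.sqrt (L * f0 * sigma ^ 2 / (n * T))
        + c * L * f0 / (p * T) + L ^ 2 / (p * T) * Xi0
        + L * f0 * n / (p * T) *
          ((1 - p) * (zeta ^ 2 / p + sigma ^ 2) / (sigma ^ 2 + d * vcdp)
            + ((n : ℝ) - q) * HE / (n * a) + Decor.distToAverageSq W) := by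
      have : 0 ≤ 1 - p := by linarith
      positivity
    -- If f0 = 0 the stepsize is zero and the general argument, which divides by η, does not apply;
    -- the expected loss then stays at its infimum, so the gradients vanish.
    rcases hf0.eq_or_lt with hz | hf0'
    · have heta : eta = fun _ => 0 := by
        funext t
        simp only [eta, Decor.stepNC, ← hz, zero_mul, zero_div, Real.sqrt_zero, mul_zero]
        exact min_eq_right (by positivity)
      rw [heta, Finset.sum_eq_zero fun t ht => Decor.meanGradSq_eq_zero_of_step_zero h hn hL hM hW
        hcor hcdp hκm hκ x0 hz.symm (Finset.mem_range.1 ht).le, mul_zero]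
      exact mul_nonneg (by norm_num) hrhs
    -- For d = 0 the denominator σ⋆² + d σ_cdp² may be zero, but every gradient is zero as well.
    rcases Nat.eq_zero_or_pos d with rfl | hd
    · have hg : ∀ t, Decor.meanGradSq G κ l W eta x0 D T (Decor.varCor G q T C eps delta) vcdp t
          = 0 := fun t => by
        simp [Decor.meanGradSq, Subsingleton.elim _ (0 : Decor.Param 0)]
      rw [Finset.sum_eq_zero fun t _ => hg t, mul_zero]
      exact mul_nonneg (by norm_num) hrhs
    have hη0 : 0 ≤ Decor.stepNC n d T L p c f0 sigma vcdp :=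
      le_min (by positivity) (by positivity)
    have hηc : Decor.stepNC n d T L p c f0 sigma vcdp * (c * L) ≤ 1 / 2 * p := by
      have h1 : Decor.stepNC n d T L p c f0 sigma vcdp ≤ p / (2 * c * L) := min_le_left _ _
      rw [le_div_iff₀ (by positivity)] at h1
      linarith
    exact Decor.nc_rate_algebra hN hr ha (Nat.cast_pos.2 hd) hT' hL hC hlam heps hp hp1 hc0 hf0'
      hXi hHE hω rfl rfl rfl
      (Decor.sum_meanGradSq_le h hn hL hM hW hcor hcdp hκm hκ x0 le_rfl hη0 hηc)
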